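/- Let $V$ be a Euclidean vector space of dimension $d$, oriented by an orthonormal basis $(e_1,\dots,e_d)$, with coordinates $x_k=\langle e_k,x\rangle$. Let $\mathfrak{so}(V)$ be the Lie algebra of antisymmetric endomorphisms of $V$ and $R=\mathcal C^{\rm pol}(\mathfrak{so}(V))^{SO(V)}$ the ring of $SO(V)$-invariant polynomial functions on $\mathfrak{so}(V)$. For a space $\mathcal A$ of smooth differential forms on an invariant open set $U\subset V$, consider the $SO(V)$-equivariant polynomial maps $\alpha:\mathfrak{so}(V)\to\mathcal A$, i.e. the elements of $(\mathcal C^{\rm pol}(\mathfrak{so}(V))\otimes\mathcal A)^{SO(V)}$, with the differential $(D\alpha)(X)=d(\alpha(X))-\iota(VX)\alpha(X)$, where $V_xX=-Xx$. Taking for $\mathcal A$ the forms on $V$ with compact support, respectively the forms on $V$ all of whose partial derivatives are rapidly decreasing, gives the cohomologies $\mathcal H^{\rm pol}_{c}(\mathfrak{so}(V),V)$ and $\mathcal H^{\rm pol}_{\rm dec\text{-}rap}(\mathfrak{so}(V),V)$. The relative cohomology $\mathcal H^{\rm pol}(\mathfrak{so}(V),V,V\setminus\{0\})$ is that of the pairs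 $(\alpha,\beta)$ of equivariant polynomial forms on $V$ and on $V\setminus\{0\}$, with $D_{\rm rel}(\alpha,\beta)=(D\alpha,\alpha|_{V\setminus\{0\}}-D\beta)$. All three are $R$-modules. A cutoff function is an $SO(V)$-invariant smooth function $\chi$ on $V$ with compact support, equal to $1$ near $0$. Integration over $V$ gives $R$-linear maps from the second and third of these modules to $R$, and the integral of a relative class is $\int_V[\alpha,\beta]=\int_V(\chi\alpha+d\chi\wedge\beta)$, for any cutoff function $\chi$. Let $T:\bigwedge V\to\mathbb R$ be the Berezin integral, which vanishes in degrees other than $d$ and satisfies $T(e_1\wedge\dots\wedge e_d)=1$, extended to differential forms with values in $\bigwedge V$ by $T(\alpha\otimes\xi)=\alpha\,T(\xi)$. Computing in the super tensor product of differential forms and $\bigwedge V$, put $$f_t(X)=-t^2\|x\|^2+t\sum_k dx_k\,e_k+\tfrac12\sum_{k<l}\langle Xe_k,e_l\rangle e_k\wedge e_l,\qquad \mathrm{Pf}(X)=T\Big(e^{\sum_{k<l}\langle Xe_k,e_l\rangle e_k\wedge e_l}\Big),$$ $$\beta_\wedge(X)=-\int_0^\infty T\Big(\big(\textstyle\sum_k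 x_ke_k\big)e^{f_t(X)}\Big)dt\ \text{ on } V\setminus\{0\},\qquad \epsilon_d=(-1)^{d(d-1)/2}\pi^{d/2},$$ and, for a cutoff function $\chi$, $$\mathrm{Th}_{\rm rel}(V)=\tfrac1{\epsilon_d}\big(\mathrm{Pf}(\tfrac X2),\beta_\wedge(X)\big),\quad \mathrm{Th}_c(V)=\tfrac1{\epsilon_d}\big(\chi\,\mathrm{Pf}(\tfrac X2)+d\chi\wedge\beta_\wedge(X)\big),\quad \mathrm{Th}_{\rm MQ}(V)=\tfrac1{\epsilon_d}T\big(e^{f_1(X)}\big).$$ Then these are closed elements of the respective complexes, the three integrals are well-defined $R$-linear maps to $R$, and: * the class $\mathrm{Th}_{\rm rel}(V)$ is a free generator of $\mathcal H^{\rm pol}(\mathfrak{so}(V),V,V\setminus\{0\})$ over $R$, and it is the unique class of integral $1$ in it; * the class $\mathrm{Th}_c(V)$, for every cutoff function $\chi$, is a free generator of $\mathcal H^{\rm pol}_c(\mathfrak{so}(V),V)$ over $R$, and it is the unique class of integral $1$ in it; * the class $\mathrm{Th}_{\rm MQ}(V)$ is a free generator of $\mathcal H^{\rm pol}_{\rm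 dec\text{-}rap}(\mathfrak{so}(V),V)$ over $R$, and it is the unique class of integral $1$ in it. -/

import Mathlib

open scoped ContDiff Topology RealInnerProductSpace TensorProduct

namespace EquivariantThom

noncomputable section

/-! ### The group `SO(V)`, its Lie algebra, and invariant polynomials -/

section Group

/-- The Lie algebra `so(V)` of antisymmetric endomorphisms of a Euclidean space `V`. -/
abbrev so (V : Type*) [NormedAddCommGroup V] [InnerProductSpace ℝ V] :
    Submodule ℝ (Module.End ℝ V) :=
  LinearMap.skewAdjointSubmodule (innerₗ V)

variable (V : Type*) [NormedAddCommGroup V] [InnerProductSpace ℝ V]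

/-- The group `SO(V)` of linear isometries of `V` of determinant one. -/
def SO : Subgroup (V ≃ₗᵢ[ℝ] V) where
  carrier := {g | LinearMap.det (g.toLinearEquiv : V →ₗ[ℝ] V) = 1}
  one_mem' := by
    change LinearMap.det (LinearMap.id : V →ₗ[ℝ] V) = 1
    exact LinearMap.det_id
  mul_mem' := by
    intro a b ha hb
    change LinearMap.det
      ((a.toLinearEquiv : V →ₗ[ℝ] V) ∘ₗ (b.toLinearEquiv : V →ₗ[ℝ] V)) = 1
    rw [LinearMap.det_comp]
    simp only [Set.mem_ofPred_eq] at ha hb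
    rw [ha, hb, one_mul]
  inv_mem' := by
    intro a ha
    change LinearMap.det (a.toLinearEquiv.symm : V →ₗ[ℝ] V) = 1
    have h := LinearEquiv.det_symm_mul_det a.toLinearEquiv
    simp only [Set.mem_ofPred_eq] at ha
    rwa [ha, mul_one] at h

variable {V}

/-- The adjoint action `X ↦ g X g⁻¹` of a linear isometry on `so(V)`. -/
def Ad (g : V ≃ₗᵢ[ℝ] V) (X : so V) : so V :=
  ⟨(g.toLinearEquiv : V →ₗ[ℝ] V) ∘ₗ (X : Module.End ℝ V) ∘ₗ
      (g.symm.toLinearEquiv : V →ₗ[ℝ] V), by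
    have hX := X.2
    rw [LinearMap.mem_skewAdjointSubmodule] at hX ⊢
    intro v w
    have h := hX (g.symm v) (g.symm w)
    simp only [innerₗ_apply_apply, Pi.neg_apply, inner_neg_right] at h
    simp only [innerₗ_apply_apply, Pi.neg_apply, inner_neg_right,
      LinearMap.comp_apply]
    change ⟪g ((X : Module.End ℝ V) (g.symm v)), w⟫ = -⟪v, g ((X : Module.End ℝ V) (g.symm w))⟫
    rw [← g.symm.inner_map_map, ← g.symm.inner_map_map v]
    simpa using h⟩

variable (V)

/-- The algebra of polynomial functions on `so(V)`, generated by the linear forms. -/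
def polyFun : Subalgebra ℝ (so V → ℝ) :=
  Algebra.adjoin ℝ (Set.range fun l : Module.Dual ℝ (so V) => (fun X => l X))

/-- The algebra of `SO(V)`-invariant polynomial functions on `so(V)`. -/
def invPoly : Subalgebra ℝ (so V → ℝ) where
  carrier := {P | P ∈ polyFun V ∧ ∀ g ∈ SO V, ∀ X, P (Ad g X) = P X}
  mul_mem' := fun ha hb =>
    ⟨mul_mem ha.1 hb.1, fun g hg X => by simp [ha.2 g hg X, hb.2 g hg X]⟩
  add_mem' := fun ha hb =>
    ⟨add_mem ha.1 hb.1, fun g hg X => by simp [ha.2 g hg X, hb.2 g hg X]⟩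
  algebraMap_mem' := fun r => ⟨Subalgebra.algebraMap_mem _ r, fun _ _ _ => rfl⟩

/-- The ring `C^pol(so(V))^{SO(V)}` of invariant polynomial functions on `so(V)`. -/
def InvPoly : Type _ := invPoly V

instance : CommRing (InvPoly V) := inferInstanceAs (CommRing (invPoly V))

variable {V} in
/-- The underlying function of an invariant polynomial. -/
def InvPoly.toFun (P : InvPoly V) : so V → ℝ := P.1

end Group

/-! ### Differential forms -/

section Forms

/-- A (not necessarily smooth) differential form of mixed degree on `V`: a `p`-form for each `p`.
(In degrees above `dim V` every component is zero, so a form has finitely many components.) -/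
abbrev Form (V : Type*) [NormedAddCommGroup V] [InnerProductSpace ℝ V] : Type _ :=
  (p : ℕ) → V → V [⋀^Fin p]→L[ℝ] ℝ

/-- Functions on `so(V)` with values in forms of mixed degree. -/
abbrev EForm (V : Type*) [NormedAddCommGroup V] [InnerProductSpace ℝ V] : Type _ :=
  so V → Form V

variable {V : Type*} [NormedAddCommGroup V] [InnerProductSpace ℝ V]

instance : AddCommGroup (EForm V) := Pi.addCommGroup

/-- Invariant polynomials act on form-valued functions by pointwise multiplication. -/
instance : Module (InvPoly V) (EForm V) where
  smul r α := fun X => r.toFun X • α X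
  one_smul α := funext fun X => one_smul ℝ (α X)
  mul_smul r s α := funext fun X => mul_smul (r.toFun X) (s.toFun X) (α X)
  smul_zero r := funext fun X => smul_zero (r.toFun X)
  smul_add r α β := funext fun X => smul_add (r.toFun X) (α X) (β X)
  add_smul r s α := funext fun X => add_smul (r.toFun X) (s.toFun X) (α X)
  zero_smul α := funext fun X => zero_smul ℝ (α X)

/-- The space `A(U)` of smooth differential forms on an open set `U ⊆ V`; a form on `U` is encoded
by its extension by zero outside `U`. -/
def smoothForms (U : TopologicalSpace.Opens V) : Submodule ℝ (Form V) where
  carrier := {a | ∀ p, ContDiffOn ℝ ∞ (a p) U ∧ ∀ x ∉ U, a p x = 0}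
  add_mem' := fun ha hb p =>
    ⟨(ha p).1.add (hb p).1, fun x hx => by simp [(ha p).2 x hx, (hb p).2 x hx]⟩
  zero_mem' := fun _ => ⟨contDiffOn_const, fun _ _ => rfl⟩
  smul_mem' := fun c a ha p =>
    ⟨(ha p).1.const_smul c, fun x hx => by simp [(ha p).2 x hx]⟩

variable (V) in
/-- The space `A_c(V)` of smooth forms with compact support. -/
def compactForms : Submodule ℝ (Form V) where
  carrier := {a | a ∈ smoothForms ⊤ ∧ ∀ p, HasCompactSupport (a p)}
  add_mem' := fun ha hb => ⟨add_mem ha.1 hb.1, fun p => (ha.2 p).add (hb.2 p)⟩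
  zero_mem' := ⟨zero_mem _, fun _ => HasCompactSupport.zero⟩
  smul_mem' := fun c _ ha =>
    ⟨Submodule.smul_mem _ c ha.1, fun p => (ha.2 p).smul_left (f := fun _ => c)⟩

variable (V) in
/-- The space of smooth forms on `V` all of whose partial derivatives are rapidly decreasing. -/
def rapidForms : Submodule ℝ (Form V) where
  carrier := {a | a ∈ smoothForms ⊤ ∧ ∀ p, ∀ k n : ℕ, ∃ C : ℝ, ∀ x,
    ‖x‖ ^ k * ‖iteratedFDeriv ℝ n (a p) x‖ ≤ C}
  add_mem' := by
    intro a b ha hb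
    refine ⟨add_mem ha.1 hb.1, fun p k n => ?_⟩
    obtain ⟨C, hC⟩ := ha.2 p k n
    obtain ⟨C', hC'⟩ := hb.2 p k n
    have ha' : ContDiff ℝ n (a p) :=
      (contDiffOn_univ.1 (by simpa using (ha.1 p).1)).of_le (by exact_mod_cast le_top)
    have hb' : ContDiff ℝ n (b p) :=
      (contDiffOn_univ.1 (by simpa using (hb.1 p).1)).of_le (by exact_mod_cast le_top)
    refine ⟨C + C', fun x => ?_⟩
    have h : iteratedFDeriv ℝ n ((a + b) p) x =
        iteratedFDeriv ℝ n (a p) x + iteratedFDeriv ℝ n (b p) x :=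
      iteratedFDeriv_add_apply ha'.contDiffAt hb'.contDiffAt
    rw [h]
    calc _ ≤ ‖x‖ ^ k * (‖iteratedFDeriv ℝ n (a p) x‖ + ‖iteratedFDeriv ℝ n (b p) x‖) := by
          gcongr
          exact norm_add_le _ _
      _ ≤ C + C' := by
          rw [mul_add]
          exact add_le_add (hC x) (hC' x)
  zero_mem' := ⟨zero_mem _, fun p k n => ⟨0, fun x => by
    change ‖x‖ ^ k * ‖iteratedFDeriv ℝ n (fun _ : V => (0 : V [⋀^Fin p]→L[ℝ] ℝ)) x‖ ≤ 0
    simp⟩⟩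
  smul_mem' := by
    intro c a ha
    refine ⟨Submodule.smul_mem _ c ha.1, fun p k n => ?_⟩
    obtain ⟨C, hC⟩ := ha.2 p k n
    have ha' : ContDiff ℝ n (a p) :=
      (contDiffOn_univ.1 (by simpa using (ha.1 p).1)).of_le (by exact_mod_cast le_top)
    refine ⟨‖c‖ * C, fun x => ?_⟩
    have h : iteratedFDeriv ℝ n ((c • a) p) x = c • iteratedFDeriv ℝ n (a p) x :=
      iteratedFDeriv_const_smul_apply (a := c) (f := a p) ha'.contDiffAt
    rw [h, norm_smul]
    calc _ = ‖c‖ * (‖x‖ ^ k * ‖iteratedFDeriv ℝ n (a p) x‖) := by ring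
      _ ≤ ‖c‖ * C := by
          gcongr
          exact hC x

theorem compactForms_le : compactForms V ≤ smoothForms ⊤ := fun _ h => h.1

theorem rapidForms_le : rapidForms V ≤ smoothForms ⊤ := fun _ h => h.1

variable (V) in
/-- The open set `V ∖ {0}`. -/
def punctured : TopologicalSpace.Opens V := ⟨{0}ᶜ, isOpen_compl_singleton⟩

/-- `(C^pol(so(V)) ⊗ 𝓐)^{SO(V)}` for a space `𝓐` of forms, realised as the space of
polynomial maps `α : so(V) → 𝓐` which are equivariant: `g^*(α(g X g⁻¹)) = α(X)`. -/
def eqForms (𝓐 : Submodule ℝ (Form V)) : Submodule (InvPoly V) (EForm V) where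
  carrier := {α | α ∈ Submodule.span ℝ
      {γ : EForm V | ∃ P ∈ polyFun V, ∃ a ∈ 𝓐, γ = fun X => P X • a} ∧
    ∀ g ∈ SO V, ∀ (X : so V) (p : ℕ) (x : V) (v : Fin p → V),
      α (Ad g X) p (g x) (fun i => g (v i)) = α X p x v}
  add_mem' := fun ha hb => ⟨add_mem ha.1 hb.1, fun g hg X p x v => by
    simp [ha.2 g hg X p x v, hb.2 g hg X p x v]⟩
  zero_mem' := ⟨zero_mem _, fun _ _ _ _ _ _ => rfl⟩
  smul_mem' := by
    intro r α hα
    refine ⟨?_, fun g hg X p x v => ?_⟩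
    · have key : ∀ β ∈ Submodule.span ℝ
          {γ : EForm V | ∃ P ∈ polyFun V, ∃ a ∈ 𝓐, γ = fun X => P X • a},
          (fun X => r.toFun X • β X) ∈ Submodule.span ℝ
            {γ : EForm V | ∃ P ∈ polyFun V, ∃ a ∈ 𝓐, γ = fun X => P X • a} := by
        intro β hβ
        induction hβ using Submodule.span_induction with
        | mem γ h =>
          obtain ⟨P, hP, a, ha, rfl⟩ := h
          refine Submodule.subset_span ⟨r.toFun * P, mul_mem r.2.1 hP, a, ha, ?_⟩
          funext X
          simp [mul_smul]
        | zero =>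
          convert Submodule.zero_mem _ using 1
          funext X
          simp
        | add β γ _ _ hb hc =>
          convert add_mem hb hc using 1
          funext X
          simp
        | smul c β _ hb =>
          convert Submodule.smul_mem _ c hb using 1
          funext X
          exact smul_comm (r.toFun X) c (β X)
      exact key α hα.1
    · change (r.toFun (Ad g X) • α (Ad g X)) p (g x) (fun i => g (v i)) =
        (r.toFun X • α X) p x v
      have hr : r.toFun (Ad g X) = r.toFun X := r.2.2 g hg X
      simp [hr, hα.2 g hg X p x v]

instance (𝓐 : Submodule ℝ (Form V)) : AddCommGroup (eqForms 𝓐) :=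
  (eqForms 𝓐).addCommGroup

instance (𝓐 : Submodule ℝ (Form V)) : Module (InvPoly V) (eqForms 𝓐) :=
  (eqForms 𝓐).module

instance (𝓐 : Submodule ℝ (Form V)) : SMul (InvPoly V) (eqForms 𝓐) :=
  Module.toDistribMulAction.toSMul

instance : SMul (InvPoly V) (EForm V) := Module.toDistribMulAction.toSMul

theorem eqForms_apply_mem {𝓐 : Submodule ℝ (Form V)} {α : EForm V} (hα : α ∈ eqForms 𝓐)
    (X : so V) : α X ∈ 𝓐 := by
  have key : ∀ β ∈ Submodule.span ℝ
      {γ : EForm V | ∃ P ∈ polyFun V, ∃ a ∈ 𝓐, γ = fun X => P X • a}, β X ∈ 𝓐 := by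
    intro β hβ
    induction hβ using Submodule.span_induction with
    | mem γ h =>
      obtain ⟨P, hP, a, ha, rfl⟩ := h
      exact 𝓐.smul_mem _ ha
    | zero => exact 𝓐.zero_mem
    | add β γ _ _ hb hc => exact 𝓐.add_mem hb hc
    | smul c β _ hb => exact 𝓐.smul_mem c hb
  exact key α hα.1

/-- The de Rham differential of a form on `U` (extended by zero outside `U`). -/
def dForm (U : TopologicalSpace.Opens V) (a : Form V) : Form V
  | 0 => 0
  | p + 1 => (U : Set V).indicator (extDeriv (a p))

/-- The contraction `ι(S)` of a form by a vector field `S`. -/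
def contract (S : V → V) (a : Form V) : Form V :=
  fun p x => (a (p + 1) x).curryLeft (S x)

/-- The vector field `VX` generated by `X ∈ so(V)`:
`V_x X = d/dε (exp(-εX) x)|_{ε=0} = -X x`. -/
def vecField (X : so V) : V → V := fun x => -((X : Module.End ℝ V) x)

/-- The equivariant differential `(Dα)(X) = d(α(X)) - ι(VX) α(X)` on `U`. -/
def eqDiff (U : TopologicalSpace.Opens V) (α : EForm V) : EForm V :=
  fun X => dForm U (α X) - contract (vecField X) (α X)

theorem dForm_add {U : TopologicalSpace.Opens V} {a b : Form V} (ha : a ∈ smoothForms U)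
    (hb : b ∈ smoothForms U) : dForm U (a + b) = dForm U a + dForm U b := by
  funext p x
  cases p with
  | zero => simp [dForm]
  | succ p =>
    by_cases hx : x ∈ (U : Set V)
    · have hU := U.isOpen.mem_nhds hx
      have h1 := ((ha p).1.contDiffAt hU).differentiableAt (by simp)
      have h2 := ((hb p).1.contDiffAt hU).differentiableAt (by simp)
      simpa [dForm, hx] using extDeriv_add h1 h2
    · simp [dForm, hx]

theorem dForm_smul (U : TopologicalSpace.Opens V) (c : ℝ) (a : Form V) :
    dForm U (c • a) = c • dForm U a := by
  funext p x
  cases p with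
  | zero => simp [dForm]
  | succ p =>
    by_cases hx : x ∈ (U : Set V)
    · simpa [dForm, hx] using extDeriv_smul (x := x) c (a p)
    · simp [dForm, hx]

theorem contract_add (S : V → V) (a b : Form V) :
    contract S (a + b) = contract S a + contract S b := by
  funext p x
  simp [contract]

theorem contract_smul (S : V → V) (c : ℝ) (a : Form V) :
    contract S (c • a) = c • contract S a := by
  funext p x
  simp [contract]

/-- The equivariant differential on `(C^pol(so(V)) ⊗ 𝓐)^{SO(V)}`, as a linear map over the
invariant polynomials. -/
def eqD (U : TopologicalSpace.Opens V) (𝓐 : Submodule ℝ (Form V)) (h : 𝓐 ≤ smoothForms U) :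
    eqForms 𝓐 →ₗ[InvPoly V] EForm V where
  toFun α := eqDiff U α
  map_add' α β := by
    funext X
    change dForm U ((α : EForm V) X + (β : EForm V) X) -
      contract (vecField X) ((α : EForm V) X + (β : EForm V) X) = _
    rw [dForm_add (h (eqForms_apply_mem α.2 X)) (h (eqForms_apply_mem β.2 X)), contract_add]
    change _ = (dForm U ((α : EForm V) X) - contract (vecField X) ((α : EForm V) X)) +
      (dForm U ((β : EForm V) X) - contract (vecField X) ((β : EForm V) X))
    abel
  map_smul' r α := by
    funext X
    change dForm U (r.toFun X • (α : EForm V) X) -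
      contract (vecField X) (r.toFun X • (α : EForm V) X) =
      r.toFun X •
        (dForm U ((α : EForm V) X) - contract (vecField X) ((α : EForm V) X))
    rw [dForm_smul, contract_smul, smul_sub]

end Forms

/-! ### Cohomology -/

section Cohomology

/-- The cohomology `Ker D / Im D` of a differential `D` on a module `A` with inclusion `i : A → E`.
The differential is recorded with values in the ambient module `E`; the image is intersected with
the kernel, which changes nothing when `D` preserves `A` and `D ∘ D = 0`. -/
def Cohomology {R A E : Type*} [CommRing R] [AddCommGroup A] [Module R A] [AddCommGroup E]
    [Module R E] (i D : A →ₗ[R] E) : Type _ :=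
  LinearMap.ker D ⧸ (LinearMap.range D).comap (i ∘ₗ (LinearMap.ker D).subtype)

instance {R A E : Type*} [CommRing R] [AddCommGroup A] [Module R A] [AddCommGroup E]
    [Module R E] (i D : A →ₗ[R] E) : AddCommGroup (Cohomology i D) :=
  inferInstanceAs (AddCommGroup
    (LinearMap.ker D ⧸ (LinearMap.range D).comap (i ∘ₗ (LinearMap.ker D).subtype)))

instance {R A E : Type*} [CommRing R] [AddCommGroup A] [Module R A] [AddCommGroup E]
    [Module R E] (i D : A →ₗ[R] E) : Module R (Cohomology i D) :=
  inferInstanceAs (Module R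
    (LinearMap.ker D ⧸ (LinearMap.range D).comap (i ∘ₗ (LinearMap.ker D).subtype)))

/-- The map sending a closed element to its cohomology class. -/
def Cohomology.mk {R A E : Type*} [CommRing R] [AddCommGroup A] [Module R A] [AddCommGroup E]
    [Module R E] (i D : A →ₗ[R] E) : LinearMap.ker D →ₗ[R] Cohomology i D :=
  Submodule.mkQ _

/-- `m` is a free generator of the `R`-module `M`: every element is `r • m` for a unique `r`. -/
def IsFreeGenerator (R : Type*) {M : Type*} [CommRing R] [AddCommGroup M] [Module R M]
    (m : M) : Prop :=
  ∀ y : M, ∃! r : R, r • m = y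

variable (V : Type*) [NormedAddCommGroup V] [InnerProductSpace ℝ V]

/-- The differential of the complex of compactly supported equivariant forms. -/
def compactD : eqForms (compactForms V) →ₗ[InvPoly V] EForm V :=
  eqD ⊤ (compactForms V) compactForms_le

/-- The differential of the complex of rapidly decreasing equivariant forms. -/
def rapidD : eqForms (rapidForms V) →ₗ[InvPoly V] EForm V :=
  eqD ⊤ (rapidForms V) rapidForms_le

/-- The compactly supported equivariant cohomology of `V`. -/
abbrev HCompact : Type _ := Cohomology (R := InvPoly V) (A := eqForms (compactForms V)) (E := EForm V)
  (eqForms (compactForms V)).subtype (compactD V)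

/-- The class of a closed compactly supported equivariant form. -/
def compactClass : LinearMap.ker (compactD V) →ₗ[InvPoly V] HCompact V :=
  Cohomology.mk _ _

/-- The rapidly decreasing equivariant cohomology of `V`. -/
abbrev HRapid : Type _ := Cohomology (R := InvPoly V) (A := eqForms (rapidForms V)) (E := EForm V)
  (eqForms (rapidForms V)).subtype (rapidD V)

/-- The class of a closed rapidly decreasing equivariant form. -/
def rapidClass : LinearMap.ker (rapidD V) →ₗ[InvPoly V] HRapid V :=
  Cohomology.mk _ _

/-- Pairs `(α, β)` of equivariant forms on `V` and on `V ∖ {0}`. -/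
abbrev RelForms : Type _ :=
  eqForms (smoothForms (⊤ : TopologicalSpace.Opens V)) × eqForms (smoothForms (punctured V))

/-- The inclusion of the relative complex in all pairs. -/
def relIncl : RelForms V →ₗ[InvPoly V] EForm V × EForm V :=
  (eqForms (smoothForms (⊤ : TopologicalSpace.Opens V))).subtype.prodMap
    (eqForms (smoothForms (punctured V))).subtype

/-- Restriction to `V ∖ {0}` (encoded, as above, as extended by zero). -/
def restrictPunctured : EForm V →ₗ[InvPoly V] EForm V where
  toFun α := fun X p => (punctured V : Set V).indicator (α X p)
  map_add' α β := by
    funext X p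
    exact Set.indicator_add _ _ _
  map_smul' r α := by
    funext X p
    exact Set.indicator_const_smul _ (r.toFun X) (α X p)

/-- The relative differential `D_rel(α, β) = (Dα, α|_{V∖{0}} - Dβ)`. -/
def relD : RelForms V →ₗ[InvPoly V] EForm V × EForm V :=
  LinearMap.prod
    (eqD ⊤ (smoothForms ⊤) le_rfl ∘ₗ LinearMap.fst _ _ _)
    (restrictPunctured V ∘ₗ (eqForms (smoothForms ⊤)).subtype ∘ₗ LinearMap.fst _ _ _ -
      eqD (punctured V) (smoothForms (punctured V)) le_rfl ∘ₗ LinearMap.snd _ _ _)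

/-- The relative equivariant cohomology of `(V, V ∖ {0})`. -/
abbrev HRel : Type _ := Cohomology (R := InvPoly V) (A := RelForms V) (E := EForm V × EForm V)
  (relIncl V) (relD V)

/-- The class of a closed element of the relative complex. -/
def relClass : LinearMap.ker (relD V) →ₗ[InvPoly V] HRel V :=
  Cohomology.mk _ _

end Cohomology

/-! ### Cutoff functions, integration -/

section Integration

variable {V : Type*} [NormedAddCommGroup V] [InnerProductSpace ℝ V]

/-- An `SO(V)`-invariant smooth function with compact support, equal to `1` near `0`. -/
structure IsCutoff (χ : V → ℝ) : Prop where
  smooth : ContDiff ℝ ∞ χ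
  compact : HasCompactSupport χ
  invariant : ∀ g ∈ SO V, ∀ x, χ (g x) = χ x
  eq_one : ∀ᶠ x in 𝓝 0, χ x = 1

/-- The wedge product `dχ ∧ b`. -/
def dWedge (χ : V → ℝ) (b : Form V) : Form V
  | 0 => 0
  | p + 1 => fun x =>
      ContinuousAlternatingMap.alternatizeUncurryFin ((fderiv ℝ χ x).smulRight (b p x))

/-- The form `χ α + dχ ∧ β`. -/
def cutoff (χ : V → ℝ) (α β : EForm V) : EForm V :=
  fun X => (fun p x => χ x • α X p x) + dWedge χ (β X)

variable [FiniteDimensional ℝ V] [MeasurableSpace V] [BorelSpace V] {d : ℕ}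

/-- The integral over `V`, oriented by the orthonormal basis `e`, of the component of top degree
of a form. -/
def formIntegral (e : OrthonormalBasis (Fin d) ℝ V) (a : Form V) : ℝ :=
  ∫ x, a d x (fun k => e k)

end Integration

/-! ### The Berezin integral and the Thom forms -/

section Thom

variable {V : Type*} [NormedAddCommGroup V] [InnerProductSpace ℝ V] {d : ℕ}

/-- The Berezin integral `T : ⋀V → ℝ`, which is zero in degrees other than `d`, and such that
`T(e₁ ∧ ⋯ ∧ e_d) = 1`. -/
def berezin (e : OrthonormalBasis (Fin d) ℝ V) : ExteriorAlgebra ℝ V →ₗ[ℝ] ℝ :=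
  ExteriorAlgebra.liftAlternating (Pi.single d e.toBasis.det)

/-- The exponential `∑ aⁿ / n!` of a nilpotent element. -/
def nilExp {A : Type*} [Ring A] [Module ℝ A] (a : A) : A :=
  ∑ n ∈ Finset.range (nilpotencyClass a), ((n.factorial : ℝ)⁻¹) • a ^ n

/-- The element `∑_{k<l} ⟨X e_k, e_l⟩ e_k ∧ e_l` of `⋀V`. -/
def bivector (e : OrthonormalBasis (Fin d) ℝ V) (X : so V) : ExteriorAlgebra ℝ V :=
  ∑ k, ∑ l ∈ Finset.Ioi k, ⟪(X : Module.End ℝ V) (e k), e l⟫ •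
    (ExteriorAlgebra.ι ℝ (e k) * ExteriorAlgebra.ι ℝ (e l))

/-- The pfaffian `Pf(X) = T(exp(∑_{k<l} ⟨X e_k, e_l⟩ e_k ∧ e_l))`. -/
def pfaffian (e : OrthonormalBasis (Fin d) ℝ V) (X : so V) : ℝ :=
  berezin e (nilExp (bivector e X))

variable (V) in
/-- The super-algebra `⋀V^* ⊗ ⋀V`, with the sign rule for the product. A section over `V` is an
element of `A(V) ⊗ ⋀V`. -/
abbrev SuperAlg : Type _ :=
  GradedTensorProduct ℝ (fun i : ℕ => ⋀[ℝ]^i (Module.Dual ℝ V)) (fun i : ℕ => ⋀[ℝ]^i V)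

/-- `α ⊗ ξ` in `⋀V^* ⊗ ⋀V`. -/
abbrev stmul (a : ExteriorAlgebra ℝ (Module.Dual ℝ V)) (ξ : ExteriorAlgebra ℝ V) : SuperAlg V :=
  GradedTensorProduct.tmul ℝ a ξ

/-- The nilpotent part `t ∑_k dx_k e_k + ½ ∑_{k<l} ⟨X e_k, e_l⟩ e_k ∧ e_l` of `f_t(X)`. -/
def fNil (e : OrthonormalBasis (Fin d) ℝ V) (t : ℝ) (X : so V) : SuperAlg V :=
  t • ∑ k, stmul (ExteriorAlgebra.ι ℝ (innerₗ V (e k))) (ExteriorAlgebra.ι ℝ (e k)) +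
    (1 / 2 : ℝ) • stmul 1 (bivector e X)

/-- The value at `x ∈ V` of `exp(f_t(X))`, where
`f_t(X) = -t²‖x‖² + t ∑_k dx_k e_k + ½ ∑_{k<l} ⟨X e_k, e_l⟩ e_k ∧ e_l`. -/
def expF (e : OrthonormalBasis (Fin d) ℝ V) (t : ℝ) (X : so V) (x : V) : SuperAlg V :=
  Real.exp (-t ^ 2 * ‖x‖ ^ 2) • nilExp (fNil e t X)

/-- The Berezin integral `T : ⋀V^* ⊗ ⋀V → ⋀V^*`, `T(α ⊗ ξ) = α T(ξ)`. -/
def superBerezin (e : OrthonormalBasis (Fin d) ℝ V) :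
    SuperAlg V →ₗ[ℝ] ExteriorAlgebra ℝ (Module.Dual ℝ V) :=
  (TensorProduct.rid ℝ _).toLinearMap ∘ₗ (berezin e).lTensor _ ∘ₗ
    (GradedTensorProduct.of ℝ (fun i : ℕ => ⋀[ℝ]^i (Module.Dual ℝ V))
      (fun i : ℕ => ⋀[ℝ]^i V)).symm.toLinearMap

variable [FiniteDimensional ℝ V]

theorem continuous_multilinear {p : ℕ} (f : MultilinearMap ℝ (fun _ : Fin p => V) ℝ) :
    Continuous f := by
  let b := Module.finBasis ℝ V
  have h : ∀ v : Fin p → V, f v =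
      ∑ r : Fin p → Fin (Module.finrank ℝ V), (∏ i, b.repr (v i) (r i)) * f fun i => b (r i) := by
    intro v
    have hv : v = fun i => ∑ j, b.repr (v i) j • b j := by
      funext i
      exact (b.sum_repr (v i)).symm
    conv_lhs => rw [hv]
    rw [MultilinearMap.map_sum]
    refine Finset.sum_congr rfl fun r _ => ?_
    rw [MultilinearMap.map_smul_univ, smul_eq_mul]
  rw [show (f : (Fin p → V) → ℝ) = fun v => _ from funext h]
  refine continuous_finsetSum _ fun r _ => (continuous_finsetProd _ fun i _ => ?_).mul
    continuous_const
  exact (LinearMap.continuous_of_finiteDimensional (b.coord (r i))).comp (continuous_apply i)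

/-- The degree `p` component of an element of `⋀V^*`, as an alternating map:
`φ₁ ∧ ⋯ ∧ φ_p` is sent to `(v₁, …, v_p) ↦ det (φ_i(v_j))`. -/
def toAlt (w : ExteriorAlgebra ℝ (Module.Dual ℝ V)) (p : ℕ) : V [⋀^Fin p]→L[ℝ] ℝ :=
  { (exteriorPower.pairingDual ℝ V p
      (DirectSum.decompose (fun i : ℕ => ⋀[ℝ]^i (Module.Dual ℝ V)) w p)).compAlternatingMap
        (exteriorPower.ιMulti ℝ p) with
    cont := continuous_multilinear _ }

/-- The form `C_∧^t(X) = T(exp(f_t(X)))`. -/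
def formC (e : OrthonormalBasis (Fin d) ℝ V) (t : ℝ) : EForm V :=
  fun X p x => toAlt (superBerezin e (expF e t X x)) p

/-- The form `η_∧^t(X) = -T((∑_k x_k e_k) exp(f_t(X)))`. -/
def formEta (e : OrthonormalBasis (Fin d) ℝ V) (t : ℝ) : EForm V :=
  fun X p x => -toAlt (superBerezin e
    ((∑ k, ⟪e k, x⟫ • stmul 1 (ExteriorAlgebra.ι ℝ (e k))) * expF e t X x)) p

/-- The form `β_∧(X) = ∫₀^∞ η_∧^t(X) dt` on `V ∖ {0}`. -/
def formBeta (e : OrthonormalBasis (Fin d) ℝ V) : EForm V :=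
  fun X p => (punctured V : Set V).indicator fun x => ∫ t in Set.Ioi (0 : ℝ), formEta e t X p x

/-- The equivariant form `Pf(X/2)`, constant of degree zero on `V`. -/
def formPf (e : OrthonormalBasis (Fin d) ℝ V) : EForm V :=
  fun X p _ => match p with
    | 0 => ContinuousAlternatingMap.constOfIsEmpty ℝ V (Fin 0) (pfaffian e ((1 / 2 : ℝ) • X))
    | _ + 1 => 0

/-- The constant `ε_d = (-1)^{d(d-1)/2} π^{d/2}`. -/
def epsilon (d : ℕ) : ℝ := (-1) ^ (d * (d - 1) / 2) * Real.pi ^ ((d : ℝ) / 2)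

/-- The relative Thom form `ε_d⁻¹ (Pf(X/2), β_∧(X))`. -/
def thomRel (e : OrthonormalBasis (Fin d) ℝ V) : EForm V × EForm V :=
  (epsilon d)⁻¹ • (formPf e, formBeta e)

/-- The Thom form with compact support `ε_d⁻¹ (χ Pf(X/2) + dχ ∧ β_∧(X))`. -/
def thomCompact (e : OrthonormalBasis (Fin d) ℝ V) (χ : V → ℝ) : EForm V :=
  (epsilon d)⁻¹ • cutoff χ (formPf e) (formBeta e)

/-- The Mathai–Quillen form `ε_d⁻¹ T(exp(f_1(X)))`. -/
def thomMQ (e : OrthonormalBasis (Fin d) ℝ V) : EForm V :=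
  (epsilon d)⁻¹ • formC e 1

end Thom

end

end EquivariantThom

open EquivariantThom

/-!
Each of the three statements says that integration is an isomorphism of `R`-modules from a
cohomology group onto `R`, sending the Thom class to `1`. By `cohomology_freeGenerator` it is enough
to know that the integral of a closed element vanishes exactly when the element is exact, and that
the integral of the Thom form is `1`.

*Integration kills exact forms.* The contraction `ι(VX)` does not contribute to the component of
top degree, so this is Stokes' theorem (`formIntegral_eqDiff`).

*A closed form of integral zero is exact* (`exists_eqDiff_eq`). The component of highest degree of
an equivariantly closed form is closed for the de Rham differential, so the components can be
removed one by one, from degree `d` downwards, as soon as the de Rham complex has an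
`SO(V)`-equivariant homotopy operator which commutes with the passage to polynomial maps and
preserves compact support and rapid decrease. Such an operator is `homotopyOp`. With a radial
mollifier `φ` of integral `1`, a closed form `a` is first deformed, by translations, to its
convolution with `φ`; the convolution `∫ φ(x - u) a(u) du` is then deformed, by dilating `u` to
`r u` and multiplying by `r ^ (d - deg a)`, to `φ(x) ∫ a` in top degree and to `0` in lower degrees.
Both deformations have primitives given by explicit integrals, which Cartan's formula identifies
(`extDeriv_homotopyOp`).

*The relative complex.* For a cutoff function `χ`, the map `(α, β) ↦ χ α + dχ ∧ β` takes relatively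
closed pairs to closed forms of compact support, because there
`χ α + dχ ∧ β = α - D((1 - χ) β)` (`cutoff_eq_sub`). If the image is exact, then `(α, β)` is exact up
to a closed form on `V ∖ {0}` of bounded support, and the latter is exact by contraction along the
rays going to infinity, an operation which anticommutes with `ι(VX)`
(`exists_eqDiff_eq_of_bounded`, `exists_relD_eq`). This reduces `relative_cohomology` to the case of
compact supports.

*The Thom forms.* Contracting `T(e^{f_t(X)} w)` with a vector `u` amounts to replacing `w` by `t u w`.
Hence the component of degree `p` of `T(e^{f_t(X)})` is `exp(-t²‖x‖²) t ^ p` times a constant form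
`coeffForm`, read off from `E_X = exp(½ ∑_{k<l} ⟨X e_k, e_l⟩ e_k ∧ e_l)`
(`toAlt_superBerezin_nilExp`). The one algebraic identity `ι_x E_X = ½ (Xx) E_X`
(`contraction_bivectorExp`) turns into a relation between the contraction of these constant forms
by `Xx` and their exterior product with `d‖x‖²`, from which both the closedness of `T(e^{f_1(X)})` and
the transgression formula `Dβ_∧ = Pf(X/2)` on `V ∖ {0}` (`restrictPunctured_formPf`) follow by
differentiating functions of `‖x‖`. The integral of the Mathai–Quillen form is a Gaussian integral,
and that of the relative form is reduced to the same Gaussian integral in polar coordinates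
(`formIntegral_cutoff_formPf_formBeta`).
-/

open scoped ContDiff Topology RealInnerProductSpace TensorProduct

namespace EquivariantThom

noncomputable section

set_option linter.unusedSectionVars false

/-! ### Exterior derivatives and Cartan's formula -/

/-- The chain rule for a linear map. It is stated for abstract normed spaces because the topology
on alternating maps does not unify readily with the one of their norm; giving the types explicitly
avoids the problem. -/
theorem hasFDerivAt_clm_comp {E F G : Type*} [NormedAddCommGroup E] [NormedSpace ℝ E]
    [NormedAddCommGroup F] [NormedSpace ℝ F] [NormedAddCommGroup G] [NormedSpace ℝ G]
    (L : F →L[ℝ] G) {f : E → F} {f' : E →L[ℝ] F} {x : E} (h : HasFDerivAt f f' x) :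
    HasFDerivAt (fun y => L (f y)) (L.comp f') x :=
  L.hasFDerivAt.comp x h

section Cartan

variable {V : Type*} [NormedAddCommGroup V] [InnerProductSpace ℝ V]

/-- Contraction of the alternation of `f`: the term of the alternation in which `w` is the argument
of differentiation splits off. -/
theorem alternatizeUncurryFin_curryLeft_apply {p : ℕ}
    (f : V →L[ℝ] V [⋀^Fin (p + 1)]→L[ℝ] ℝ) (w : V) (v : Fin (p + 1) → V) :
    (ContinuousAlternatingMap.alternatizeUncurryFin f).curryLeft w v =
      f w v - ∑ i : Fin (p + 1), (-1) ^ (i : ℕ) • (f (v i)).curryLeft w (i.removeNth v) := by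
  have h (i : Fin (p + 1)) : i.succ.removeNth (Matrix.vecCons w v) =
      Matrix.vecCons w (i.removeNth v) := by
    funext j
    refine Fin.cases ?_ (fun j => ?_) j <;> simp [Fin.removeNth]
  rw [ContinuousAlternatingMap.curryLeft_apply_apply,
    ContinuousAlternatingMap.alternatizeUncurryFin_apply, Fin.sum_univ_succ, sub_eq_add_neg,
    ← Finset.sum_neg_distrib]
  simp [h, pow_succ]

theorem extDeriv_fun_const {p : ℕ} (c : V [⋀^Fin p]→L[ℝ] ℝ) (x : V) :
    extDeriv (fun _ : V => c) x = 0 := by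
  rw [extDeriv, fderiv_fun_const]
  exact map_zero (ContinuousAlternatingMap.alternatizeUncurryFinCLM ℝ V ℝ (n := p))

theorem alternating_ext_curryLeft {p : ℕ} {f g : V [⋀^Fin (p + 1)]→L[ℝ] ℝ}
    (h : ∀ u, f.curryLeft u = g.curryLeft u) : f = g := by
  ext v
  have h' : f (Matrix.vecCons (Matrix.vecHead v) (Matrix.vecTail v)) =
      g (Matrix.vecCons (Matrix.vecHead v) (Matrix.vecTail v)) :=
    congrArg (fun q => q (Matrix.vecTail v)) (h (v 0))
  rwa [Matrix.cons_head_tail] at h'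

variable (V) in
/-- `ContinuousAlternatingMap.curryLeft` as a continuous linear map. -/
def curryLeftCLM (p : ℕ) :
    V [⋀^Fin (p + 1)]→L[ℝ] ℝ →L[ℝ] V →L[ℝ] V [⋀^Fin p]→L[ℝ] ℝ :=
  (ContinuousAlternatingMap.curryLeftLI (𝕜 := ℝ) (E := V) (F := ℝ)
      (n := p)).toContinuousLinearMap

@[simp] theorem curryLeftCLM_apply {p : ℕ} (f : V [⋀^Fin (p + 1)]→L[ℝ] ℝ) :
    curryLeftCLM V p f = f.curryLeft := rfl

theorem hasFDerivAt_curryLeft_comp {p : ℕ} {a : V → V [⋀^Fin (p + 1)]→L[ℝ] ℝ} {A A' : V →L[ℝ] V}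
    {b b' x : V} (ha : DifferentiableAt ℝ a (A x + b)) :
    ∃ F : V →L[ℝ] V [⋀^Fin p]→L[ℝ] ℝ, HasFDerivAt (fun x => ((a (A x + b)).curryLeft
      (A' x + b')).compContinuousLinearMap A) F x ∧ ∀ u, F u =
        ((fderiv ℝ a (A x + b) (A u)).curryLeft (A' x + b')).compContinuousLinearMap A +
          ((a (A x + b)).curryLeft (A' u)).compContinuousLinearMap A := by
  have h1 : HasFDerivAt (fun x => a (A x + b)) ((fderiv ℝ a (A x + b)).comp A) x :=
    ha.hasFDerivAt.comp x (A.hasFDerivAt.add_const b)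
  have h2 : HasFDerivAt (fun x => A' x + b') A' x := A'.hasFDerivAt.add_const b'
  have h0 := hasFDerivAt_clm_comp (F := V [⋀^Fin (p + 1)]→L[ℝ] ℝ)
    (G := V →L[ℝ] V [⋀^Fin p]→L[ℝ] ℝ) (curryLeftCLM V p) h1
  have h3 := h0.clm_apply h2
  have h4 := hasFDerivAt_clm_comp (F := V [⋀^Fin p]→L[ℝ] ℝ) (G := V [⋀^Fin p]→L[ℝ] ℝ)
    (ContinuousAlternatingMap.compContinuousLinearMapCLM A) h3
  refine ⟨_, h4, fun u => ?_⟩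
  ext v
  simp [add_comm]

/-- **Cartan's formula** along a path of affine maps `φ s x = A s x + b s`:
`d/ds φ_s^* a = d (ι(φ̇) a) + ι(φ̇) (d a)` (pulled back by `φ_s`), for a form of positive degree. -/
theorem hasDerivAt_pullback_affine {p : ℕ} {a : V → V [⋀^Fin (p + 1)]→L[ℝ] ℝ}
    {A : ℝ → V →L[ℝ] V} {b : ℝ → V} {A' : V →L[ℝ] V} {b' : V} {t : ℝ} (hA : HasDerivAt A A' t)
    (hb : HasDerivAt b b' t) {x : V} (ha : DifferentiableAt ℝ a (A t x + b t)) :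
    HasDerivAt (fun s => (a (A s x + b s)).compContinuousLinearMap (A s))
      (extDeriv (fun x => ((a (A t x + b t)).curryLeft
        (A' x + b')).compContinuousLinearMap (A t)) x +
        ((extDeriv a (A t x + b t)).curryLeft (A' x + b')).compContinuousLinearMap (A t)) t := by
  have h1 : HasDerivAt (fun s => A s x + b s) (A' x + b') t := by
    have := (hA.clm_apply (hasDerivAt_const t x)).add hb
    rw [map_zero, add_zero] at this
    exact this
  have h2 := ha.hasFDerivAt.comp_hasDerivAt t h1
  have h3 := (h2.hasFDerivAt.continuousAlternatingMapCompContinuousLinearMap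
    hA.hasFDerivAt).hasDerivAt
  refine h3.congr_deriv ?_
  obtain ⟨F, hF, hF'⟩ := hasFDerivAt_curryLeft_comp (A' := A') (b' := b') ha
  ext v
  have e2 := alternatizeUncurryFin_curryLeft_apply (fderiv ℝ a (A t x + b t)) (A' x + b')
    (fun i => A t (v i))
  have e3 : ((ContinuousAlternatingMap.alternatizeUncurryFin
      (fderiv ℝ a (A t x + b t))).curryLeft (A' x + b')).compContinuousLinearMap (A t) v =
      (ContinuousAlternatingMap.alternatizeUncurryFin
      (fderiv ℝ a (A t x + b t))).curryLeft (A' x + b') (fun i => A t (v i)) := rfl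
  rw [ContinuousAlternatingMap.fderivCompContinuousLinearMap_eq_alternatizeUncurryFin]
  simp only [extDeriv]
  rw [hF.fderiv, ContinuousAlternatingMap.add_apply, e3, e2]
  simp only [ContinuousAlternatingMap.alternatizeUncurryFin_apply, hF', smul_add,
    Finset.sum_add_distrib, ContinuousAlternatingMap.add_apply]
  simp [ContinuousAlternatingMap.alternatizeUncurryFin_apply]
  have e4 (i : Fin (p + 1)) : (⇑(A t) ∘ i.removeNth v) = i.removeNth (fun i => A t (v i)) := rfl
  have e5 : (fun i => A t (v i)) = ⇑(A t) ∘ v := rfl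
  simp only [e4, e5]
  ring

/-- Cartan's formula for functions, where the term `d (ι(φ̇) a)` is absent. -/
theorem hasDerivAt_pullback_affine_zero {a : V → V [⋀^Fin 0]→L[ℝ] ℝ}
    {A : ℝ → V →L[ℝ] V} {b : ℝ → V} {A' : V →L[ℝ] V} {b' : V} {t : ℝ} (hA : HasDerivAt A A' t)
    (hb : HasDerivAt b b' t) {x : V} (ha : DifferentiableAt ℝ a (A t x + b t)) :
    HasDerivAt (fun s => (a (A s x + b s)).compContinuousLinearMap (A s))
      (((extDeriv a (A t x + b t)).curryLeft (A' x + b')).compContinuousLinearMap (A t)) t := by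
  have h1 : HasDerivAt (fun s => A s x + b s) (A' x + b') t := by
    have := (hA.clm_apply (hasDerivAt_const t x)).add hb
    rw [map_zero, add_zero] at this
    exact this
  have h2 := ha.hasFDerivAt.comp_hasDerivAt t h1
  have h3 := (h2.hasFDerivAt.continuousAlternatingMapCompContinuousLinearMap
    hA.hasFDerivAt).hasDerivAt
  refine h3.congr_deriv ?_
  ext v
  simp [extDeriv, ContinuousAlternatingMap.alternatizeUncurryFin_apply,
    ContinuousAlternatingMap.fderivCompContinuousLinearMap_of_isEmpty]

end Cartan

/-! ### Infinitesimal invariance -/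

section InfinitesimalInvariance

variable {V : Type*} [NormedAddCommGroup V] [InnerProductSpace ℝ V] [FiniteDimensional ℝ V]

theorem sq_det_linearIsometryEquiv (g : V ≃ₗᵢ[ℝ] V) :
    LinearMap.det (g.toLinearEquiv : V →ₗ[ℝ] V) ^ 2 = 1 := by
  let e := stdOrthonormalBasis ℝ V
  have h := e.toBasis.det_comp (g.toLinearEquiv : V →ₗ[ℝ] V) e
  have h1 : e.toBasis.det e = 1 := by
    rw [← e.coe_toBasis]; exact e.toBasis.det_self
  have h2 := e.det_to_matrix_orthonormalBasis_real (e.map g)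
  have h3 : (g.toLinearEquiv : V →ₗ[ℝ] V) ∘ e = e.map g := by
    funext i; simp
  rw [h1, mul_one, h3] at h
  rw [← h]
  rcases h2 with h2 | h2 <;> simp [h2]

/-- An element of `so(V)` as a continuous linear map. -/
def soCLM (X : so V) : V →L[ℝ] V := LinearMap.toContinuousLinearMap (X : Module.End ℝ V)

@[simp] theorem soCLM_apply (X : so V) (x : V) : soCLM X x = (X : Module.End ℝ V) x := rfl

theorem soCLM_mem_skewAdjoint (X : so V) : soCLM X ∈ skewAdjoint (V →L[ℝ] V) := by
  rw [skewAdjoint.mem_iff, ContinuousLinearMap.star_eq_adjoint]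
  symm
  rw [ContinuousLinearMap.eq_adjoint_iff]
  intro x y
  have hX := X.2
  rw [LinearMap.mem_skewAdjointSubmodule] at hX
  have h := hX x y
  simp only [innerₗ_apply_apply, Pi.neg_apply, inner_neg_right] at h
  simp [h]

/-- The one-parameter group `exp (s X)` of isometries generated by `X ∈ so(V)`. -/
def soExp (X : so V) (s : ℝ) : V ≃ₗᵢ[ℝ] V :=
  Unitary.linearIsometryEquiv (⟨NormedSpace.exp (s • soCLM X),
    letI : NormedAlgebra ℚ (V →L[ℝ] V) := NormedAlgebra.restrictScalars ℚ ℝ _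
    NormedSpace.exp_mem_unitary_of_mem_skewAdjoint
      (skewAdjoint.smul_mem s (soCLM_mem_skewAdjoint X))⟩ : unitary (V →L[ℝ] V))

theorem soExp_apply (X : so V) (s : ℝ) (x : V) :
    soExp X s x = NormedSpace.exp (s • soCLM X) x := rfl

theorem soExp_add (X : so V) (s t : ℝ) (x : V) : soExp X (s + t) x = soExp X s (soExp X t x) := by
  let : NormedAlgebra ℚ (V →L[ℝ] V) := NormedAlgebra.restrictScalars ℚ ℝ _
  simp only [soExp_apply]
  rw [add_smul, NormedSpace.exp_add_of_commute]
  · rfl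
  · exact ((Commute.refl (soCLM X)).smul_left s).smul_right t

theorem soExp_mem_SO (X : so V) (s : ℝ) : soExp X s ∈ SO V := by
  have h : ((soExp X s).toLinearEquiv : V →ₗ[ℝ] V) =
      ((soExp X (s / 2)).toLinearEquiv : V →ₗ[ℝ] V) ∘ₗ
        ((soExp X (s / 2)).toLinearEquiv : V →ₗ[ℝ] V) := by
    ext x
    change soExp X s x = soExp X (s / 2) (soExp X (s / 2) x)
    rw [← soExp_add, add_halves]
  change LinearMap.det ((soExp X s).toLinearEquiv : V →ₗ[ℝ] V) = 1
  rw [h, LinearMap.det_comp, ← sq, sq_det_linearIsometryEquiv]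

theorem Ad_soExp (X : so V) (s : ℝ) : Ad (soExp X s) X = X := by
  apply Subtype.ext
  ext x
  change soExp X s ((X : Module.End ℝ V) ((soExp X s).symm x)) = (X : Module.End ℝ V) x
  have h : Commute (NormedSpace.exp (s • soCLM X)) (soCLM X) :=
    ((Commute.refl (soCLM X)).smul_left s).exp_left
  have h2 : soExp X s ((X : Module.End ℝ V) ((soExp X s).symm x)) =
      (X : Module.End ℝ V) (soExp X s ((soExp X s).symm x)) :=
    DFunLike.congr_fun h.eq ((soExp X s).symm x)
  rw [h2, LinearIsometryEquiv.apply_symm_apply]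

/-- The equivariance condition `g^*(α(g X g⁻¹)) = α(X)` for `g ∈ SO(V)`, on all components and for
maps which need not be polynomial. -/
def IsEquivariant (α : EForm V) : Prop :=
  ∀ g ∈ SO V, ∀ (X : so V) (p : ℕ) (x : V) (v : Fin p → V),
      α (Ad g X) p (g x) (fun i => g (v i)) = α X p x v

theorem dForm_top_succ (a : Form V) (p : ℕ) : dForm ⊤ a (p + 1) = extDeriv (a p) := by
  funext x
  simp [dForm]

theorem mem_smoothForms_top {a : Form V} :
    a ∈ smoothForms (⊤ : TopologicalSpace.Opens V) ↔ ∀ p, ContDiff ℝ ∞ (a p) := by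
  change (∀ p, ContDiffOn ℝ ∞ (a p) (⊤ : TopologicalSpace.Opens V) ∧ ∀ x ∉ _, a p x = 0) ↔ _
  simp [contDiffOn_univ]

/-- The Lie derivative `L(VX) = d ι(VX) + ι(VX) d` annihilates `α(X)` when `α` is equivariant. -/
theorem IsEquivariant.lieDeriv_eq_zero {α : EForm V} (hα : IsEquivariant α) (X : so V)
    (hs : ∀ p, Differentiable ℝ (α X p)) :
    dForm ⊤ (contract (vecField X) (α X)) + contract (vecField X) (dForm ⊤ (α X)) = 0 := by
  -- `s ↦ exp(sX)^* α(X)` is constant, since `exp(sX)` commutes with `X`; its derivative at `s = 0`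
  -- is the Lie derivative of `α(X)`.
  have hA : HasDerivAt (fun s : ℝ => NormedSpace.exp (s • soCLM X)) (soCLM X) 0 := by
    simpa using hasDerivAt_exp_smul_const (𝕂 := ℝ) (soCLM X) 0
  have h0 : NormedSpace.exp ((0 : ℝ) • soCLM X) = 1 := by simp
  have hc (p : ℕ) (x : V) : (fun s : ℝ => (α X p (NormedSpace.exp (s • soCLM X) x + 0)
      ).compContinuousLinearMap (NormedSpace.exp (s • soCLM X))) = fun _ => α X p x := by
    funext s
    ext v
    have := hα _ (soExp_mem_SO X s) X p x v
    rw [Ad_soExp] at this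
    rw [add_zero]
    exact this
  have hv : vecField X = fun x => -(soCLM X x + 0) := by
    funext x; simp [vecField]
  funext p x
  cases p with
  | zero =>
    have := (hasDerivAt_pullback_affine_zero (a := α X 0) (x := x) hA
      (hasDerivAt_const (0 : ℝ) (0 : V)) (hs 0 _)).unique
      (by rw [hc]; exact hasDerivAt_const _ _)
    rw [h0] at this
    ext v
    have h2 := congrArg (fun f : V [⋀^Fin 0]→L[ℝ] ℝ => f v) this
    simp at h2
    simp only [Pi.add_apply, contract, dForm_top_succ, hv]
    simpa [dForm] using h2
  | succ p =>
    have := (hasDerivAt_pullback_affine (a := α X (p + 1)) (x := x) hA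
      (hasDerivAt_const (0 : ℝ) (0 : V)) (hs (p + 1) _)).unique
      (by rw [hc]; exact hasDerivAt_const _ _)
    rw [h0] at this
    have e1 : (fun x => ((α X (p + 1) ((1 : V →L[ℝ] V) x + 0)).curryLeft
        (soCLM X x + 0)).compContinuousLinearMap 1) =
        -(contract (vecField X) (α X) p) := by
      funext x
      ext v
      simp [contract, vecField]
    rw [e1] at this
    have e2 : extDeriv (-(contract (vecField X) (α X) p)) x =
        - extDeriv (contract (vecField X) (α X) p) x := by
      have := extDeriv_smul (x := x) (-1 : ℝ) (contract (vecField X) (α X) p)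
      simpa using this
    rw [e2] at this
    ext v
    have h2 := congrArg (fun f : V [⋀^Fin (p + 1)]→L[ℝ] ℝ => f v) this
    simp at h2
    simp only [Pi.add_apply, contract, dForm_top_succ, vecField] at h2 ⊢
    simp
    linarith

end InfinitesimalInvariance

/-! ### Equivariant polynomial maps -/

theorem contDiff_clm_comp {E F G : Type*} [NormedAddCommGroup E] [NormedSpace ℝ E]
    [NormedAddCommGroup F] [NormedSpace ℝ F] [NormedAddCommGroup G] [NormedSpace ℝ G]
    (L : F →L[ℝ] G) {f : E → F} {n : WithTop ℕ∞} (h : ContDiff ℝ n f) :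
    ContDiff ℝ n (fun y => L (f y)) :=
  L.contDiff.comp h

section PolynomialMaps

variable {V : Type*} [NormedAddCommGroup V] [InnerProductSpace ℝ V]

/-- `C^pol(so(V)) ⊗ 𝓐`: the polynomial maps from `so(V)` to a space `𝓐` of forms. -/
def polyMaps (𝓐 : Submodule ℝ (Form V)) : Submodule ℝ (EForm V) :=
  Submodule.span ℝ {γ : EForm V | ∃ P ∈ polyFun V, ∃ a ∈ 𝓐, γ = fun X => P X • a}

theorem mem_eqForms {𝓐 : Submodule ℝ (Form V)} {α : EForm V} :
    α ∈ eqForms 𝓐 ↔ α ∈ polyMaps 𝓐 ∧ IsEquivariant α := Iff.rfl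

theorem polyMaps_smul_mem {𝓐 : Submodule ℝ (Form V)} {P : so V → ℝ} (hP : P ∈ polyFun V)
    {a : Form V} (ha : a ∈ 𝓐) : (fun X => P X • a) ∈ polyMaps 𝓐 :=
  Submodule.subset_span ⟨P, hP, a, ha, rfl⟩

theorem polyMaps_const_mem {𝓐 : Submodule ℝ (Form V)} {a : Form V} (ha : a ∈ 𝓐) :
    (fun _ => a) ∈ polyMaps 𝓐 := by
  simpa using polyMaps_smul_mem (one_mem (polyFun V)) ha

theorem polyMaps_apply_mem {𝓐 : Submodule ℝ (Form V)} {α : EForm V} (hα : α ∈ polyMaps 𝓐)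
    (X : so V) : α X ∈ 𝓐 := by
  induction hα using Submodule.span_induction with
  | mem γ h =>
    obtain ⟨P, hP, a, ha, rfl⟩ := h
    exact 𝓐.smul_mem _ ha
  | zero => exact 𝓐.zero_mem
  | add β γ _ _ hb hc => exact 𝓐.add_mem hb hc
  | smul c β _ hb => exact 𝓐.smul_mem c hb

theorem polyFun_smul_polyMaps {𝓐 : Submodule ℝ (Form V)} {P : so V → ℝ} (hP : P ∈ polyFun V)
    {α : EForm V} (hα : α ∈ polyMaps 𝓐) : (fun X => P X • α X) ∈ polyMaps 𝓐 := by
  induction hα using Submodule.span_induction with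
  | mem γ h =>
    obtain ⟨Q, hQ, a, ha, rfl⟩ := h
    simpa [mul_smul] using polyMaps_smul_mem (mul_mem hP hQ) ha
  | zero =>
    convert zero_mem (polyMaps 𝓐) using 1
    funext X
    exact smul_zero (P X)
  | add β γ _ _ hb hc =>
    convert add_mem hb hc using 1
    funext X
    exact smul_add (P X) _ _
  | smul c β _ hb =>
    convert (polyMaps 𝓐).smul_mem c hb using 1
    funext X
    exact smul_comm (P X) c (β X)

/-- A linear operation on forms, applied pointwise in `X`, preserves polynomial maps. -/
theorem polyMaps_map {𝓐 𝓑 : Submodule ℝ (Form V)} (K : Form V → Form V)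
    (hadd : ∀ a ∈ 𝓐, ∀ b ∈ 𝓐, K (a + b) = K a + K b)
    (hsmul : ∀ c : ℝ, ∀ a ∈ 𝓐, K (c • a) = c • K a) (hmem : ∀ a ∈ 𝓐, K a ∈ 𝓑)
    {α : EForm V} (hα : α ∈ polyMaps 𝓐) : (fun X => K (α X)) ∈ polyMaps 𝓑 := by
  induction hα using Submodule.span_induction with
  | mem γ h =>
    obtain ⟨P, hP, a, ha, rfl⟩ := h
    simp only [hsmul _ a ha]
    exact polyMaps_smul_mem hP (hmem a ha)
  | zero =>
    have h : K 0 = 0 := by simpa using hsmul 0 0 𝓐.zero_mem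
    simp only [Pi.zero_apply, h]
    exact zero_mem (polyMaps 𝓑)
  | add β γ hβ hγ hb hc =>
    convert add_mem hb hc using 1
    funext X
    exact hadd _ (polyMaps_apply_mem hβ X) _ (polyMaps_apply_mem hγ X)
  | smul c β hβ hb =>
    convert (polyMaps 𝓑).smul_mem c hb using 1
    funext X
    exact hsmul c _ (polyMaps_apply_mem hβ X)

theorem linear_mem_polyFun (l : Module.Dual ℝ (so V)) : (fun X => l X) ∈ polyFun V :=
  Algebra.subset_adjoin ⟨l, rfl⟩

/-- A space of smooth forms on `V` which is stable under the operations making up the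
equivariant differential. -/
structure IsStable (𝓐 : Submodule ℝ (Form V)) : Prop where
  smooth : 𝓐 ≤ smoothForms ⊤
  dForm_mem : ∀ a ∈ 𝓐, dForm ⊤ a ∈ 𝓐
  contract_mem : ∀ a ∈ 𝓐, ∀ X : so V, contract (vecField X) a ∈ 𝓐

variable [FiniteDimensional ℝ V]

theorem contract_mem_polyMaps {𝓐 : Submodule ℝ (Form V)}
    (h : ∀ a ∈ 𝓐, ∀ X : so V, contract (vecField X) a ∈ 𝓐) {α : EForm V}
    (hα : α ∈ polyMaps 𝓐) : (fun X => contract (vecField X) (α X)) ∈ polyMaps 𝓐 := by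
  induction hα using Submodule.span_induction with
  | mem γ hγ =>
    obtain ⟨P, hP, a, ha, rfl⟩ := hγ
    -- `X ↦ ι(VX)` is linear in `X`, so it is expanded in a basis of `so(V)`.
    let b := Module.finBasis ℝ (so V)
    have hb (X : so V) : contract (vecField X) (P X • a) =
        ∑ i, (P X * b.coord i X) • contract (vecField (b i)) a := by
      simp only [contract_smul, mul_smul, ← Finset.smul_sum]
      congr 1
      have hv : vecField X = fun x => ∑ i, b.coord i X • vecField (b i) x := by
        funext x
        have h1 := congrArg (fun Y : so V => (Y : Module.End ℝ V) x) (b.sum_repr X)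
        simp only [Submodule.coe_sum, LinearMap.sum_apply] at h1
        simp [vecField, ← h1]
      funext p x
      simp only [Finset.sum_apply, Pi.smul_apply, contract]
      rw [hv]
      simp only [map_sum, map_smul]
    simp only [hb]
    have : (fun X => ∑ i, (P X * b.coord i X) • contract (vecField (b i)) a) =
        ∑ i, fun X : so V => (P X * b.coord i X) • contract (vecField (b i)) a := by
      funext X
      rw [Finset.sum_apply]
    rw [this]
    exact sum_mem fun i _ =>
      polyMaps_smul_mem (mul_mem hP (linear_mem_polyFun (b.coord i))) (h a ha _)
  | zero =>
    convert zero_mem (polyMaps 𝓐) using 1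
    funext X
    exact (by simpa using contract_smul (vecField X) 0 (0 : Form V))
  | add β γ hβ hγ hb hc =>
    convert add_mem hb hc using 1
    funext X
    exact contract_add _ _ _
  | smul c β hβ hb =>
    convert (polyMaps 𝓐).smul_mem c hb using 1
    funext X
    exact contract_smul _ _ _

theorem IsEquivariant.apply_eq {α : EForm V} (hα : IsEquivariant α) {g : V ≃ₗᵢ[ℝ] V}
    (hg : g ∈ SO V) (X : so V) (p : ℕ) :
    α X p = fun x => (α (Ad g X) p (g x)).compContinuousLinearMap
      (g.toContinuousLinearEquiv : V →L[ℝ] V) := by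
  funext x
  ext v
  exact (hα g hg X p x v).symm

theorem vecField_Ad (g : V ≃ₗᵢ[ℝ] V) (X : so V) (x : V) :
    vecField (Ad g X) (g x) = g (vecField X x) := by
  simp only [vecField, map_neg]
  congr 1
  change g ((X : Module.End ℝ V) (g.symm (g x))) = _
  simp

theorem IsEquivariant.contract {α : EForm V} (hα : IsEquivariant α) :
    IsEquivariant (fun X => contract (vecField X) (α X)) := by
  intro g hg X p x v
  have h := hα g hg X (p + 1) x (Matrix.vecCons (vecField X x) v)
  simp only [EquivariantThom.contract, ContinuousAlternatingMap.curryLeft_apply_apply] at h ⊢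
  rw [← h, vecField_Ad]
  congr 1
  funext i
  refine Fin.cases ?_ (fun j => ?_) i <;> simp

theorem IsEquivariant.dForm {α : EForm V} (hα : IsEquivariant α)
    (hs : ∀ X p, Differentiable ℝ (α X p)) :
    IsEquivariant (fun X => dForm ⊤ (α X)) := by
  intro g hg X p x v
  cases p with
  | zero => rfl
  | succ p =>
    change EquivariantThom.dForm ⊤ (α (Ad g X)) (p + 1) (g x) (fun i => g (v i)) =
      EquivariantThom.dForm ⊤ (α X) (p + 1) x v
    rw [dForm_top_succ, dForm_top_succ, hα.apply_eq hg X p]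
    have h := extDeriv_pullback (r := 2) (x := x)
      (f := (g.toContinuousLinearEquiv : V →L[ℝ] V)) (hs (Ad g X) p (g x))
      (ContinuousLinearMap.contDiff _).contDiffAt (by simp)
    simp only [ContinuousLinearMap.fderiv] at h
    exact (congrArg (fun f : V [⋀^Fin (p + 1)]→L[ℝ] ℝ => f v) h).symm

theorem eqForms_differentiable {𝓐 : Submodule ℝ (Form V)} (h : 𝓐 ≤ smoothForms ⊤) {α : EForm V}
    (hα : α ∈ polyMaps 𝓐) (X : so V) (p : ℕ) : ContDiff ℝ ∞ (α X p) :=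
  mem_smoothForms_top.1 (h (polyMaps_apply_mem hα X)) p

theorem IsStable.eqDiff_mem {𝓐 : Submodule ℝ (Form V)} (h : IsStable 𝓐) {α : EForm V}
    (hα : α ∈ eqForms 𝓐) : eqDiff ⊤ α ∈ eqForms 𝓐 := by
  rw [mem_eqForms] at hα ⊢
  refine ⟨sub_mem (polyMaps_map (𝓐 := 𝓐) (dForm ⊤)
    (fun a ha b hb => dForm_add (h.smooth ha) (h.smooth hb))
    (fun c a _ => dForm_smul _ c a) h.dForm_mem hα.1)
    (contract_mem_polyMaps h.contract_mem hα.1), ?_⟩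
  have h1 := hα.2.dForm fun X p =>
    (eqForms_differentiable h.smooth hα.1 X p).differentiable (by simp)
  have h2 := hα.2.contract
  intro g hg X p x v
  exact congrArg₂ (· - ·) (h1 g hg X p x v) (h2 g hg X p x v)

theorem dForm_dForm {a : Form V} (ha : a ∈ smoothForms ⊤) : dForm ⊤ (dForm ⊤ a) = 0 := by
  funext p x
  match p with
  | 0 => rfl
  | 1 =>
    rw [dForm_top_succ]
    change extDeriv (fun _ => 0) x = 0
    exact extDeriv_fun_const 0 x
  | p + 2 =>
    rw [dForm_top_succ, dForm_top_succ]
    exact extDeriv_extDeriv_apply (r := 2)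
      ((mem_smoothForms_top.1 ha p).of_le
        (show ((2 : ℕ∞) : WithTop ℕ∞) ≤ ∞ from mod_cast le_top)).contDiffAt (by simp)

theorem contract_contract (S : V → V) (a : Form V) : contract S (contract S a) = 0 := by
  funext p x
  simp [contract]

theorem isStable_smoothForms : IsStable (smoothForms (⊤ : TopologicalSpace.Opens V)) where
  smooth := le_rfl
  dForm_mem a ha := by
    rw [mem_smoothForms_top] at ha ⊢
    intro p
    cases p with
    | zero => exact contDiff_const
    | succ p =>
      rw [dForm_top_succ]
      exact (ContinuousAlternatingMap.alternatizeUncurryFinCLM ℝ V ℝ).contDiff.comp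
        ((ha p).fderiv_right (m := ∞) (by simp))
  contract_mem a ha X := by
    rw [mem_smoothForms_top] at ha ⊢
    intro p
    have h1 : ContDiff ℝ ∞ (fun x => curryLeftCLM V p (a (p + 1) x)) :=
      contDiff_clm_comp (F := V [⋀^Fin (p + 1)]→L[ℝ] ℝ) (G := V →L[ℝ] V [⋀^Fin p]→L[ℝ] ℝ)
        (curryLeftCLM V p) (ha (p + 1))
    have h2 : ContDiff ℝ ∞ (vecField X) := (soCLM X).contDiff.neg
    exact h1.clm_apply h2

/-- The equivariant differential squares to zero on equivariant forms: its square is the Lie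
derivative along `-VX`. -/
theorem eqDiff_eqDiff {α : EForm V} (hα : α ∈ eqForms (smoothForms ⊤)) :
    eqDiff ⊤ (eqDiff ⊤ α) = 0 := by
  rw [mem_eqForms] at hα
  funext X
  have hs := polyMaps_apply_mem hα.1 X
  have h1 := isStable_smoothForms.dForm_mem _ hs
  have h2 := isStable_smoothForms.contract_mem _ hs X
  have h3 := hα.2.lieDeriv_eq_zero X fun p =>
    (eqForms_differentiable le_rfl hα.1 X p).differentiable (by simp)
  have e1 : dForm ⊤ (dForm ⊤ (α X) - contract (vecField X) (α X)) =
      - dForm ⊤ (contract (vecField X) (α X)) := by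
    rw [sub_eq_add_neg, ← neg_one_smul ℝ, dForm_add h1 (Submodule.smul_mem _ _ h2), dForm_smul,
      dForm_dForm hs, zero_add]
    exact neg_one_smul ℝ (dForm ⊤ (contract (vecField X) (α X)))
  have e2 : contract (vecField X) (dForm ⊤ (α X) - contract (vecField X) (α X)) =
      contract (vecField X) (dForm ⊤ (α X)) := by
    rw [sub_eq_add_neg, ← neg_one_smul ℝ, contract_add, contract_smul, contract_contract]
    simp
  change dForm ⊤ (dForm ⊤ (α X) - contract (vecField X) (α X)) -
    contract (vecField X) (dForm ⊤ (α X) - contract (vecField X) (α X)) = 0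
  rw [e1, e2, ← neg_add', h3, neg_zero]

theorem alternating_eq_zero {d : ℕ} (e : OrthonormalBasis (Fin d) ℝ V) {p : ℕ} (hp : d < p)
    (f : V [⋀^Fin p]→L[ℝ] ℝ) : f = 0 := by
  ext v
  refine f.toAlternatingMap.map_linearDependent v fun hv => ?_
  have h1 := hv.fintype_card_le_finrank
  have h2 := Module.finrank_eq_card_basis e.toBasis
  simp at h1 h2
  omega

end PolynomialMaps

/-! ### Smoothness of parametric integrals -/

section ParametricIntegrals

open MeasureTheory Filter

variable {Ω E G : Type*} [NormedAddCommGroup E] [NormedSpace ℝ E] [NormedAddCommGroup G]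
  [NormedSpace ℝ G]

/-- The partial derivatives in the second variable of a function of two variables are smooth
functions of both variables. -/
theorem contDiffAt_iteratedFDeriv_param [NormedAddCommGroup Ω] [NormedSpace ℝ Ω] {F : Ω → E → G}
    (n : ℕ) {q : Ω × E} (h : ContDiffAt ℝ ∞ (fun q : Ω × E => F q.1 q.2) q) :
    ContDiffAt ℝ ∞ (fun q : Ω × E => iteratedFDeriv ℝ n (F q.1) q.2) q := by
  induction n with
  | zero =>
    have h1 := (continuousMultilinearCurryFin0 ℝ E G).symm.contDiff (n := ∞)
    exact h1.contDiffAt.comp q h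
  | succ n ih =>
    have h1 := LinearIsometryEquiv.contDiff (n := ∞) (𝕜 := ℝ) (E := E →L[ℝ] E [×n]→L[ℝ] G)
      (F := E [×(n + 1)]→L[ℝ] G)
      (continuousMultilinearCurryLeftEquiv ℝ (fun _ : Fin (n + 1) => E) G).symm
    refine h1.contDiffAt.comp q ?_
    refine ContDiffAt.fderiv (n := ∞) (f := fun q : Ω × E => iteratedFDeriv ℝ n (F q.1)) ?_
      contDiffAt_snd (by simp)
    have h2 : ContDiffAt ℝ ∞ (fun r : (Ω × E) × E => (r.1.1, r.2)) (q, q.2) := by fun_prop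
    exact ContDiffAt.comp (q, q.2) (g := fun q : Ω × E => iteratedFDeriv ℝ n (F q.1) q.2) ih h2

variable [MeasurableSpace Ω] {μ : Measure Ω} {F : Ω → E → G} {U : Set E}

/-- Differentiation under the integral sign of the `n`-th derivative; the bound on the derivative
of order `n + 1` serves as the dominating function. -/
theorem hasFDerivAt_integral_iteratedFDeriv (hU : IsOpen U)
    (hF : ∀ᵐ w ∂μ, ContDiffOn ℝ ∞ (F w) U)
    (hmeas : ∀ n : ℕ, ∀ x ∈ U, AEStronglyMeasurable (fun w => iteratedFDeriv ℝ n (F w) x) μ)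
    (hbound : ∀ n : ℕ, ∀ x ∈ U, ∃ s ∈ 𝓝 x, ∃ bound : Ω → ℝ, Integrable bound μ ∧
      ∀ᵐ w ∂μ, ∀ y ∈ s, ‖iteratedFDeriv ℝ n (F w) y‖ ≤ bound w) (n : ℕ) {x : E} (hx : x ∈ U) :
    Integrable (fun w => iteratedFDeriv ℝ n (F w) x) μ ∧
    HasFDerivAt (fun x => ∫ w, iteratedFDeriv ℝ n (F w) x ∂μ)
      (∫ w, fderiv ℝ (iteratedFDeriv ℝ n (F w)) x ∂μ) x := by
  obtain ⟨s, hs, bound, hb, hle⟩ := hbound n x hx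
  obtain ⟨s', hs', bound', hb', hle'⟩ := hbound (n + 1) x hx
  have hint : Integrable (fun w => iteratedFDeriv ℝ n (F w) x) μ :=
    hb.mono' (hmeas n x hx) (hle.mono fun w h => h x (mem_of_mem_nhds hs))
  refine ⟨hint, ?_⟩
  refine hasFDerivAt_integral_of_dominated_of_fderiv_le
    (F := fun y w => iteratedFDeriv ℝ n (F w) y)
    (F' := fun y w => fderiv ℝ (iteratedFDeriv ℝ n (F w)) y) (s := s' ∩ U) (bound := bound')
    (inter_mem hs' (hU.mem_nhds hx)) ?_ hint ?_ ?_ hb' ?_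
  · filter_upwards [hU.mem_nhds hx] with y hy using hmeas n y hy
  · rw [show (fun w => fderiv ℝ (iteratedFDeriv ℝ n (F w)) x) = fun w =>
      continuousMultilinearCurryLeftEquiv ℝ (fun _ : Fin (n + 1) => E) G
        (iteratedFDeriv ℝ (n + 1) (F w) x) from funext fun w => by
          rw [fderiv_iteratedFDeriv]; rfl]
    exact (continuousMultilinearCurryLeftEquiv ℝ (fun _ : Fin (n + 1) => E)
      G).continuous.comp_aestronglyMeasurable (hmeas (n + 1) x hx)
  · filter_upwards [hle'] with w h y hy
    rw [norm_fderiv_iteratedFDeriv]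
    exact h y hy.1
  · filter_upwards [hF] with w h y hy
    refine DifferentiableAt.hasFDerivAt ?_
    exact (h.contDiffAt (hU.mem_nhds hy.2)).differentiableAt_iteratedFDeriv (m := n)
      (by exact_mod_cast ENat.natCast_lt_top n)

/-- Differentiation under the integral sign, to all orders. -/
theorem hasFTaylorSeriesUpToOn_integral [CompleteSpace G] (hU : IsOpen U)
    (hF : ∀ᵐ w ∂μ, ContDiffOn ℝ ∞ (F w) U)
    (hmeas : ∀ n : ℕ, ∀ x ∈ U, AEStronglyMeasurable (fun w => iteratedFDeriv ℝ n (F w) x) μ)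
    (hbound : ∀ n : ℕ, ∀ x ∈ U, ∃ s ∈ 𝓝 x, ∃ bound : Ω → ℝ, Integrable bound μ ∧
      ∀ᵐ w ∂μ, ∀ y ∈ s, ‖iteratedFDeriv ℝ n (F w) y‖ ≤ bound w) :
    HasFTaylorSeriesUpToOn ∞ (fun x => ∫ w, F w x ∂μ)
      (fun x n => ∫ w, iteratedFDeriv ℝ n (F w) x ∂μ) U where
  zero_eq x hx := by
    have h := (hasFDerivAt_integral_iteratedFDeriv hU hF hmeas hbound 0 hx).1
    have h2 := ((continuousMultilinearCurryFin0 ℝ E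
      G).toContinuousLinearEquiv.toContinuousLinearMap).integral_comp_comm h
    exact h2.symm
  fderivWithin n _ x hx := by
    obtain ⟨h1, h2⟩ := hasFDerivAt_integral_iteratedFDeriv hU hF hmeas hbound n hx
    have h3 := (hasFDerivAt_integral_iteratedFDeriv hU hF hmeas hbound (n + 1) hx).1
    have h4 := ContinuousLinearMap.integral_comp_comm (𝕜 := ℝ) (E := E [×(n + 1)]→L[ℝ] G)
      (Fₗ := E →L[ℝ] E [×n]→L[ℝ] G)
      ((continuousMultilinearCurryLeftEquiv ℝ (fun _ : Fin (n + 1) => E)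
        G).toContinuousLinearEquiv.toContinuousLinearMap) h3
    exact (h2.congr_fderiv h4).hasFDerivWithinAt
  cont n _ x hx :=
    (hasFDerivAt_integral_iteratedFDeriv hU hF hmeas hbound n
      hx).2.continuousAt.continuousWithinAt

/-- A parametric integral is smooth when all derivatives of the integrand are locally dominated by
integrable functions, and its derivative is the integral of the derivative. -/
theorem contDiffOn_integral [CompleteSpace G] (hU : IsOpen U)
    (hF : ∀ᵐ w ∂μ, ContDiffOn ℝ ∞ (F w) U)
    (hmeas : ∀ n : ℕ, ∀ x ∈ U, AEStronglyMeasurable (fun w => iteratedFDeriv ℝ n (F w) x) μ)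
    (hbound : ∀ n : ℕ, ∀ x ∈ U, ∃ s ∈ 𝓝 x, ∃ bound : Ω → ℝ, Integrable bound μ ∧
      ∀ᵐ w ∂μ, ∀ y ∈ s, ‖iteratedFDeriv ℝ n (F w) y‖ ≤ bound w) :
    ContDiffOn ℝ ∞ (fun x => ∫ w, F w x ∂μ) U ∧
    (∀ x ∈ U, Integrable (fun w => F w x) μ) ∧ (∀ x ∈ U, Integrable (fun w => fderiv ℝ (F w) x) μ) ∧
    ∀ x ∈ U, HasFDerivAt (fun x => ∫ w, F w x ∂μ) (∫ w, fderiv ℝ (F w) x ∂μ) x := by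
  have hT := hasFTaylorSeriesUpToOn_integral hU hF hmeas hbound
  have h1 (x) (hx : x ∈ U) : Integrable (fun w => fderiv ℝ (F w) x) μ := by
    have := (hasFDerivAt_integral_iteratedFDeriv hU hF hmeas hbound 1 hx).1
    have h2 := ((continuousMultilinearCurryFin1 ℝ E
      G).toContinuousLinearEquiv.toContinuousLinearMap).integrable_comp this
    refine h2.congr (Eventually.of_forall fun w => ?_)
    ext v
    simp
  have h0 (x) (hx : x ∈ U) : Integrable (fun w => F w x) μ := by
    have := (hasFDerivAt_integral_iteratedFDeriv hU hF hmeas hbound 0 hx).1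
    exact ((continuousMultilinearCurryFin0 ℝ E
      G).toContinuousLinearEquiv.toContinuousLinearMap).integrable_comp this
  refine ⟨hT.contDiffOn, h0, h1, fun x hx => ?_⟩
  have h3 := hT.hasFDerivWithinAt (by simp) hx
  have h4 := h3.hasFDerivAt (hU.mem_nhds hx)
  refine h4.congr_fderiv ?_
  have h5 := ((continuousMultilinearCurryFin1 ℝ E
      G).toContinuousLinearEquiv.toContinuousLinearMap).integral_comp_comm
        (hasFDerivAt_integral_iteratedFDeriv hU hF hmeas hbound 1 hx).1
  refine h5.symm.trans (integral_congr_ae (Eventually.of_forall fun w => ?_))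
  ext v
  simp

end ParametricIntegrals

/-! ### Rapidly decreasing forms -/

section SchwartzForms

open MeasureTheory Filter

open scoped SchwartzMap

variable {V : Type*} [NormedAddCommGroup V] [InnerProductSpace ℝ V] [FiniteDimensional ℝ V]

theorem mem_rapidForms {a : Form V} :
    a ∈ rapidForms V ↔ ∀ p, ∃ s : 𝓢(V, V [⋀^Fin p]→L[ℝ] ℝ), ⇑s = a p := by
  constructor
  · intro ha p
    exact ⟨⟨a p, mem_smoothForms_top.1 ha.1 p, ha.2 p⟩, rfl⟩
  · intro h
    refine ⟨mem_smoothForms_top.2 fun p => ?_, fun p k n => ?_⟩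
    · obtain ⟨s, hs⟩ := h p
      rw [← hs]
      exact s.smooth ⊤
    · obtain ⟨s, hs⟩ := h p
      rw [← hs]
      obtain ⟨C, _, hC⟩ := s.decay k n
      exact ⟨C, hC⟩

theorem mem_compactForms {a : Form V} :
    a ∈ compactForms V ↔ ∀ p, ContDiff ℝ ∞ (a p) ∧ HasCompactSupport (a p) :=
  ⟨fun h p => ⟨mem_smoothForms_top.1 h.1 p, h.2 p⟩,
    fun h => ⟨mem_smoothForms_top.2 fun p => (h p).1, fun p => (h p).2⟩⟩

theorem compactForms_le_rapidForms : compactForms V ≤ rapidForms V := fun _ ha =>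
  mem_rapidForms.2 fun p =>
    ⟨((mem_compactForms.1 ha p).2).toSchwartzMap (mem_compactForms.1 ha p).1, rfl⟩

theorem isStable_rapidForms : IsStable (rapidForms V) where
  smooth := rapidForms_le
  dForm_mem a ha := by
    rw [mem_rapidForms] at ha ⊢
    intro p
    cases p with
    | zero => exact ⟨0, rfl⟩
    | succ p =>
      obtain ⟨s, hs⟩ := ha p
      refine ⟨SchwartzMap.postcompCLM (𝕜 := ℝ) (F := V →L[ℝ] V [⋀^Fin p]→L[ℝ] ℝ)
        (G := V [⋀^Fin (p + 1)]→L[ℝ] ℝ)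
        (ContinuousAlternatingMap.alternatizeUncurryFinCLM ℝ V ℝ (n := p))
        (SchwartzMap.fderivCLM ℝ V (V [⋀^Fin p]→L[ℝ] ℝ) s), ?_⟩
      rw [dForm_top_succ, ← hs]
      rfl
  contract_mem a ha X := by
    rw [mem_rapidForms] at ha ⊢
    intro p
    obtain ⟨s, hs⟩ := ha (p + 1)
    have hg : Function.HasTemperateGrowth (vecField X) :=
      (soCLM X).hasTemperateGrowth.neg
    refine ⟨SchwartzMap.bilinLeftCLM (E := V [⋀^Fin (p + 1)]→L[ℝ] ℝ)
      (G := V [⋀^Fin p]→L[ℝ] ℝ) (curryLeftCLM V p) hg s, ?_⟩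
    rw [SchwartzMap.bilinLeftCLM_apply, hs]
    rfl

theorem isStable_compactForms : IsStable (compactForms V) where
  smooth := compactForms_le
  dForm_mem a ha := by
    refine ⟨isStable_smoothForms.dForm_mem a ha.1, fun p => ?_⟩
    cases p with
    | zero => exact HasCompactSupport.zero
    | succ p =>
      rw [dForm_top_succ]
      exact (ha.2 p).fderiv (𝕜 := ℝ) |>.comp_left
        (g := ContinuousAlternatingMap.alternatizeUncurryFinCLM ℝ V ℝ) (map_zero _)
  contract_mem a ha X := by
    refine ⟨isStable_smoothForms.contract_mem a ha.1 X, fun p => ?_⟩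
    refine (ha.2 (p + 1)).mono fun x hx => ?_
    contrapose! hx
    simp only [Function.mem_support, not_not] at hx ⊢
    simp [contract, hx]

theorem norm_pow_le_of_sub {V : Type*} [NormedAddCommGroup V] (x c : V) (k : ℕ) :
    ‖x‖ ^ k ≤ 2 ^ k * (‖x - c‖ ^ k + ‖c‖ ^ k) := by
  have h : ‖x‖ ≤ ‖x - c‖ + ‖c‖ := by simpa using norm_add_le (x - c) c
  calc ‖x‖ ^ k ≤ (‖x - c‖ + ‖c‖) ^ k := by gcongr
    _ ≤ 2 ^ (k - 1) * (‖x - c‖ ^ k + ‖c‖ ^ k) := add_pow_le (norm_nonneg _) (norm_nonneg _) k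
    _ ≤ 2 ^ k * (‖x - c‖ ^ k + ‖c‖ ^ k) := by
      gcongr
      · norm_num
      · omega

/-- A superposition of translates of a Schwartz function, with operator coefficients which are
integrable against all powers of the translation, is a Schwartz function. -/
theorem exists_schwartz_superposition {Ω E₁ G : Type*} [NormedAddCommGroup E₁] [NormedSpace ℝ E₁]
    [NormedAddCommGroup G] [NormedSpace ℝ G] [CompleteSpace G] [TopologicalSpace Ω]
    [SecondCountableTopology Ω] [MeasurableSpace Ω] [OpensMeasurableSpace Ω] {μ : Measure Ω}
    (f : 𝓢(V, E₁)) {L : Ω → E₁ →L[ℝ] G} {c : Ω → V} (hL : Continuous L) (hc : Continuous c)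
    (hint : ∀ k : ℕ, Integrable (fun w => ‖L w‖ * ‖c w‖ ^ k) μ) :
    ∃ s : 𝓢(V, G), ∀ x, s x = ∫ w, L w (f (x - c w)) ∂μ ∧
      Integrable (fun w => L w (f (x - c w))) μ ∧
      Integrable (fun w => (L w).comp (fderiv ℝ f (x - c w))) μ ∧
      HasFDerivAt s (∫ w, (L w).comp (fderiv ℝ f (x - c w)) ∂μ) x := by
  have hsm (w : Ω) : ContDiff ℝ ∞ (fun x => f (x - c w)) :=
    (f.smooth ⊤).comp (contDiff_id.sub contDiff_const)
  have hF (w : Ω) : ContDiff ℝ ∞ (fun x => L w (f (x - c w))) := (L w).contDiff.comp (hsm w)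
  have hiter (n : ℕ) (w : Ω) (x : V) : iteratedFDeriv ℝ n (fun x => L w (f (x - c w))) x =
      (L w).compContinuousMultilinearMap (iteratedFDeriv ℝ n f (x - c w)) := by
    have h1 := (L w).iteratedFDeriv_comp_left (f := fun x => f (x - c w)) (x := x)
      (hsm w).contDiffAt (i := n) (by exact_mod_cast le_top)
    have h2 := iteratedFDeriv_comp_sub (𝕜 := ℝ) (f := f) n (c w) x
    rw [← h2]
    exact h1
  have hmeas (n : ℕ) (x : V) (_ : x ∈ (Set.univ : Set V)) : AEStronglyMeasurable
      (fun w => iteratedFDeriv ℝ n (fun x => L w (f (x - c w))) x) μ := by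
    simp only [hiter]
    have h1 : Continuous fun w => iteratedFDeriv ℝ n f (x - c w) :=
      ((f.smooth ⊤).continuous_iteratedFDeriv (by exact_mod_cast le_top)).comp
        (continuous_const.sub hc)
    have h2 : Continuous fun w => (L w).compContinuousMultilinearMap
        (iteratedFDeriv ℝ n f (x - c w)) :=
      ((ContinuousLinearMap.compContinuousMultilinearMapL ℝ (fun _ : Fin n => V) E₁
        G).continuous.comp hL).clm_apply h1
    exact h2.aestronglyMeasurable
  -- The weight `‖x‖ ^ k` is shared between `x - c w`, where the decay of `f` absorbs it, and `c
  -- w`, where the integrability of `‖L w‖ * ‖c w‖ ^ k` does.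
  have hle (k n : ℕ) : ∃ C : ℝ, ∀ w x,
      ‖x‖ ^ k * ‖iteratedFDeriv ℝ n (fun x => L w (f (x - c w))) x‖ ≤
        C * (‖L w‖ * ‖c w‖ ^ 0 + ‖L w‖ * ‖c w‖ ^ k) := by
    obtain ⟨C₁, -, hC₁⟩ := f.decay k n
    obtain ⟨C₂, -, hC₂⟩ := f.decay 0 n
    refine ⟨2 ^ k * (|C₁| + |C₂|), fun w x => ?_⟩
    have e1 := hC₁ (x - c w)
    have e2 := hC₂ (x - c w)
    simp only [pow_zero, one_mul] at e2
    rw [hiter]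
    have e3 := (L w).norm_compContinuousMultilinearMap_le (iteratedFDeriv ℝ n f (x - c w))
    calc _ ≤ (2 ^ k * (‖x - c w‖ ^ k + ‖c w‖ ^ k)) *
          (‖L w‖ * ‖iteratedFDeriv ℝ n f (x - c w)‖) := by
          gcongr; exact norm_pow_le_of_sub _ _ _
      _ = 2 ^ k * ‖L w‖ * (‖x - c w‖ ^ k * ‖iteratedFDeriv ℝ n f (x - c w)‖ +
            ‖c w‖ ^ k * ‖iteratedFDeriv ℝ n f (x - c w)‖) := by ring
      _ ≤ 2 ^ k * ‖L w‖ * (|C₁| + ‖c w‖ ^ k * |C₂|) := by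
          gcongr
          · exact e1.trans (le_abs_self _)
          · exact e2.trans (le_abs_self _)
      _ ≤ 2 ^ k * ‖L w‖ * ((|C₁| + |C₂|) + ‖c w‖ ^ k * (|C₁| + |C₂|)) := by
          gcongr
          · linarith [abs_nonneg C₂]
          · linarith [abs_nonneg C₁]
      _ = _ := by ring
  have hbound (n : ℕ) (x : V) (_ : x ∈ (Set.univ : Set V)) : ∃ s ∈ 𝓝 x, ∃ bound : Ω → ℝ,
      Integrable bound μ ∧ ∀ᵐ w ∂μ, ∀ y ∈ s,
        ‖iteratedFDeriv ℝ n (fun x => L w (f (x - c w))) y‖ ≤ bound w := by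
    obtain ⟨C, hC⟩ := hle 0 n
    refine ⟨Set.univ, univ_mem, _, ((hint 0).add (hint 0)).const_mul C,
      Eventually.of_forall fun w y _ => ?_⟩
    simpa using hC w y
  have hF' : ∀ᵐ w ∂μ, ContDiffOn ℝ ∞ (fun x => L w (f (x - c w))) Set.univ :=
    Eventually.of_forall fun w => (hF w).contDiffOn
  have hT := hasFTaylorSeriesUpToOn_integral isOpen_univ hF' hmeas hbound
  obtain ⟨hc1, hc2, hc3, hc4⟩ := contDiffOn_integral isOpen_univ hF' hmeas hbound
  have hfd (w : Ω) (x : V) : fderiv ℝ (fun x => L w (f (x - c w))) x =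
      (L w).comp (fderiv ℝ f (x - c w)) := by
    have h1 : HasFDerivAt (fun x => f (x - c w)) (fderiv ℝ f (x - c w)) x := by
      have := (f.differentiableAt (x := x - c w)).hasFDerivAt.comp x
        ((hasFDerivAt_id x).sub_const (c w))
      rw [ContinuousLinearMap.comp_id] at this
      exact this
    exact (hasFDerivAt_clm_comp (L w) h1).fderiv
  simp only [hfd] at hc3 hc4
  refine ⟨⟨fun x => ∫ w, L w (f (x - c w)) ∂μ, contDiffOn_univ.1 hc1, fun k n => ?_⟩,
    fun x => ⟨rfl, hc2 x trivial, hc3 x trivial, hc4 x trivial⟩⟩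
  obtain ⟨C, hC⟩ := hle k n
  refine ⟨∫ w, C * (‖L w‖ * ‖c w‖ ^ 0 + ‖L w‖ * ‖c w‖ ^ k) ∂μ, fun x => ?_⟩
  have h1 := (hasFTaylorSeriesUpToOn_univ_iff.1 hT).eq_iteratedFDeriv
    (m := n) (by exact_mod_cast le_top) x
  rw [← h1]
  calc _ = ‖∫ w, ‖x‖ ^ k • iteratedFDeriv ℝ n (fun x => L w (f (x - c w))) x ∂μ‖ := by
        rw [integral_smul, norm_smul, norm_pow, norm_norm]
    _ ≤ _ := by
      refine norm_integral_le_of_norm_le (((hint 0).add (hint k)).const_mul C)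
        (Eventually.of_forall fun w => ?_)
      rw [norm_smul, norm_pow, norm_norm]
      exact hC w x

end SchwartzForms

/-! ### Mollifiers and superpositions of translates -/

section Mollifier

open MeasureTheory Filter

open scoped SchwartzMap

variable {V : Type*} [NormedAddCommGroup V] [InnerProductSpace ℝ V]

/-- A radial smooth function equal to `1` on the unit ball and vanishing for `‖x‖ ≥ 2`. -/
def radialBump (x : V) : ℝ := Real.smoothTransition (2 - ‖x‖ ^ 2)

theorem contDiff_radialBump : ContDiff ℝ ∞ (radialBump : V → ℝ) :=
  Real.smoothTransition.contDiff.comp (contDiff_const.sub (contDiff_norm_sq ℝ))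

theorem radialBump_eq_one {x : V} (hx : ‖x‖ ≤ 1) : radialBump x = 1 :=
  Real.smoothTransition.one_of_one_le (by nlinarith [norm_nonneg x])

theorem radialBump_eq_zero {x : V} (hx : 2 ≤ ‖x‖) : radialBump x = 0 :=
  Real.smoothTransition.zero_of_nonpos (by nlinarith)

theorem radialBump_nonneg (x : V) : 0 ≤ radialBump x := Real.smoothTransition.nonneg _

variable [FiniteDimensional ℝ V]

theorem hasCompactSupport_radialBump : HasCompactSupport (radialBump : V → ℝ) :=
  HasCompactSupport.intro (isCompact_closedBall 0 2) fun x hx =>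
    radialBump_eq_zero (by simpa using (not_le.1 (by simpa using hx)).le)

variable [MeasurableSpace V] [BorelSpace V]

theorem integral_radialBump_pos : 0 < ∫ x : V, radialBump x := by
  refine contDiff_radialBump.continuous.integral_pos_of_hasCompactSupport_nonneg_nonzero
    hasCompactSupport_radialBump radialBump_nonneg (x := 0) ?_
  rw [radialBump_eq_one (by simp)]
  exact one_ne_zero

/-- A radial smooth function of integral `1` vanishing for `‖x‖ ≥ 2`. -/
def mollifier (x : V) : ℝ := (∫ y : V, radialBump y)⁻¹ * radialBump x

theorem contDiff_mollifier : ContDiff ℝ ∞ (mollifier : V → ℝ) :=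
  contDiff_const.mul contDiff_radialBump

theorem continuous_mollifier : Continuous (mollifier : V → ℝ) := contDiff_mollifier.continuous

theorem hasCompactSupport_mollifier : HasCompactSupport (mollifier : V → ℝ) :=
  hasCompactSupport_radialBump.mul_left (f := fun _ => (∫ y : V, radialBump y)⁻¹)

theorem mollifier_eq_zero {x : V} (hx : 2 ≤ ‖x‖) : mollifier x = 0 := by
  simp [mollifier, radialBump_eq_zero hx]

theorem integral_mollifier : ∫ x : V, mollifier x = 1 := by
  simp only [mollifier]
  rw [integral_const_mul, inv_mul_cancel₀ integral_radialBump_pos.ne']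

theorem mollifier_isometry (g : V ≃ₗᵢ[ℝ] V) (x : V) : mollifier (g x) = mollifier x := by
  simp [mollifier, radialBump]

/-- A first order linear differential operator `M` applied under the integral sign. The exterior
derivative is the case of interest. -/
theorem clm_fderiv_eq_integral {Ω : Type*} [MeasurableSpace Ω] {μ : Measure Ω} {G H : Type*}
    [NormedAddCommGroup G] [NormedSpace ℝ G] [CompleteSpace G] [NormedAddCommGroup H]
    [NormedSpace ℝ H] [CompleteSpace H] (M : (V →L[ℝ] G) →L[ℝ] H)
    {s : V → G} {Φ : Ω → V →L[ℝ] G} {x : V}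
    (hs : HasFDerivAt s (∫ w, Φ w ∂μ) x) (hΦ : Integrable Φ μ) :
    M (fderiv ℝ s x) = ∫ w, M (Φ w) ∂μ ∧ Integrable (fun w => M (Φ w)) μ := by
  rw [hs.fderiv]
  exact ⟨(M.integral_comp_comm hΦ).symm, M.integrable_comp hΦ⟩

/-- The integral of a total derivative vanishes. -/
theorem integral_clm_fderiv_eq_zero {G H : Type*} [NormedAddCommGroup G] [NormedSpace ℝ G]
    [CompleteSpace G] [NormedAddCommGroup H] [NormedSpace ℝ H] [CompleteSpace H]
    (M : (V →L[ℝ] G) →L[ℝ] H)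
    {f : V → G} (hf : ContDiff ℝ 1 f) (hc : Integrable f) (hc' : Integrable (fderiv ℝ f)) :
    ∫ x, M (fderiv ℝ f x) = 0 := by
  have h0 : ∫ x, fderiv ℝ f x = 0 := by
    ext v
    rw [ContinuousLinearMap.integral_apply hc']
    have h := integral_smul_fderiv_eq_neg_fderiv_smul_of_integrable (μ := (volume : Measure V))
      (𝕜 := ℝ) (f := fun _ => (1 : ℝ)) (g := f) (v := v) (by simp)
      (by simpa using hc'.apply_continuousLinearMap v) (by simpa using hc)
      (fun x _ => differentiableAt_const _) (fun x _ => hf.differentiable (by simp) x)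
    simpa using h
  rw [M.integral_comp_comm hc', h0, map_zero]

/-- Integration by parts against the Euler vector field, whose divergence is `d`. -/
theorem integral_fderiv_self {d : ℕ} (e : OrthonormalBasis (Fin d) ℝ V) {G : Type*}
    [NormedAddCommGroup G] [NormedSpace ℝ G] [CompleteSpace G]
    {f : V → G} (hf : ContDiff ℝ 1 f) (hc : HasCompactSupport f) :
    ∫ x, fderiv ℝ f x x = -(d : ℝ) • ∫ x, f x := by
  have hi : Integrable f := hf.continuous.integrable_of_hasCompactSupport hc
  have hi' (k : Fin d) : Integrable (fun x => ⟪e k, x⟫ • fderiv ℝ f x (e k)) := by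
    refine Continuous.integrable_of_hasCompactSupport ?_ ?_
    · have := hf.continuous_fderiv (by simp)
      fun_prop
    · exact ((hc.fderiv_apply (𝕜 := ℝ) (e k))).smul_left (f := fun x => ⟪e k, x⟫)
  have h1 (x : V) : fderiv ℝ f x x = ∑ k, ⟪e k, x⟫ • fderiv ℝ f x (e k) := by
    conv_lhs => rw [← e.sum_repr' x]
    simp only [map_sum, map_smul]
    simp [e.sum_repr']
  simp only [h1]
  rw [integral_finsetSum _ fun k _ => hi' k]
  have h2 (k : Fin d) : ∫ x, ⟪e k, x⟫ • fderiv ℝ f x (e k) = - ∫ x, f x := by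
    have hd (x : V) : HasFDerivAt (fun x => ⟪e k, x⟫) (innerSL ℝ (e k)) x :=
      (innerSL ℝ (e k)).hasFDerivAt
    have h := integral_smul_fderiv_eq_neg_fderiv_smul_of_integrable (μ := (volume : Measure V))
      (𝕜 := ℝ) (f := fun x => ⟪e k, x⟫) (g := f) (v := e k)
      (by simpa [(hd _).fderiv] using hi)
      (hi' k) ?_ (fun x _ => (hd x).differentiableAt)
      (fun x _ => hf.differentiable (by simp) x)
    · rw [h]
      simp [(hd _).fderiv]
    · exact (((innerSL ℝ (e k)).continuous.smul hf.continuous)).integrable_of_hasCompactSupport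
        hc.smul_left
  simp [h2, ← Nat.cast_smul_eq_nsmul ℝ]

/-- The integral, with values in the constant forms, of an exact rapidly decreasing form vanishes.
-/
theorem integral_extDeriv_eq_zero {p : ℕ} (s : 𝓢(V, V [⋀^Fin p]→L[ℝ] ℝ)) :
    ∫ x, extDeriv s x = 0 :=
  integral_clm_fderiv_eq_zero (G := V [⋀^Fin p]→L[ℝ] ℝ) (H := V [⋀^Fin (p + 1)]→L[ℝ] ℝ)
    (ContinuousAlternatingMap.alternatizeUncurryFinCLM ℝ V ℝ (n := p))
    (s.smooth 1) s.integrable (SchwartzMap.fderivCLM ℝ V (V [⋀^Fin p]→L[ℝ] ℝ) s).integrable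

theorem integrable_comp_snd_unitInterval {f : V → ℝ} (hf : Integrable f) :
    Integrable (fun w : ℝ × V => f w.2) ((volume.restrict (Set.Ioc (0 : ℝ) 1)).prod volume) :=
  hf.comp_snd _

theorem ae_mem_unitInterval : ∀ᵐ w : ℝ × V ∂((volume.restrict (Set.Ioc (0 : ℝ) 1)).prod volume),
    w.1 ∈ Set.Ioc (0 : ℝ) 1 :=
  Measure.quasiMeasurePreserving_fst.ae (ae_restrict_mem measurableSet_Ioc)

/-- The superposition `∫∫ φ(y) B(f(x - t y), y) dt dy` over `0 ≤ t ≤ 1`, for the mollifier `φ`, is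
a Schwartz function of `x`, and may be differentiated under the integral sign. -/
theorem exists_translation_superposition {E₁ G : Type*} [NormedAddCommGroup E₁]
    [NormedSpace ℝ E₁] [NormedAddCommGroup G] [NormedSpace ℝ G] [CompleteSpace G]
    (B : E₁ →L[ℝ] V →L[ℝ] G) (f : 𝓢(V, E₁)) :
    ∃ s : 𝓢(V, G), ∀ x,
      s x = ∫ w : ℝ × V, mollifier w.2 • B (f (x - w.1 • w.2)) w.2
        ∂((volume.restrict (Set.Ioc 0 1)).prod volume) ∧
      Integrable (fun w : ℝ × V => mollifier w.2 • B (f (x - w.1 • w.2)) w.2)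
        ((volume.restrict (Set.Ioc 0 1)).prod volume) ∧
      Integrable (fun w : ℝ × V =>
        mollifier w.2 • (B.flip w.2).comp (fderiv ℝ f (x - w.1 • w.2)))
        ((volume.restrict (Set.Ioc 0 1)).prod volume) ∧
      HasFDerivAt s (∫ w : ℝ × V,
        mollifier w.2 • (B.flip w.2).comp (fderiv ℝ f (x - w.1 • w.2))
        ∂((volume.restrict (Set.Ioc 0 1)).prod volume)) x := by
  let L : ℝ × V → E₁ →L[ℝ] G := fun w => mollifier w.2 • B.flip w.2
  have hLc : Continuous L :=
    (continuous_mollifier.comp continuous_snd).smul (B.flip.continuous.comp continuous_snd)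
  have hint (k : ℕ) : Integrable (fun w : ℝ × V => ‖L w‖ * ‖w.1 • w.2‖ ^ k)
      ((volume.restrict (Set.Ioc 0 1)).prod volume) := by
    have h1 : Integrable (fun y : V => ‖mollifier y • B.flip y‖ * ‖y‖ ^ k) := by
      refine Continuous.integrable_of_hasCompactSupport ?_ ?_
      · exact (continuous_mollifier.smul B.flip.continuous).norm.mul (continuous_norm.pow k)
      · exact (hasCompactSupport_mollifier.smul_right (f' := fun y => B.flip y)).norm.mul_right
    refine (integrable_comp_snd_unitInterval h1).mono'
      (hLc.norm.mul ((continuous_fst.smul continuous_snd).norm.pow k)).aestronglyMeasurable ?_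
    filter_upwards [ae_mem_unitInterval] with w hw
    rw [norm_mul, norm_norm, norm_pow, norm_norm, norm_smul w.1, Real.norm_of_nonneg hw.1.le]
    gcongr
    · exact mul_nonneg hw.1.le (norm_nonneg w.2)
    · exact mul_le_of_le_one_left (norm_nonneg w.2) hw.2
  exact exists_schwartz_superposition f (L := L) (c := fun w : ℝ × V => w.1 • w.2)
    hLc (by fun_prop) hint

/-- The superposition `∫∫ φ(x - r u) r ^ m B(f(u), u) dr du` over `0 ≤ r ≤ 1`, for the mollifier
`φ`, is a Schwartz function of `x`, and may be differentiated under the integral sign. -/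
theorem exists_dilation_superposition {E₁ G : Type*} [NormedAddCommGroup E₁]
    [NormedSpace ℝ E₁] [NormedAddCommGroup G] [NormedSpace ℝ G] [CompleteSpace G]
    (B : E₁ →L[ℝ] V →L[ℝ] G) (f : 𝓢(V, E₁)) (m : ℕ) :
    ∃ s : 𝓢(V, G), ∀ x,
      s x = ∫ w : ℝ × V, mollifier (x - w.1 • w.2) • w.1 ^ m • B (f w.2) w.2
        ∂((volume.restrict (Set.Ioc 0 1)).prod volume) ∧
      Integrable (fun w : ℝ × V => mollifier (x - w.1 • w.2) • w.1 ^ m • B (f w.2) w.2)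
        ((volume.restrict (Set.Ioc 0 1)).prod volume) ∧
      Integrable (fun w : ℝ × V =>
        (fderiv ℝ mollifier (x - w.1 • w.2)).smulRight (w.1 ^ m • B (f w.2) w.2))
        ((volume.restrict (Set.Ioc 0 1)).prod volume) ∧
      HasFDerivAt s (∫ w : ℝ × V,
        (fderiv ℝ mollifier (x - w.1 • w.2)).smulRight (w.1 ^ m • B (f w.2) w.2)
        ∂((volume.restrict (Set.Ioc 0 1)).prod volume)) x := by
  -- Here it is the mollifier that is translated, and `f` enters through the operator coefficients.
  let L : ℝ × V → ℝ →L[ℝ] G := fun w => ContinuousLinearMap.toSpanSingleton ℝ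
    (w.1 ^ m • B (f w.2) w.2)
  have hBc : Continuous fun u => B (f u) u :=
    (B.continuous.comp f.continuous).clm_apply continuous_id
  have hcc : Continuous fun w : ℝ × V => w.1 ^ m • B (f w.2) w.2 :=
    (continuous_fst.pow m).smul (hBc.comp continuous_snd)
  have hLc : Continuous L :=
    (ContinuousLinearMap.toSpanSingletonLIE ℝ G).continuous.comp hcc
  have hint (k : ℕ) : Integrable (fun w : ℝ × V => ‖L w‖ * ‖w.1 • w.2‖ ^ k)
      ((volume.restrict (Set.Ioc 0 1)).prod volume) := by
    have h1 : Integrable (fun y : V => ‖B‖ * (‖y‖ ^ (k + 1) * ‖f y‖)) :=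
      (f.integrable_pow_mul volume (k + 1)).const_mul _
    refine (integrable_comp_snd_unitInterval h1).mono'
      (hLc.norm.mul ((continuous_fst.smul continuous_snd).norm.pow k)).aestronglyMeasurable ?_
    filter_upwards [ae_mem_unitInterval] with w hw
    have h2 : ‖w.1 ^ m‖ ≤ 1 := by
      rw [norm_pow, Real.norm_of_nonneg hw.1.le]
      exact pow_le_one₀ hw.1.le hw.2
    rw [norm_mul, norm_norm, norm_pow, norm_norm, norm_smul, Real.norm_of_nonneg hw.1.le,
      ContinuousLinearMap.norm_toSpanSingleton, norm_smul]
    calc ‖w.1 ^ m‖ * ‖B (f w.2) w.2‖ * (w.1 * ‖w.2‖) ^ k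
        ≤ 1 * (‖B‖ * ‖f w.2‖ * ‖w.2‖) * (1 * ‖w.2‖) ^ k := by
          have := hw.1.le
          gcongr
          · exact B.le_opNorm₂ _ _
          · exact hw.2
      _ = _ := by ring
  obtain ⟨s, hs⟩ := exists_schwartz_superposition
    (hasCompactSupport_mollifier.toSchwartzMap contDiff_mollifier : 𝓢(V, ℝ)) (L := L)
    (c := fun w : ℝ × V => w.1 • w.2) hLc (by fun_prop) hint
  exact ⟨s, hs⟩

end Mollifier

/-! ### Homotopies by translations and dilations -/

section Homotopies

open MeasureTheory Filter

open scoped SchwartzMap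

variable {V : Type*} [NormedAddCommGroup V] [InnerProductSpace ℝ V]

/-- The derivation property of contraction, `ι_y (dx ∧ φ) + dx ∧ ι_y φ = φ_y`. -/
theorem alternatizeUncurryFin_flip_comp {p : ℕ} (φ : V →L[ℝ] V [⋀^Fin (p + 1)]→L[ℝ] ℝ) (y : V)
    (ψ : V →L[ℝ] V [⋀^Fin p]→L[ℝ] ℝ) (hψ : ∀ w, ψ w = (φ w).curryLeft y) :
    ContinuousAlternatingMap.alternatizeUncurryFin ψ =
      φ y - (ContinuousAlternatingMap.alternatizeUncurryFin φ).curryLeft y := by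
  ext v
  rw [ContinuousAlternatingMap.sub_apply, alternatizeUncurryFin_curryLeft_apply,
    ContinuousAlternatingMap.alternatizeUncurryFin_apply]
  simp [hψ]

/-- The alternation of `w ↦ ι_w f` is the degree of `f` times `f`. -/
theorem alternatizeUncurryFin_curryLeft_self {p : ℕ} (f : V [⋀^Fin (p + 1)]→L[ℝ] ℝ)
    (ψ : V →L[ℝ] V [⋀^Fin p]→L[ℝ] ℝ) (hψ : ∀ w, ψ w = f.curryLeft w) :
    ContinuousAlternatingMap.alternatizeUncurryFin ψ = ((p + 1 : ℕ) : ℝ) • f := by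
  ext v
  rw [ContinuousAlternatingMap.alternatizeUncurryFin_apply]
  have h (i : Fin (p + 1)) : (-1) ^ (i : ℕ) • f (Matrix.vecCons (v i) (i.removeNth v)) = f v := by
    have h1 := f.toAlternatingMap.map_insertNth i (v i) (i.removeNth v)
    rw [Fin.insertNth_self_removeNth] at h1
    exact h1.symm
  simp only [hψ, ContinuousAlternatingMap.curryLeft_apply_apply, h]
  simp

variable [FiniteDimensional ℝ V] [MeasurableSpace V] [BorelSpace V]

/-- A primitive of `a - φ * a` for a closed form `a`, where `φ * a` is the convolution with the
mollifier: the integrand of the exterior derivative of `∫∫ φ(y) ι_y a(x - t y)` is the derivative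
of `-φ(y) a(x - t y)` in `t`. -/
theorem exists_translationHomotopy {p : ℕ} (a : 𝓢(V, V [⋀^Fin (p + 1)]→L[ℝ] ℝ)) :
    ∃ s : 𝓢(V, V [⋀^Fin p]→L[ℝ] ℝ),
      (∀ x, s x = ∫ w : ℝ × V, mollifier w.2 • (a (x - w.1 • w.2)).curryLeft w.2
        ∂((volume.restrict (Set.Ioc 0 1)).prod volume)) ∧
      (∀ x, Integrable (fun w : ℝ × V => mollifier w.2 • (a (x - w.1 • w.2)).curryLeft w.2)
        ((volume.restrict (Set.Ioc 0 1)).prod volume)) ∧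
      ((∀ x, extDeriv a x = 0) → ∀ x, extDeriv s x = a x - ∫ y, mollifier y • a (x - y)) := by
  obtain ⟨s, hs⟩ := exists_translation_superposition (G := V [⋀^Fin p]→L[ℝ] ℝ)
    (E₁ := V [⋀^Fin (p + 1)]→L[ℝ] ℝ) (curryLeftCLM V p) a
  refine ⟨s, fun x => (hs x).1, fun x => (hs x).2.1, fun hd x => ?_⟩
  obtain ⟨h1, h2⟩ := clm_fderiv_eq_integral (G := V [⋀^Fin p]→L[ℝ] ℝ)
    (H := V [⋀^Fin (p + 1)]→L[ℝ] ℝ)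
    (ContinuousAlternatingMap.alternatizeUncurryFinCLM ℝ V ℝ (n := p)) (hs x).2.2.2 (hs x).2.2.1
  have hpt (w : ℝ × V) : (ContinuousAlternatingMap.alternatizeUncurryFinCLM ℝ V ℝ (n := p))
      (mollifier w.2 • ((curryLeftCLM V p).flip w.2).comp (fderiv ℝ a (x - w.1 • w.2))) =
      mollifier w.2 • fderiv ℝ a (x - w.1 • w.2) w.2 := by
    rw [map_smul]
    congr 1
    refine (alternatizeUncurryFin_flip_comp (fderiv ℝ a (x - w.1 • w.2)) w.2 _
      fun _ => rfl).trans ?_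
    have := hd (x - w.1 • w.2)
    rw [extDeriv] at this
    rw [this]
    simp
  simp only [hpt] at h1 h2
  -- The fundamental theorem of calculus in `t`, for fixed `y`.
  have hy (y : V) : ∫ t in Set.Ioc (0 : ℝ) 1, mollifier y • fderiv ℝ a (x - t • y) y =
      mollifier y • a x - mollifier y • a (x - y) := by
    rw [← intervalIntegral.integral_of_le zero_le_one]
    have hder (t : ℝ) : HasDerivAt (fun t : ℝ => -(mollifier y • a (x - t • y)))
        (mollifier y • fderiv ℝ a (x - t • y) y) t := by
      have e1 : HasDerivAt (fun t : ℝ => x - t • y) (-y) t := by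
        simpa using ((hasDerivAt_id t).smul_const y).const_sub x
      have e2 := (a.differentiableAt (x := x - t • y)).hasFDerivAt.comp_hasDerivAt t e1
      have e3 := (e2.const_smul (mollifier y)).neg
      refine e3.congr_deriv ?_
      rw [map_neg, smul_neg, neg_neg]
    rw [intervalIntegral.integral_eq_sub_of_hasDerivAt (fun t _ => hder t)]
    · simp only [zero_smul, one_smul, sub_zero, sub_neg_eq_add]
      exact neg_add_eq_sub _ _
    · refine Continuous.intervalIntegrable ?_ _ _
      have := (SchwartzMap.fderivCLM ℝ V (V [⋀^Fin (p + 1)]→L[ℝ] ℝ) a).continuous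
      have e1 : Continuous fun t : ℝ => fderiv ℝ a (x - t • y) :=
        this.comp (f := fun t : ℝ => x - t • y) (by fun_prop)
      have e2 : Continuous fun t : ℝ => fderiv ℝ a (x - t • y) y := e1.clm_apply continuous_const
      exact e2.const_smul (mollifier y)
  refine h1.trans ?_
  rw [integral_prod_symm _ h2]
  simp only [hy]
  have i1 : Integrable fun y : V => mollifier y • a x :=
    (continuous_mollifier.integrable_of_hasCompactSupport
      hasCompactSupport_mollifier).smul_const _
  have i2 : Integrable fun y : V => mollifier y • a (x - y) :=
    (continuous_mollifier.smul (a.continuous.comp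
      (continuous_const.sub continuous_id))).integrable_of_hasCompactSupport
      hasCompactSupport_mollifier.smul_right
  rw [integral_sub i1 i2, integral_smul_const, integral_mollifier, one_smul]

/-- Stated, like the next two lemmas, for abstract normed spaces, so that it can be used for
alternating maps by giving the types explicitly. -/
theorem continuous_clm_smulRight {Ω G H : Type*} [TopologicalSpace Ω] [NormedAddCommGroup G]
    [NormedSpace ℝ G] [NormedAddCommGroup H] [NormedSpace ℝ H] (M : (V →L[ℝ] G) →L[ℝ] H)
    {φ : Ω → V →L[ℝ] ℝ} {g : Ω → G} (hφ : Continuous φ) (hg : Continuous g) :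
    Continuous fun u => M ((φ u).smulRight (g u)) := by
  have h := (ContinuousLinearMap.smulRightL ℝ V G).continuous.comp hφ
  exact M.continuous.comp (h.clm_apply hg)

theorem integrable_fun_add {Ω G : Type*} [MeasurableSpace Ω] {μ : Measure Ω}
    [NormedAddCommGroup G] {f g : Ω → G} (hf : Integrable f μ) (hg : Integrable g μ) :
    Integrable (fun u => f u + g u) μ :=
  hf.add hg

theorem integrable_fun_smul {Ω G : Type*} [MeasurableSpace Ω] {μ : Measure Ω}
    [NormedAddCommGroup G] [NormedSpace ℝ G] {f : Ω → G} (c : ℝ) (hf : Integrable f μ) :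
    Integrable (fun u => c • f u) μ :=
  hf.smul c

theorem hasCompactSupport_comp_sub_smul {G : Type*} [Zero G] {f : V → G}
    (hf : HasCompactSupport f) (x : V) {r : ℝ} (hr : r ≠ 0) :
    HasCompactSupport fun u => f (x - r • u) :=
  hf.comp_homeomorph ((Homeomorph.smulOfNeZero r hr).trans (Homeomorph.subLeft x))

theorem contDiff_curryLeft_self {p : ℕ} {a : V → V [⋀^Fin (p + 1)]→L[ℝ] ℝ}
    (ha : ContDiff ℝ ∞ a) : ContDiff ℝ ∞ fun u => (a u).curryLeft u :=
  (contDiff_clm_comp (F := V [⋀^Fin (p + 1)]→L[ℝ] ℝ) (G := V →L[ℝ] V [⋀^Fin p]→L[ℝ] ℝ)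
    (curryLeftCLM V p) ha).clm_apply contDiff_id

/-- The formula `L_E ω = d ι_E ω + ι_E dω` for the Euler vector field `E`. -/
theorem extDeriv_curryLeft_self {p : ℕ} {a : V → V [⋀^Fin (p + 1)]→L[ℝ] ℝ} {u : V}
    (ha : DifferentiableAt ℝ a u) :
    extDeriv (fun u => (a u).curryLeft u) u =
      fderiv ℝ a u u - (extDeriv a u).curryLeft u + ((p + 1 : ℕ) : ℝ) • a u := by
  obtain ⟨F, hF, hF'⟩ := hasFDerivAt_curryLeft_comp (A := ContinuousLinearMap.id ℝ V)
    (A' := ContinuousLinearMap.id ℝ V) (b := 0) (b' := 0) (x := u) (a := a) (by simpa using ha)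
  have h1 : HasFDerivAt (fun u => (a u).curryLeft u) F u := by
    convert hF using 2
    ext v
    simp
  have h2 (w : V) : F w = (fderiv ℝ a u w).curryLeft u + (a u).curryLeft w := by
    rw [hF']
    ext v
    simp
  let F₁ : V →L[ℝ] V [⋀^Fin p]→L[ℝ] ℝ := ((curryLeftCLM V p).flip u).comp (fderiv ℝ a u)
  let F₂ : V →L[ℝ] V [⋀^Fin p]→L[ℝ] ℝ := curryLeftCLM V p (a u)
  have h3 : F = F₁ + F₂ := by
    ext1 w
    exact h2 w
  rw [extDeriv, h1.fderiv, h3, ContinuousAlternatingMap.alternatizeUncurryFin_add,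
    alternatizeUncurryFin_flip_comp (fderiv ℝ a u) u F₁ fun _ => rfl,
    alternatizeUncurryFin_curryLeft_self (a u) F₂ fun _ => rfl, extDeriv]

/-- Integrating `ι_E d(f a) + d ι_E (f a) = L_E (f a)`, where `E` is the Euler vector field and
`f(u) = θ(x - r u)`, for a closed form `a`. -/
theorem integral_dilation_eq {d p m : ℕ} (e : OrthonormalBasis (Fin d) ℝ V) (hm : d = m + (p + 1))
    (a : 𝓢(V, V [⋀^Fin (p + 1)]→L[ℝ] ℝ)) (hd : ∀ x, extDeriv a x = 0) (x : V) {r : ℝ}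
    (hr : r ≠ 0) :
    r • ∫ u, ContinuousAlternatingMap.alternatizeUncurryFin
      ((fderiv ℝ mollifier (x - r • u)).smulRight ((a u).curryLeft u)) =
    ∫ u, (r * fderiv ℝ mollifier (x - r • u) u - m * mollifier (x - r • u)) • a u := by
  let f : V → ℝ := fun u => mollifier (x - r • u)
  have hfc : ContDiff ℝ ∞ f :=
    contDiff_mollifier.comp (contDiff_const.sub (contDiff_id.const_smul r))
  have hfs : HasCompactSupport f := hasCompactSupport_comp_sub_smul hasCompactSupport_mollifier x hr
  have hf' (u : V) : HasFDerivAt f (-r • fderiv ℝ mollifier (x - r • u)) u := by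
    have h1 : HasFDerivAt (fun u : V => x - r • u) (-(r • ContinuousLinearMap.id ℝ V)) u :=
      ((hasFDerivAt_id u).const_smul r).const_sub x
    have h2 := ((contDiff_mollifier (V := V)).differentiable (by simp)
      (x - r • u)).hasFDerivAt.comp u h1
    refine h2.congr_fderiv ?_
    ext w
    simp
  have hac : ContDiff ℝ ∞ a := a.smooth ⊤
  have hw : ContDiff ℝ ∞ fun u => f u • a u := hfc.smul hac
  have hws : HasCompactSupport fun u => f u • a u := hfs.smul_right
  have hw' (u : V) : HasFDerivAt (fun u => f u • a u)
      (f u • fderiv ℝ a u + (-r • fderiv ℝ mollifier (x - r • u)).smulRight (a u)) u :=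
    (hf' u).smul a.differentiableAt.hasFDerivAt
  have hext (u : V) : extDeriv (fun u => f u • a u) u = -r •
      ContinuousAlternatingMap.alternatizeUncurryFin
        ((fderiv ℝ mollifier (x - r • u)).smulRight (a u)) := by
    have h0 := hd u
    rw [extDeriv] at h0
    have h1 : (-r • fderiv ℝ mollifier (x - r • u)).smulRight (a u) =
      -r • (fderiv ℝ mollifier (x - r • u)).smulRight (a u) := by
      ext w v
      simp
      ring
    rw [extDeriv, (hw' u).fderiv, h1, ContinuousAlternatingMap.alternatizeUncurryFin_add,
      ContinuousAlternatingMap.alternatizeUncurryFin_smul,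
      ContinuousAlternatingMap.alternatizeUncurryFin_smul, h0, smul_zero, zero_add]
  have hbs : HasCompactSupport fun u => (f u • a u).curryLeft u :=
    hws.mono fun u hu => by
      contrapose! hu
      simp only [Function.mem_support, not_not] at hu ⊢
      simp [hu]
  have h0 := integral_extDeriv_eq_zero
    (hbs.toSchwartzMap (contDiff_curryLeft_self hw) : 𝓢(V, V [⋀^Fin p]→L[ℝ] ℝ))
  -- `L_E = d ι_E + ι_E d` for `f a`, with `d(f a) = df ∧ a` and `ι_E (df ∧ a) = (E f) a - df ∧ ι_E
  -- a`.
  have h1 (u : V) : extDeriv (fun u => (f u • a u).curryLeft u) u =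
      fderiv ℝ (fun u => f u • a u) u u + ((r * fderiv ℝ mollifier (x - r • u) u) • a u +
      (((p + 1 : ℕ) : ℝ) * f u) • a u -
      r • ContinuousAlternatingMap.alternatizeUncurryFin
        ((fderiv ℝ mollifier (x - r • u)).smulRight ((a u).curryLeft u))) := by
    have e1 := alternatizeUncurryFin_flip_comp
      ((fderiv ℝ mollifier (x - r • u)).smulRight (a u)) u
      ((fderiv ℝ mollifier (x - r • u)).smulRight ((a u).curryLeft u)) (fun w => by ext v; simp)
    have e2 : (-r • ContinuousAlternatingMap.alternatizeUncurryFin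
        ((fderiv ℝ mollifier (x - r • u)).smulRight (a u))).curryLeft u =
        -r • (ContinuousAlternatingMap.alternatizeUncurryFin
        ((fderiv ℝ mollifier (x - r • u)).smulRight (a u))).curryLeft u := rfl
    rw [extDeriv_curryLeft_self (hw' u).differentiableAt, hext, e2, e1,
      ContinuousLinearMap.smulRight_apply]
    module
  have hφc : Continuous fun u : V => fderiv ℝ (mollifier : V → ℝ) (x - r • u) :=
    (contDiff_mollifier.continuous_fderiv (by simp)).comp (f := fun u : V => x - r • u)
      (by fun_prop)
  have hφs : HasCompactSupport fun u : V => fderiv ℝ (mollifier : V → ℝ) (x - r • u) :=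
    hasCompactSupport_comp_sub_smul (hasCompactSupport_mollifier.fderiv (𝕜 := ℝ)) x hr
  have i1 : Integrable fun u => fderiv ℝ (fun u => f u • a u) u u := by
    refine Continuous.integrable_of_hasCompactSupport
      ((hw.continuous_fderiv (by simp)).clm_apply continuous_id) ?_
    refine (hws.fderiv (𝕜 := ℝ)).mono fun u hu => ?_
    contrapose! hu
    simp only [Function.mem_support, not_not] at hu ⊢
    rw [hu]
    rfl
  have i2 : Integrable fun u => (r * fderiv ℝ mollifier (x - r • u) u) • a u := by
    refine Continuous.integrable_of_hasCompactSupport ((continuous_const.mul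
      (hφc.clm_apply continuous_id)).smul hac.continuous) (hφs.mono fun u hu => ?_)
    contrapose! hu
    simp only [Function.mem_support, not_not] at hu ⊢
    simp [hu]
  have i3 (c : ℝ) : Integrable fun u => (c * f u) • a u :=
    ((continuous_const.mul hfc.continuous).smul
      hac.continuous).integrable_of_hasCompactSupport hfs.mul_left.smul_right
  have i4 : Integrable fun u => ContinuousAlternatingMap.alternatizeUncurryFin
      ((fderiv ℝ mollifier (x - r • u)).smulRight ((a u).curryLeft u)) := by
    refine Continuous.integrable_of_hasCompactSupport ?_ (hφs.mono fun u hu => ?_)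
    · exact continuous_clm_smulRight (G := V [⋀^Fin p]→L[ℝ] ℝ) (H := V [⋀^Fin (p + 1)]→L[ℝ] ℝ)
        (ContinuousAlternatingMap.alternatizeUncurryFinCLM ℝ V ℝ (n := p)) hφc
        (contDiff_curryLeft_self hac).continuous
    · contrapose! hu
      simp only [Function.mem_support, not_not] at hu ⊢
      rw [hu, ContinuousLinearMap.zero_smulRight]
      exact map_zero (ContinuousAlternatingMap.alternatizeUncurryFinCLM ℝ V ℝ (n := p))
  have h2 := (integral_congr_ae (Eventually.of_forall h1)).symm.trans h0
  have i5 : Integrable fun u => r • ContinuousAlternatingMap.alternatizeUncurryFin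
      ((fderiv ℝ mollifier (x - r • u)).smulRight ((a u).curryLeft u)) := i4.smul r
  have i6 : Integrable fun u => (r * fderiv ℝ mollifier (x - r • u) u) • a u +
      (((p + 1 : ℕ) : ℝ) * f u) • a u := by
    exact integrable_fun_add (G := V [⋀^Fin (p + 1)]→L[ℝ] ℝ) i2 (i3 _)
  have i7 : Integrable fun u => (r * fderiv ℝ mollifier (x - r • u) u) • a u +
      (((p + 1 : ℕ) : ℝ) * f u) • a u - r • ContinuousAlternatingMap.alternatizeUncurryFin
      ((fderiv ℝ mollifier (x - r • u)).smulRight ((a u).curryLeft u)) := i6.sub i5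
  have h3 := integral_fderiv_self e (hw.of_le (by exact_mod_cast le_top)) hws
  have h4 : ∫ u, (((p + 1 : ℕ) : ℝ) * f u) • a u = ((p + 1 : ℕ) : ℝ) • ∫ u, f u • a u := by
    rw [← integral_smul]
    simp only [smul_smul]
  have h5 : ∫ u, ((m : ℝ) * f u) • a u = (m : ℝ) • ∫ u, f u • a u := by
    rw [← integral_smul]
    simp only [smul_smul]
  -- The divergence of `E` contributes `-d` and the degree of `a` contributes `p + 1`; they add up
  -- to `-m`.
  rw [integral_add i1 i7, h3, integral_sub i6 i5,
    integral_add i2 (i3 _), integral_smul, h4] at h2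
  have h6 (u : V) : (r * fderiv ℝ mollifier (x - r • u) u - m * mollifier (x - r • u)) • a u =
      (r * fderiv ℝ mollifier (x - r • u) u) • a u - ((m : ℝ) * f u) • a u := by
    ext v
    simp only [ContinuousAlternatingMap.smul_apply, ContinuousAlternatingMap.sub_apply,
      smul_eq_mul, f]
    ring
  simp only [h6]
  rw [integral_sub i2 (i3 _), h5, ← sub_eq_zero, ← neg_eq_zero, ← h2, hm]
  push_cast
  module

/-- For a closed form `a` of degree `p + 1 = d - m`, a primitive of `0 ^ m φ(x) ∫ a - φ * a`, the
difference of the values at `r = 0` and `r = 1` of `r ^ m ∫ φ(x - r u) a(u) du`. -/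
theorem exists_dilationHomotopy {d p : ℕ} (e : OrthonormalBasis (Fin d) ℝ V) (m : ℕ)
    (a : 𝓢(V, V [⋀^Fin (p + 1)]→L[ℝ] ℝ)) :
    ∃ s : 𝓢(V, V [⋀^Fin p]→L[ℝ] ℝ),
      (∀ x, s x = ∫ w : ℝ × V, mollifier (x - w.1 • w.2) • w.1 ^ m • (a w.2).curryLeft w.2
        ∂((volume.restrict (Set.Ioc 0 1)).prod volume)) ∧
      (∀ x, Integrable
        (fun w : ℝ × V => mollifier (x - w.1 • w.2) • w.1 ^ m • (a w.2).curryLeft w.2)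
        ((volume.restrict (Set.Ioc 0 1)).prod volume)) ∧
      (d = m + (p + 1) → (∀ x, extDeriv a x = 0) → ∀ x, extDeriv s x =
        (0 : ℝ) ^ m • mollifier x • (∫ u, a u) - ∫ u, mollifier (x - u) • a u) := by
  obtain ⟨s, hs⟩ := exists_dilation_superposition (G := V [⋀^Fin p]→L[ℝ] ℝ)
    (E₁ := V [⋀^Fin (p + 1)]→L[ℝ] ℝ) (curryLeftCLM V p) a m
  refine ⟨s, fun x => (hs x).1, fun x => (hs x).2.1, fun hm hd x => ?_⟩
  obtain ⟨h1, h2⟩ := clm_fderiv_eq_integral (G := V [⋀^Fin p]→L[ℝ] ℝ)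
    (H := V [⋀^Fin (p + 1)]→L[ℝ] ℝ)
    (ContinuousAlternatingMap.alternatizeUncurryFinCLM ℝ V ℝ (n := p)) (hs x).2.2.2 (hs x).2.2.1
  have hpt (w : ℝ × V) : (ContinuousAlternatingMap.alternatizeUncurryFinCLM ℝ V ℝ (n := p))
      ((fderiv ℝ mollifier (x - w.1 • w.2)).smulRight (w.1 ^ m • curryLeftCLM V p (a w.2) w.2)) =
      w.1 ^ m • ContinuousAlternatingMap.alternatizeUncurryFin
        ((fderiv ℝ mollifier (x - w.1 • w.2)).smulRight ((a w.2).curryLeft w.2)) := by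
    rw [← ContinuousAlternatingMap.alternatizeUncurryFin_smul]
    refine congrArg ContinuousAlternatingMap.alternatizeUncurryFin ?_
    ext v z
    simp
    ring
  simp only [hpt] at h1 h2
  -- The derivative of `r ^ m φ(x - r u) a(u)` in `r`.
  let F : ℝ → V → V [⋀^Fin (p + 1)]→L[ℝ] ℝ := fun r u =>
    (m * r ^ (m - 1) * mollifier (x - r • u) - r ^ m * fderiv ℝ mollifier (x - r • u) u) • a u
  have hφ : Continuous (fderiv ℝ (mollifier : V → ℝ)) :=
    contDiff_mollifier.continuous_fderiv (by simp)
  have hFc : Continuous fun w : ℝ × V => F w.1 w.2 := by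
    have e1 : Continuous fun w : ℝ × V => x - w.1 • w.2 := by fun_prop
    exact (((continuous_const.mul (continuous_fst.pow _)).mul
      (continuous_mollifier.comp e1)).sub ((continuous_fst.pow _).mul
      ((hφ.comp e1).clm_apply continuous_snd))).smul (a.continuous.comp continuous_snd)
  have hFi : Integrable (fun w : ℝ × V => F w.1 w.2)
      ((volume.restrict (Set.Ioc 0 1)).prod volume) := by
    obtain ⟨C₀, hC₀⟩ := continuous_mollifier.bounded_above_of_compact_support
      (hasCompactSupport_mollifier (V := V))
    obtain ⟨C₁, hC₁⟩ := hφ.bounded_above_of_compact_support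
      ((hasCompactSupport_mollifier (V := V)).fderiv (𝕜 := ℝ))
    have b : Integrable fun u : V => m * C₀ * (‖u‖ ^ 0 * ‖a u‖) + C₁ * (‖u‖ ^ 1 * ‖a u‖) :=
      ((a.integrable_pow_mul volume 0).const_mul _).add
        ((a.integrable_pow_mul volume 1).const_mul _)
    refine (integrable_comp_snd_unitInterval b).mono' hFc.aestronglyMeasurable ?_
    filter_upwards [ae_mem_unitInterval] with w hw
    have hp (k : ℕ) : ‖w.1 ^ k‖ ≤ 1 := by
      rw [norm_pow, Real.norm_of_nonneg hw.1.le]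
      exact pow_le_one₀ hw.1.le hw.2
    have hC : 0 ≤ C₀ := (norm_nonneg _).trans (hC₀ 0)
    calc ‖F w.1 w.2‖ ≤ (m * 1 * C₀ + 1 * (C₁ * ‖w.2‖)) * ‖a w.2‖ := by
          rw [norm_smul]
          gcongr
          refine (norm_sub_le _ _).trans ?_
          rw [norm_mul, norm_mul, norm_mul, Real.norm_natCast]
          gcongr
          · exact hp _
          · exact hC₀ _
          · exact hp _
          · exact (ContinuousLinearMap.le_opNorm _ _).trans (by gcongr; exact hC₁ _)
      _ = _ := by ring
  have hr (r : ℝ) (hr : r ∈ Set.Ioc (0 : ℝ) 1) :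
      ∫ u, r ^ m • ContinuousAlternatingMap.alternatizeUncurryFin
        ((fderiv ℝ mollifier (x - r • u)).smulRight ((a u).curryLeft u)) = -∫ u, F r u := by
    have h3 := integral_dilation_eq e hm a hd x hr.1.ne'
    have h4 : -∫ u, F r u = (r ^ m * r⁻¹) •
        ∫ u, (r * fderiv ℝ mollifier (x - r • u) u - m * mollifier (x - r • u)) • a u := by
      rw [← integral_smul, ← integral_neg]
      refine integral_congr_ae (Eventually.of_forall fun u => ?_)
      change -(_ • a u) = (r ^ m * r⁻¹) • (_ • a u)
      rw [smul_smul]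
      refine (neg_smul _ _).symm.trans ?_
      congr 1
      have := hr.1.ne'
      rcases m with - | m
      · field_simp
        simp
      · rw [Nat.add_sub_cancel]
        field_simp
        ring
    rw [h4, ← h3, smul_smul, mul_assoc, inv_mul_cancel₀ hr.1.ne', mul_one, integral_smul]
  have hu (u : V) : ∫ r in Set.Ioc (0 : ℝ) 1, F r u =
      mollifier (x - u) • a u - ((0 : ℝ) ^ m * mollifier x) • a u := by
    rw [← intervalIntegral.integral_of_le zero_le_one]
    have hder (r : ℝ) : HasDerivAt (fun r : ℝ => (r ^ m * mollifier (x - r • u)) • a u)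
        (F r u) r := by
      have e1 : HasDerivAt (fun t : ℝ => x - t • u) (-u) r := by
        simpa using ((hasDerivAt_id r).smul_const u).const_sub x
      have e2 := ((contDiff_mollifier (V := V)).differentiable (by simp)
        (x - r • u)).hasFDerivAt.comp_hasDerivAt r e1
      have e3 := (((hasDerivAt_pow m r).mul e2).smul_const (a u))
      refine e3.congr_deriv ?_
      rw [map_neg, mul_neg, ← sub_eq_add_neg]
      rfl
    rw [intervalIntegral.integral_eq_sub_of_hasDerivAt (fun t _ => hder t)]
    · simp
    · exact (hFc.comp (f := fun r : ℝ => (r, u)) (by fun_prop)).intervalIntegrable _ _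
  refine h1.trans ?_
  -- `integral_dilation_eq` requires the integral over `u` to be taken first, the fundamental
  -- theorem of calculus the integral over `r`.
  rw [integral_prod _ h2, setIntegral_congr_fun measurableSet_Ioc hr, integral_neg,
    integral_integral_swap hFi]
  simp only [hu]
  have i1 : Integrable fun u : V => mollifier (x - u) • a u := by
    refine (Continuous.smul (continuous_mollifier.comp
      (continuous_const.sub continuous_id)) a.continuous).integrable_of_hasCompactSupport ?_
    have := hasCompactSupport_comp_sub_smul (hasCompactSupport_mollifier (V := V)) x one_ne_zero
    simp only [one_smul] at this
    exact this.smul_right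
  have i2 : Integrable fun u : V => ((0 : ℝ) ^ m * mollifier x) • a u := by
    exact integrable_fun_smul (G := V [⋀^Fin (p + 1)]→L[ℝ] ℝ) _ a.integrable
  rw [integral_sub i1 i2, integral_smul, mul_smul, neg_sub]

end Homotopies

/-! ### The equivariant homotopy operator -/

section HomotopyOperator

open MeasureTheory Filter

open scoped SchwartzMap

variable {V : Type*} [NormedAddCommGroup V] [InnerProductSpace ℝ V]
  [FiniteDimensional ℝ V] [MeasurableSpace V] [BorelSpace V]

theorem integral_form_apply {Ω : Type*} [MeasurableSpace Ω] {μ : Measure Ω} {p : ℕ}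
    {F : Ω → V [⋀^Fin p]→L[ℝ] ℝ} (hF : Integrable F μ) (v : Fin p → V) :
    (∫ w, F w ∂μ) v = ∫ w, F w v ∂μ :=
  ((ContinuousAlternatingMap.apply ℝ V ℝ v).integral_comp_comm
    (E := V [⋀^Fin p]→L[ℝ] ℝ) hF).symm

/-- An `SO(V)`-equivariant homotopy operator for the de Rham complexes of rapidly decreasing and of
compactly supported forms: the average over translations, with weight `mollifier`, minus the
average over dilations, which contracts the convolution with `mollifier` of a form of degree less
than `d` to zero. -/
def homotopyOp (d : ℕ) (a : Form V) : Form V := fun p x =>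
  (∫ w : ℝ × V, mollifier w.2 • (a (p + 1) (x - w.1 • w.2)).curryLeft w.2
    ∂((volume.restrict (Set.Ioc 0 1)).prod volume)) -
  ∫ w : ℝ × V, mollifier (x - w.1 • w.2) • w.1 ^ (d - (p + 1)) • (a (p + 1) w.2).curryLeft w.2
    ∂((volume.restrict (Set.Ioc 0 1)).prod volume)

theorem extDeriv_fun_sub {p : ℕ} {a b : V → V [⋀^Fin p]→L[ℝ] ℝ} {x : V}
    (ha : DifferentiableAt ℝ a x) (hb : DifferentiableAt ℝ b x) :
    extDeriv (fun x => a x - b x) x = extDeriv a x - extDeriv b x := by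
  rw [extDeriv, fderiv_fun_sub ha hb]
  exact map_sub (ContinuousAlternatingMap.alternatizeUncurryFinCLM ℝ V ℝ (n := p)) _ _

theorem homotopyOp_integrable {d : ℕ} (e : OrthonormalBasis (Fin d) ℝ V)
    {a : Form V} (ha : a ∈ rapidForms V) (p : ℕ) (x : V) :
    Integrable (fun w : ℝ × V => mollifier w.2 • (a (p + 1) (x - w.1 • w.2)).curryLeft w.2)
      ((volume.restrict (Set.Ioc 0 1)).prod volume) ∧
    Integrable (fun w : ℝ × V =>
      mollifier (x - w.1 • w.2) • w.1 ^ (d - (p + 1)) • (a (p + 1) w.2).curryLeft w.2)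
      ((volume.restrict (Set.Ioc 0 1)).prod volume) := by
  obtain ⟨s, hs⟩ := mem_rapidForms.1 ha (p + 1)
  rw [← hs]
  obtain ⟨s₁, -, h₁, -⟩ := exists_translationHomotopy s
  obtain ⟨s₂, -, h₂, -⟩ := exists_dilationHomotopy e (d - (p + 1)) s
  exact ⟨h₁ x, h₂ x⟩

theorem homotopyOp_mem_rapidForms {d : ℕ} (e : OrthonormalBasis (Fin d) ℝ V)
    {a : Form V} (ha : a ∈ rapidForms V) :
    homotopyOp d a ∈ rapidForms V := by
  rw [mem_rapidForms]
  intro p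
  obtain ⟨s, hs⟩ := mem_rapidForms.1 ha (p + 1)
  obtain ⟨s₁, h₁, -⟩ := exists_translationHomotopy s
  obtain ⟨s₂, h₂, -⟩ := exists_dilationHomotopy e (d - (p + 1)) s
  refine ⟨s₁ - s₂, funext fun x => ?_⟩
  rw [sub_apply, h₁, h₂, hs]
  rfl

/-- Both integrands of `homotopyOp` vanish for `‖x‖ > R + 2` if `a` is supported in the ball of
radius `R`, because the mollifier is supported in the ball of radius `2`. -/
theorem homotopyOp_mem_compactForms {d : ℕ} (e : OrthonormalBasis (Fin d) ℝ V)
    {a : Form V} (ha : a ∈ compactForms V) :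
    homotopyOp d a ∈ compactForms V := by
  refine ⟨(homotopyOp_mem_rapidForms e (compactForms_le_rapidForms ha)).1, fun p => ?_⟩
  obtain ⟨R, hR⟩ := (ha.2 (p + 1)).isCompact.isBounded.subset_closedBall 0
  have hz (y : V) (hy : R < ‖y‖) : a (p + 1) y = 0 :=
    image_eq_zero_of_notMem_tsupport fun h => (hy.trans_le (by simpa using hR h)).false
  refine HasCompactSupport.intro (isCompact_closedBall 0 (R + 2)) fun x hx => ?_
  have hx' : R + 2 < ‖x‖ := by simpa using hx
  have key (w : ℝ × V) (hw : w.1 ∈ Set.Ioc (0 : ℝ) 1) : ‖x‖ ≤ ‖x - w.1 • w.2‖ + ‖w.2‖ := by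
    have h1 : ‖w.1 • w.2‖ ≤ ‖w.2‖ := by
      rw [norm_smul, Real.norm_of_nonneg hw.1.le]
      exact mul_le_of_le_one_left (norm_nonneg w.2) hw.2
    have h2 := norm_add_le (x - w.1 • w.2) (w.1 • w.2)
    rw [sub_add_cancel] at h2
    linarith
  have e1 : ∫ w : ℝ × V, mollifier w.2 • (a (p + 1) (x - w.1 • w.2)).curryLeft w.2
      ∂((volume.restrict (Set.Ioc 0 1)).prod volume) = 0 := by
    refine integral_eq_zero_of_ae (ae_mem_unitInterval.mono fun w hw => ?_)
    by_cases h : 2 ≤ ‖w.2‖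
    · simp [mollifier_eq_zero h]
    · simp [hz (x - w.1 • w.2) (by linarith [key w hw])]
  have e2 : ∫ w : ℝ × V, mollifier (x - w.1 • w.2) • w.1 ^ (d - (p + 1)) •
      (a (p + 1) w.2).curryLeft w.2 ∂((volume.restrict (Set.Ioc 0 1)).prod volume) = 0 := by
    refine integral_eq_zero_of_ae (ae_mem_unitInterval.mono fun w hw => ?_)
    by_cases h : 2 ≤ ‖x - w.1 • w.2‖
    · simp [mollifier_eq_zero h]
    · simp [hz w.2 (by linarith [key w hw])]
  simp only [homotopyOp]
  rw [e1, e2, sub_zero]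

theorem homotopyOp_add {d : ℕ} (e : OrthonormalBasis (Fin d) ℝ V)
    {a b : Form V} (ha : a ∈ rapidForms V) (hb : b ∈ rapidForms V) :
    homotopyOp d (a + b) = homotopyOp d a + homotopyOp d b := by
  funext p x
  obtain ⟨a1, a2⟩ := homotopyOp_integrable e ha p x
  obtain ⟨b1, b2⟩ := homotopyOp_integrable e hb p x
  have e1 := integral_add a1 b1
  have e2 := integral_add a2 b2
  simp only [homotopyOp, Pi.add_apply, ContinuousAlternatingMap.curryLeft_add, smul_add,
    add_apply] at e1 e2 ⊢
  rw [e1, e2]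
  abel

theorem homotopyOp_smul {d : ℕ} (c : ℝ) (a : Form V) :
    homotopyOp d (c • a) = c • homotopyOp d a := by
  funext p x
  simp only [homotopyOp, Pi.smul_apply, smul_sub, ← integral_smul,
    ContinuousAlternatingMap.curryLeft_smul, smul_apply, smul_comm c]

/-- The homotopy operator commutes with isometries since the mollifier is radial. -/
theorem IsEquivariant.homotopyOp {d : ℕ} (e : OrthonormalBasis (Fin d) ℝ V)
    {α : EForm V} (hα : IsEquivariant α)
    (hr : ∀ X, α X ∈ rapidForms V) : IsEquivariant fun X => homotopyOp d (α X) := by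
  intro g hg X p x v
  obtain ⟨a1, a2⟩ := homotopyOp_integrable e (hr X) p x
  obtain ⟨b1, b2⟩ := homotopyOp_integrable e (hr (Ad g X)) p (g x)
  let G : ℝ × V ≃ᵐ ℝ × V :=
    (MeasurableEquiv.refl ℝ).prodCongr g.toHomeomorph.toMeasurableEquiv
  have hG : MeasurePreserving G ((volume.restrict (Set.Ioc 0 1)).prod volume)
      ((volume.restrict (Set.Ioc 0 1)).prod volume) :=
    (MeasurePreserving.id _).prod g.measurePreserving
  have hcons (y : V) : (Matrix.vecCons (g y) fun i => g (v i)) =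
      fun i => g (Matrix.vecCons y v i) := by
    funext i
    refine Fin.cases ?_ (fun j => ?_) i <;> simp
  simp only [EquivariantThom.homotopyOp, ContinuousAlternatingMap.sub_apply]
  rw [integral_form_apply a1, integral_form_apply a2, integral_form_apply b1,
    integral_form_apply b2, ← hG.integral_comp' (fun w : ℝ × V => (mollifier w.2 •
      (α (Ad g X) (p + 1) (g x - w.1 • w.2)).curryLeft w.2) fun i => g (v i)),
    ← hG.integral_comp' (fun w : ℝ × V => (mollifier (g x - w.1 • w.2) • w.1 ^ (d - (p + 1)) •
      (α (Ad g X) (p + 1) w.2).curryLeft w.2) fun i => g (v i))]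
  have hGw (w : ℝ × V) : G w = (w.1, g w.2) := rfl
  have hsub (w : ℝ × V) : g x - w.1 • g w.2 = g (x - w.1 • w.2) := by simp
  simp only [hGw, hsub, mollifier_isometry, ContinuousAlternatingMap.smul_apply,
    ContinuousAlternatingMap.curryLeft_apply_apply, hcons, hα g hg X]

/-- The Poincaré lemma: `homotopyOp` gives a primitive of a closed form of positive degree, whose
integral has to vanish when the degree is `d`. -/
theorem extDeriv_homotopyOp {d : ℕ} (e : OrthonormalBasis (Fin d) ℝ V)
    {a : Form V} (ha : a ∈ rapidForms V) {p : ℕ} (hp : p + 1 ≤ d)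
    (hd : ∀ x, extDeriv (a (p + 1)) x = 0) (hint : p + 1 = d → ∫ x, a (p + 1) x = 0) (x : V) :
    extDeriv (homotopyOp d a p) x = a (p + 1) x := by
  obtain ⟨s, hs⟩ := mem_rapidForms.1 ha (p + 1)
  rw [← hs] at hd hint
  obtain ⟨s₁, h₁, -, h₁'⟩ := exists_translationHomotopy s
  obtain ⟨s₂, h₂, -, h₂'⟩ := exists_dilationHomotopy e (d - (p + 1)) s
  have h : homotopyOp d a p = fun x => s₁ x - s₂ x := by
    funext x
    rw [h₁, h₂, hs]
    rfl
  have h3 : (0 : ℝ) ^ (d - (p + 1)) • mollifier x • (∫ u, s u) = 0 := by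
    rcases hp.eq_or_lt with h | h
    · rw [hint h, smul_zero, smul_zero]
    · rw [zero_pow (by omega), zero_smul]
  -- The convolution with the mollifier, in the two forms produced by the two homotopies.
  have h4 : ∫ y, mollifier y • s (x - y) = ∫ y, mollifier (x - y) • s y := by
    rw [← integral_sub_left_eq_self _ volume x]
    simp
  rw [h]
  have h5 := extDeriv_fun_sub (s₁.differentiableAt (x := x)) (s₂.differentiableAt (x := x))
  rw [h5, h₁' hd, h₂' (by omega) hd, h3, h4, ← hs]
  abel

end HomotopyOperator

/-! ### Closed forms of integral zero -/

section Injectivity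

open MeasureTheory Filter

open scoped SchwartzMap

variable {V : Type*} [NormedAddCommGroup V] [InnerProductSpace ℝ V]
  [FiniteDimensional ℝ V] [MeasurableSpace V] [BorelSpace V]

/-- A rapidly decreasing constant function vanishes, unless `V` is a point. -/
theorem schwartz_eq_zero_of_extDeriv {d : ℕ} (e : OrthonormalBasis (Fin d) ℝ V)
    (s : 𝓢(V, V [⋀^Fin 0]→L[ℝ] ℝ)) (hd : ∀ x, extDeriv s x = 0)
    (hint : d = 0 → ∫ x, s x = 0) : ∀ x, s x = 0 := by
  have h1 (x : V) : fderiv ℝ s x = 0 := by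
    ext w v
    have h := congrArg (fun f : V [⋀^Fin 1]→L[ℝ] ℝ => f fun _ => w) (hd x)
    simp only [extDeriv, ContinuousAlternatingMap.alternatizeUncurryFin_apply] at h
    rw [Fin.sum_univ_succ] at h
    simpa [Subsingleton.elim (Fin.removeNth 0 fun _ : Fin 1 => w) v] using h
  have h2 (x : V) : s x = s 0 := is_const_of_fderiv_eq_zero s.differentiable h1 x 0
  have h3 : Integrable (fun _ : V => s 0) := by
    have := s.integrable (μ := (volume : Measure V))
    rwa [show (⇑s : V → _) = fun _ => s 0 from funext h2] at this
  have h4 : s 0 = 0 := by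
    rcases integrable_const_iff.1 h3 with h | h
    · exact h
    · by_contra h0
      have hsub : ¬ NoncompactSpace V := fun _ => by
        have := measure_univ_of_isAddLeftInvariant (volume : Measure V)
        have := h.measure_univ_lt_top
        simp_all
      have hd0 : d = 0 := by
        by_contra hd0
        have : Nontrivial V := by
          refine ⟨e ⟨0, Nat.pos_of_ne_zero hd0⟩, 0, fun h => ?_⟩
          have := e.norm_eq_one ⟨0, Nat.pos_of_ne_zero hd0⟩
          simp [h] at this
        exact hsub (NormedSpace.noncompactSpace ℝ V)
      have h5 := hint hd0
      simp only [h2] at h5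
      rw [integral_const] at h5
      rcases smul_eq_zero.1 h5 with h6 | h6
      · rw [measureReal_eq_zero_iff, Measure.measure_univ_eq_zero] at h6
        exact NeZero.ne _ h6
      · exact h0 h6
  exact fun x => (h2 x).trans h4

theorem alternating_eq_zero_of_basis {d : ℕ} (e : OrthonormalBasis (Fin d) ℝ V)
    {f : V [⋀^Fin d]→L[ℝ] ℝ} (h : f (fun k => e k) = 0) : f = 0 := by
  have h1 := f.toAlternatingMap.eq_smul_basis_det e.toBasis
  ext v
  have h2 := congrArg (fun g : V [⋀^Fin d]→ₗ[ℝ] ℝ => g v) h1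
  have h3 : f.toAlternatingMap e.toBasis = 0 := by
    rw [e.coe_toBasis]; exact h
  rw [h3, zero_smul] at h2
  exact h2

theorem integral_eq_zero_of_formIntegral {d : ℕ} (e : OrthonormalBasis (Fin d) ℝ V) {a : Form V}
    (ha : a ∈ rapidForms V) (h : formIntegral e a = 0) : ∫ x, a d x = 0 := by
  obtain ⟨s, hs⟩ := mem_rapidForms.1 ha d
  refine alternating_eq_zero_of_basis e ?_
  rw [← hs, integral_form_apply s.integrable, hs]
  exact h

theorem eqDiff_add {U : TopologicalSpace.Opens V} {α β : EForm V}
    (hα : ∀ X, α X ∈ smoothForms U) (hβ : ∀ X, β X ∈ smoothForms U) :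
    eqDiff U (α + β) = eqDiff U α + eqDiff U β := by
  funext X
  simp only [eqDiff, Pi.add_apply, contract_add, dForm_add (hα X) (hβ X)]
  abel

theorem eqDiff_neg {U : TopologicalSpace.Opens V} (α : EForm V) :
    eqDiff U (-α) = -eqDiff U α := by
  funext X
  simp only [eqDiff, Pi.neg_apply]
  rw [← neg_one_smul ℝ (α X), dForm_smul, contract_smul]
  funext p x
  ext v
  change -1 * dForm U (α X) p x v - -1 * contract (vecField X) (α X) p x v =
    -(dForm U (α X) p x v - contract (vecField X) (α X) p x v)
  ring

theorem eqDiff_sub {U : TopologicalSpace.Opens V} {α β : EForm V}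
    (hα : ∀ X, α X ∈ smoothForms U) (hβ : ∀ X, β X ∈ smoothForms U) :
    eqDiff U (α - β) = eqDiff U α - eqDiff U β := by
  rw [sub_eq_add_neg, eqDiff_add (β := -β) hα (fun X => neg_mem (hβ X)), eqDiff_neg,
    ← sub_eq_add_neg]

theorem eqDiff_apply_succ (α : EForm V) (X : so V) (p : ℕ) (x : V) :
    eqDiff ⊤ α X (p + 1) x =
      extDeriv (α X p) x - (α X (p + 2) x).curryLeft (vecField X x) := by
  simp only [eqDiff, Pi.sub_apply, dForm_top_succ, contract]

/-- If `D α = 0`, a component of `α(X)` is closed as soon as the component two degrees above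
vanishes. -/
theorem extDeriv_eq_zero_of_closed {α : EForm V} (hD : eqDiff ⊤ α = 0) {X : so V} {p : ℕ}
    (h : α X (p + 2) = 0) (x : V) : extDeriv (α X p) x = 0 := by
  have h1 := eqDiff_apply_succ α X p x
  rw [hD, h] at h1
  simpa using h1.symm

theorem eqForms_mono {𝓐 𝓑 : Submodule ℝ (Form V)} (h : 𝓐 ≤ 𝓑) {α : EForm V}
    (hα : α ∈ eqForms 𝓐) : α ∈ eqForms 𝓑 :=
  ⟨polyMaps_map (𝓑 := 𝓑) id (fun _ _ _ _ => rfl) (fun _ _ _ => rfl) (fun _ ha => h ha) hα.1, hα.2⟩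

/-- A closed equivariant form whose integral vanishes is exact. The primitive is found by removing
the components of `α` one by one, from the highest degree downwards: the component of highest
degree is closed for the de Rham differential, hence has the primitive given by `homotopyOp`. -/
theorem exists_eqDiff_eq {𝓐 : Submodule ℝ (Form V)} {d : ℕ} (e : OrthonormalBasis (Fin d) ℝ V)
    (h : IsStable 𝓐) (hr : 𝓐 ≤ rapidForms V) (hK : ∀ a ∈ 𝓐, homotopyOp d a ∈ 𝓐)
    {α : EForm V} (hα : α ∈ eqForms 𝓐) (hD : eqDiff ⊤ α = 0)
    (hint : ∀ X, formIntegral e (α X) = 0) : ∃ ψ ∈ eqForms 𝓐, eqDiff ⊤ ψ = α := by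
  -- Downward induction on a bound `n` for the degrees that occur; the integral matters only at the
  -- start, where the component of degree `d` is removed.
  suffices H : ∀ n ≤ d + 1, ∀ α ∈ eqForms 𝓐, eqDiff ⊤ α = 0 → (∀ X p, n ≤ p → α X p = 0) →
      (n = d + 1 → ∀ X, formIntegral e (α X) = 0) → ∃ ψ ∈ eqForms 𝓐, eqDiff ⊤ ψ = α by
    refine H (d + 1) le_rfl α hα hD (fun X p hp => ?_) (fun _ => hint)
    funext x
    exact alternating_eq_zero e hp _
  intro n
  induction n with
  | zero =>
    intro _ α _ _ h0 _
    have : α = 0 := by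
      funext X p
      exact h0 X p (Nat.zero_le p)
    refine ⟨0, zero_mem _, ?_⟩
    rw [this]
    have h1 := eqDiff_sub (U := ⊤) (α := (0 : EForm V)) (β := 0) (fun _ => zero_mem _)
      (fun _ => zero_mem _)
    rwa [sub_self, sub_self] at h1
  | succ n ih =>
    intro hn α hα hD h0 hint
    have hαr (X : so V) : α X ∈ rapidForms V := hr (polyMaps_apply_mem hα.1 X)
    let ψ : EForm V := fun X => homotopyOp d (α X)
    have hψ : ψ ∈ eqForms 𝓐 :=
      ⟨polyMaps_map (𝓐 := 𝓐) (homotopyOp d) (fun a ha b hb => homotopyOp_add e (hr ha) (hr hb))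
        (fun c a _ => homotopyOp_smul c a) hK hα.1, IsEquivariant.homotopyOp e hα.2 hαr⟩
    have hψ0 (X : so V) (p : ℕ) (hp : n ≤ p) : ψ X p = 0 := by
      funext x
      simp [ψ, homotopyOp, h0 X (p + 1) (by omega)]
    have hDψ : eqDiff ⊤ ψ ∈ eqForms 𝓐 := h.eqDiff_mem hψ
    have hsm {β : EForm V} (hβ : β ∈ eqForms 𝓐) (X : so V) : β X ∈ smoothForms ⊤ :=
      h.smooth (polyMaps_apply_mem hβ.1 X)
    obtain ⟨ψ', hψ', hψ''⟩ := ih (by omega) (α - eqDiff ⊤ ψ) (sub_mem hα hDψ) (by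
        rw [eqDiff_sub (hsm hα) (hsm hDψ), hD, eqDiff_eqDiff (eqForms_mono h.smooth hψ), sub_zero])
      (by
        intro X p hp
        funext x
        have hd (x : V) : extDeriv (α X n) x = 0 :=
          extDeriv_eq_zero_of_closed hD (h0 X (n + 2) (by omega)) x
        change α X p x - eqDiff ⊤ ψ X p x = 0
        -- In degree zero `α(X)` is a rapidly decreasing constant; in degree `n > 0` the component
        -- of `α(X)` equals `d ψ(X)`; above degree `n` everything vanishes.
        rcases p with - | p
        · have hn0 : n = 0 := by omega
          subst hn0
          have e1 : eqDiff ⊤ ψ X 0 x = 0 := by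
            simp [eqDiff, dForm, contract, hψ0 X 1 (by omega)]
          obtain ⟨s, hs⟩ := mem_rapidForms.1 (hαr X) 0
          rw [e1, sub_zero, ← hs]
          refine schwartz_eq_zero_of_extDeriv e s (by rwa [hs]) (fun hd0 => ?_) x
          subst hd0
          rw [hs]
          exact integral_eq_zero_of_formIntegral e (hαr X) (hint rfl X)
        · rw [eqDiff_apply_succ, hψ0 X (p + 2) (by omega)]
          rcases hp.eq_or_lt with rfl | hlt
          · have e2 : extDeriv (ψ X p) x = α X (p + 1) x :=
              extDeriv_homotopyOp e (hαr X) (by omega) hd (fun hpd => by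
                subst hpd
                exact integral_eq_zero_of_formIntegral e (hαr X) (hint rfl X)) x
            rw [e2]
            simp
          · have e2 : ψ X p = fun _ => 0 := hψ0 X p (by omega)
            rw [e2, extDeriv_fun_const 0 x, h0 X (p + 1) (by omega)]
            simp)
      (fun h => by omega)
    refine ⟨ψ + ψ', add_mem hψ hψ', ?_⟩
    rw [eqDiff_add (hsm hψ) (hsm hψ'), hψ'']
    abel

end Injectivity

/-! ### Free generators of a cohomology module -/

section Cohomology

/-- A linear map `J` to the ring of scalars which vanishes exactly on exact elements and takes the
value `1` makes the cohomology free of rank one. -/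
theorem cohomology_freeGenerator {R A E : Type*} [CommRing R] [AddCommGroup A] [Module R A]
    [AddCommGroup E] [Module R E] (i D : A →ₗ[R] E) (J : LinearMap.ker D →ₗ[R] R)
    (hJ : ∀ z : LinearMap.ker D, J z = 0 ↔ i z ∈ LinearMap.range D) {m : LinearMap.ker D}
    (hm : J m = 1) :
    IsFreeGenerator R (Cohomology.mk i D m) ∧ ∃ I : Cohomology i D →ₗ[R] R,
      (∀ z, I (Cohomology.mk i D z) = J z) ∧ ∀ a, I a = 1 ↔ a = Cohomology.mk i D m := by
  let S : Submodule R (LinearMap.ker D) :=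
    (LinearMap.range D).comap (i ∘ₗ (LinearMap.ker D).subtype)
  have hS (z : LinearMap.ker D) : z ∈ S ↔ J z = 0 := (hJ z).symm
  let I : Cohomology i D →ₗ[R] R := S.liftQ J fun z hz => (hS z).1 hz
  have hI (z : LinearMap.ker D) : I (Cohomology.mk i D z) = J z := S.liftQ_apply J z
  have hinj : Function.Injective I := by
    rw [injective_iff_map_eq_zero]
    intro a ha
    obtain ⟨z, rfl⟩ := S.mkQ_surjective a
    exact (Submodule.Quotient.mk_eq_zero S).2 ((hS z).2 ((hI z).symm.trans ha))
  refine ⟨fun y => ⟨I y, hinj ?_, fun r hr => ?_⟩, I, hI, fun a => ⟨fun h => hinj ?_, fun h => ?_⟩⟩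
  · rw [map_smul, hI, hm, smul_eq_mul, mul_one]
  · rw [← hr, map_smul, hI, hm, smul_eq_mul, mul_one]
  · rw [h, hI, hm]
  · rw [h, hI, hm]

end Cohomology

/-! ### Integration in cohomology -/

section Integral

open MeasureTheory Filter

open scoped SchwartzMap

variable {V : Type*} [NormedAddCommGroup V] [InnerProductSpace ℝ V]
  [FiniteDimensional ℝ V] [MeasurableSpace V] [BorelSpace V]

theorem alternating_apply_isometry {d : ℕ} (e : OrthonormalBasis (Fin d) ℝ V) {g : V ≃ₗᵢ[ℝ] V}
    (hg : g ∈ SO V) (f : V [⋀^Fin d]→L[ℝ] ℝ) : f (fun k => g (e k)) = f fun k => e k := by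
  have h1 := f.toAlternatingMap.eq_smul_basis_det e.toBasis
  have h2 (v : Fin d → V) := congrArg (fun g : V [⋀^Fin d]→ₗ[ℝ] ℝ => g v) h1
  have h3 : e.toBasis.det (fun k => g (e k)) = e.toBasis.det fun k => e k := by
    have h := e.toBasis.det_comp (g.toLinearEquiv : V →ₗ[ℝ] V) (fun k => e k)
    have hg' : LinearMap.det (g.toLinearEquiv : V →ₗ[ℝ] V) = 1 := hg
    rw [hg', one_mul] at h
    exact h
  have h4 := h2 fun k => g (e k)
  have h5 := h2 fun k => e k
  simp only [AlternatingMap.smul_apply] at h4 h5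
  rw [h3] at h4
  exact h4.trans h5.symm

theorem formIntegral_integrable {d : ℕ} (e : OrthonormalBasis (Fin d) ℝ V) {a : Form V}
    (ha : a ∈ rapidForms V) : Integrable fun x => a d x fun k => e k := by
  obtain ⟨s, hs⟩ := mem_rapidForms.1 ha d
  rw [← hs]
  exact (ContinuousAlternatingMap.apply ℝ V ℝ fun k => e k).integrable_comp
    (H := V [⋀^Fin d]→L[ℝ] ℝ) s.integrable

theorem formIntegral_add {d : ℕ} (e : OrthonormalBasis (Fin d) ℝ V) {a b : Form V}
    (ha : a ∈ rapidForms V) (hb : b ∈ rapidForms V) :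
    formIntegral e (a + b) = formIntegral e a + formIntegral e b :=
  integral_add (formIntegral_integrable e ha) (formIntegral_integrable e hb)

theorem formIntegral_smul {d : ℕ} (e : OrthonormalBasis (Fin d) ℝ V) (c : ℝ) (a : Form V) :
    formIntegral e (c • a) = c * formIntegral e a :=
  integral_const_mul c _

/-- Isometries of determinant one preserve both the measure and the orientation, so the integral of
an equivariant form is an invariant polynomial. -/
theorem formIntegral_mem_invPoly {𝓐 : Submodule ℝ (Form V)} (hr : 𝓐 ≤ rapidForms V) {d : ℕ}
    (e : OrthonormalBasis (Fin d) ℝ V) {α : EForm V} (hα : α ∈ eqForms 𝓐) :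
    (fun X => formIntegral e (α X)) ∈ invPoly V := by
  refine ⟨?_, fun g hg X => ?_⟩
  · have key : ∀ β ∈ polyMaps 𝓐, (fun X => formIntegral e (β X)) ∈ polyFun V := by
      intro β hβ
      induction hβ using Submodule.span_induction with
      | mem γ h =>
        obtain ⟨P, hP, a, ha, rfl⟩ := h
        simp only [formIntegral_smul]
        exact mul_mem hP ((polyFun V).algebraMap_mem (formIntegral e a))
      | zero =>
        have : (fun _ : so V => formIntegral e (0 : Form V)) = 0 := by
          funext X
          simp [formIntegral]
        exact this ▸ zero_mem _
      | add β γ hb hc ihb ihc =>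
        have : (fun X => formIntegral e ((β + γ) X)) =
            (fun X => formIntegral e (β X)) + fun X => formIntegral e (γ X) := by
          funext X
          exact formIntegral_add e (hr (polyMaps_apply_mem hb X)) (hr (polyMaps_apply_mem hc X))
        exact this ▸ add_mem ihb ihc
      | smul c β hb ih =>
        have : (fun X => formIntegral e ((c • β) X)) = c • fun X => formIntegral e (β X) := by
          funext X
          exact formIntegral_smul e c (β X)
        exact this ▸ Subalgebra.smul_mem _ ih c
    exact key α hα.1
  · have h1 := g.measurePreserving.integral_comp g.toHomeomorph.measurableEmbedding
      (fun x => α (Ad g X) d x fun k => e k)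
    simp only [formIntegral]
    rw [← h1]
    refine integral_congr_ae (Eventually.of_forall fun x => ?_)
    change α (Ad g X) d (g x) (fun k => e k) = α X d x fun k => e k
    rw [← alternating_apply_isometry e hg]
    exact hα.2 g hg X d x _

/-- Integration of rapidly decreasing equivariant forms, as a map to the invariant polynomials. -/
def integralMap {𝓐 : Submodule ℝ (Form V)} (hr : 𝓐 ≤ rapidForms V) {d : ℕ}
    (e : OrthonormalBasis (Fin d) ℝ V) : eqForms 𝓐 →ₗ[InvPoly V] InvPoly V where
  toFun α := ⟨fun X => formIntegral e ((α : EForm V) X), formIntegral_mem_invPoly hr e α.2⟩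
  map_add' α β := Subtype.ext <| funext fun X =>
    formIntegral_add e (hr (polyMaps_apply_mem α.2.1 X)) (hr (polyMaps_apply_mem β.2.1 X))
  map_smul' r α := Subtype.ext <| funext fun X =>
    formIntegral_smul e (r.toFun X) ((α : EForm V) X)

theorem InvPoly.ext {P Q : InvPoly V} (h : ∀ X, P.toFun X = Q.toFun X) : P = Q :=
  Subtype.ext (funext h)

/-- Stokes' theorem for rapidly decreasing equivariant forms. -/
theorem formIntegral_eqDiff {d : ℕ} (e : OrthonormalBasis (Fin d) ℝ V) {ψ : EForm V}
    (hψ : ∀ X, ψ X ∈ rapidForms V) (X : so V) : formIntegral e (eqDiff ⊤ ψ X) = 0 := by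
  have h0 (x : V) : ψ X (d + 1) x = 0 := alternating_eq_zero e (Nat.lt_succ_self d) _
  rcases d with - | p
  · have : eqDiff ⊤ ψ X 0 = 0 := by
      funext x
      simp [eqDiff, dForm, contract, h0]
    simp [formIntegral, this]
  · obtain ⟨s, hs⟩ := mem_rapidForms.1 (hψ X) p
    have h1 (x : V) : eqDiff ⊤ ψ X (p + 1) x = extDeriv s x := by
      rw [eqDiff_apply_succ, h0, hs]
      simp
    have h2 : eqDiff ⊤ ψ X ∈ rapidForms V :=
      sub_mem (isStable_rapidForms.dForm_mem _ (hψ X)) (isStable_rapidForms.contract_mem _ (hψ X) X)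
    obtain ⟨s', hs'⟩ := mem_rapidForms.1 h2 (p + 1)
    have h3 := integral_form_apply (s'.integrable (μ := (volume : Measure V))) fun k => e k
    rw [hs'] at h3
    rw [formIntegral, ← h3]
    simp only [h1]
    rw [integral_extDeriv_eq_zero]
    rfl

/-- The cohomology of a stable space of rapidly decreasing forms, preserved by the homotopy
operator, is freely generated by any class of integral `1`. -/
theorem isStable_cohomology {𝓐 : Submodule ℝ (Form V)} {d : ℕ} (e : OrthonormalBasis (Fin d) ℝ V)
    (h : IsStable 𝓐) (hr : 𝓐 ≤ rapidForms V) (hK : ∀ a ∈ 𝓐, homotopyOp d a ∈ 𝓐)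
    {m : LinearMap.ker (eqD ⊤ 𝓐 h.smooth)}
    (hm : ∀ X, formIntegral e (((m : eqForms 𝓐) : EForm V) X) = 1) :
    IsFreeGenerator (InvPoly V)
      (Cohomology.mk (eqForms 𝓐).subtype (eqD ⊤ 𝓐 h.smooth) m) ∧
    ∃ I : Cohomology (eqForms 𝓐).subtype (eqD ⊤ 𝓐 h.smooth) →ₗ[InvPoly V] InvPoly V,
      (∀ (z : LinearMap.ker (eqD ⊤ 𝓐 h.smooth)) (X : so V),
        (I (Cohomology.mk (eqForms 𝓐).subtype (eqD ⊤ 𝓐 h.smooth) z)).toFun X =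
          formIntegral e (((z : eqForms 𝓐) : EForm V) X)) ∧
      ∀ a, I a = 1 ↔ a = Cohomology.mk (eqForms 𝓐).subtype (eqD ⊤ 𝓐 h.smooth) m := by
  have hJ (z : LinearMap.ker (eqD ⊤ 𝓐 h.smooth)) :
      (integralMap hr e ∘ₗ (LinearMap.ker (eqD ⊤ 𝓐 h.smooth)).subtype) z = 0 ↔
        (eqForms 𝓐).subtype z ∈ LinearMap.range (eqD ⊤ 𝓐 h.smooth) := by
    refine ⟨fun hz => ?_, ?_⟩
    · obtain ⟨ψ, hψ, hψ'⟩ := exists_eqDiff_eq e h hr hK z.1.2 (LinearMap.mem_ker.1 z.2)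
        fun X => congrArg (fun P : InvPoly V => P.toFun X) hz
      exact ⟨⟨ψ, hψ⟩, hψ'⟩
    · rintro ⟨ψ, hψ⟩
      have hψ' : eqDiff ⊤ (ψ : EForm V) = ((z : eqForms 𝓐) : EForm V) := hψ
      refine InvPoly.ext fun X => ?_
      change formIntegral e (((z : eqForms 𝓐) : EForm V) X) = 0
      rw [← hψ']
      exact formIntegral_eqDiff e (fun X => hr (polyMaps_apply_mem ψ.2.1 X)) X
  obtain ⟨h1, I, hI, h2⟩ := cohomology_freeGenerator (eqForms 𝓐).subtype (eqD ⊤ 𝓐 h.smooth)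
    (integralMap hr e ∘ₗ (LinearMap.ker (eqD ⊤ 𝓐 h.smooth)).subtype) hJ (m := m) (InvPoly.ext hm)
  exact ⟨h1, I, fun z X => congrArg (fun P : InvPoly V => P.toFun X) (hI z), h2⟩

end Integral

/-! ### Multiplication of forms by functions -/

section Multiplication

open MeasureTheory Filter

variable {V : Type*} [NormedAddCommGroup V] [InnerProductSpace ℝ V] [FiniteDimensional ℝ V]

/-- Multiplication of a form by a function. -/
def mulForm (f : V → ℝ) (a : Form V) : Form V := fun p x => f x • a p x

theorem mulForm_add (f : V → ℝ) (a b : Form V) :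
    mulForm f (a + b) = mulForm f a + mulForm f b :=
  funext fun _ => funext fun _ => smul_add _ _ _

theorem mulForm_smul (f : V → ℝ) (c : ℝ) (a : Form V) : mulForm f (c • a) = c • mulForm f a :=
  funext fun p => funext fun x => smul_comm (f x) c (a p x)

theorem contract_mulForm (S : V → V) (f : V → ℝ) (a : Form V) :
    contract S (mulForm f a) = mulForm f (contract S a) := rfl

theorem smoothForms_contDiffAt {a : Form V} (ha : a ∈ smoothForms (punctured V)) (p : ℕ) {x : V}
    (hx : x ≠ 0) : ContDiffAt ℝ ∞ (a p) x :=
  (ha p).1.contDiffAt ((punctured V).isOpen.mem_nhds hx)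

theorem mulForm_mem_smoothForms {f : V → ℝ} (hf : ContDiff ℝ ∞ f) {a : Form V}
    (ha : a ∈ smoothForms ⊤) : mulForm f a ∈ smoothForms ⊤ := by
  rw [mem_smoothForms_top] at ha ⊢
  exact fun p => hf.smul (ha p)

/-- A form on `V ∖ {0}` multiplied by a function vanishing near `0` extends smoothly to `V`. -/
theorem mulForm_mem_smoothForms_of_punctured {f : V → ℝ} (hf : ContDiff ℝ ∞ f)
    (hf0 : ∀ᶠ x in 𝓝 0, f x = 0) {a : Form V} (ha : a ∈ smoothForms (punctured V)) :
    mulForm f a ∈ smoothForms ⊤ := by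
  rw [mem_smoothForms_top]
  intro p
  rw [contDiff_iff_contDiffAt]
  intro x
  by_cases hx : x = 0
  · subst hx
    refine (contDiffAt_const (c := (0 : V [⋀^Fin p]→L[ℝ] ℝ))).congr_of_eventuallyEq ?_
    filter_upwards [hf0] with y hy
    simp [mulForm, hy]
  · exact hf.contDiffAt.smul (smoothForms_contDiffAt ha p hx)

theorem mulForm_mem_punctured {f : V → ℝ} (hf : ContDiff ℝ ∞ f) {a : Form V}
    (ha : a ∈ smoothForms (punctured V)) : mulForm f a ∈ smoothForms (punctured V) :=
  fun p => ⟨hf.contDiffOn.smul (ha p).1, fun x hx => by simp [mulForm, (ha p).2 x hx]⟩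

theorem mulForm_mem_compactForms {f : V → ℝ} (hf : ContDiff ℝ ∞ f) (hc : HasCompactSupport f)
    {a : Form V} (ha : a ∈ smoothForms ⊤) : mulForm f a ∈ compactForms V :=
  ⟨mulForm_mem_smoothForms hf ha, fun _ => hc.smul_right⟩

theorem IsEquivariant.mulForm {f : V → ℝ} (hf : ∀ g ∈ SO V, ∀ x, f (g x) = f x) {α : EForm V}
    (hα : IsEquivariant α) : IsEquivariant fun X => mulForm f (α X) := by
  intro g hg X p x v
  simp [EquivariantThom.mulForm, hf g hg, hα g hg X p x v]

theorem mulForm_mem_eqForms {𝓐 𝓑 : Submodule ℝ (Form V)} {f : V → ℝ}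
    (hf : ∀ g ∈ SO V, ∀ x, f (g x) = f x) (h : ∀ a ∈ 𝓐, mulForm f a ∈ 𝓑) {α : EForm V}
    (hα : α ∈ eqForms 𝓐) : (fun X => mulForm f (α X)) ∈ eqForms 𝓑 :=
  ⟨polyMaps_map (𝓐 := 𝓐) (mulForm f) (fun a _ b _ => mulForm_add f a b)
    (fun c a _ => mulForm_smul f c a) h hα.1, IsEquivariant.mulForm hf hα.2⟩

/-- The Leibniz rule `d(f b) = f db + df ∧ b`. -/
theorem extDeriv_smul_apply {p : ℕ} {f : V → ℝ} {b : V → V [⋀^Fin p]→L[ℝ] ℝ} {x : V}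
    (hf : DifferentiableAt ℝ f x) (hb : DifferentiableAt ℝ b x) :
    extDeriv (fun y => f y • b y) x = f x • extDeriv b x +
      ContinuousAlternatingMap.alternatizeUncurryFin ((fderiv ℝ f x).smulRight (b x)) := by
  have h : HasFDerivAt (fun y => f y • b y)
      (f x • fderiv ℝ b x + (fderiv ℝ f x).smulRight (b x)) x :=
    hf.hasFDerivAt.smul hb.hasFDerivAt
  rw [extDeriv, h.fderiv, ContinuousAlternatingMap.alternatizeUncurryFin_add,
    ContinuousAlternatingMap.alternatizeUncurryFin_smul, extDeriv]

theorem extDeriv_eq_of_eventuallyEq {p : ℕ} {a b : V → V [⋀^Fin p]→L[ℝ] ℝ} {x : V}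
    (h : a =ᶠ[𝓝 x] b) : extDeriv a x = extDeriv b x := by
  rw [extDeriv, extDeriv, h.fderiv_eq]

theorem dWedge_apply_of_fderiv_eq_zero {f : V → ℝ} {x : V} (h : fderiv ℝ f x = 0) (b : Form V)
    (p : ℕ) : dWedge f b p x = 0 := by
  cases p with
  | zero => rfl
  | succ p =>
    simp only [dWedge, h, ContinuousLinearMap.zero_smulRight]
    exact map_zero (ContinuousAlternatingMap.alternatizeUncurryFinCLM ℝ V ℝ (n := p))

/-- The Leibniz rule `D(f β) = f Dβ + df ∧ β`, for a form `β` on `V ∖ {0}` and a function `f`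
vanishing near `0`. -/
theorem eqDiff_mulForm {f : V → ℝ} (hf : ContDiff ℝ ∞ f) (hf0 : ∀ᶠ x in 𝓝 0, f x = 0)
    {β : EForm V} (hβ : ∀ X, β X ∈ smoothForms (punctured V)) :
    eqDiff ⊤ (fun X => mulForm f (β X)) =
      fun X => mulForm f (eqDiff (punctured V) β X) + dWedge f (β X) := by
  funext X p x
  change dForm ⊤ (mulForm f (β X)) p x - contract (vecField X) (mulForm f (β X)) p x =
    f x • (dForm (punctured V) (β X) p x - contract (vecField X) (β X) p x) + dWedge f (β X) p x
  rw [contract_mulForm]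
  by_cases hx : x = 0
  · subst hx
    have h0 : f 0 = 0 := hf0.self_of_nhds
    have h1 : fderiv ℝ f 0 = 0 := by
      have : f =ᶠ[𝓝 0] fun _ => 0 := hf0
      rw [this.fderiv_eq, fderiv_fun_const]
      rfl
    have h2 : dForm ⊤ (mulForm f (β X)) p 0 = 0 := by
      cases p with
      | zero => rfl
      | succ p =>
        rw [dForm_top_succ]
        refine (extDeriv_eq_of_eventuallyEq ?_).trans (extDeriv_fun_const 0 0)
        filter_upwards [hf0] with y hy
        simp [mulForm, hy]
    rw [dWedge_apply_of_fderiv_eq_zero h1, h2, mulForm, h0]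
    simp
  · have hb (p : ℕ) : DifferentiableAt ℝ (β X p) x :=
      (smoothForms_contDiffAt (hβ X) p hx).differentiableAt (by simp)
    cases p with
    | zero => simp [dForm, dWedge, mulForm]
    | succ p =>
      have h1 : dForm (punctured V) (β X) (p + 1) x = extDeriv (β X p) x :=
        Set.indicator_of_mem (s := (punctured V : Set V)) hx _
      have h2 := extDeriv_smul_apply (hf.differentiable (by simp) x) (hb p)
      rw [dForm_top_succ, h1]
      change extDeriv (fun y => f y • β X p y) x - f x • contract (vecField X) (β X) (p + 1) x = _
      rw [h2, smul_sub]
      change _ = _ + ContinuousAlternatingMap.alternatizeUncurryFin _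
      abel

theorem dWedge_one_sub {χ : V → ℝ} (b : Form V) :
    dWedge (fun x => 1 - χ x) b = -dWedge χ b := by
  funext p x
  cases p with
  | zero => simp [dWedge]
  | succ p =>
    have h : (fderiv ℝ (fun x => 1 - χ x) x).smulRight (b p x) =
        -(fderiv ℝ χ x).smulRight (b p x) := by
      rw [fderiv_const_sub]
      ext w v
      simp
    simp only [dWedge, h, Pi.neg_apply]
    exact map_neg (ContinuousAlternatingMap.alternatizeUncurryFinCLM ℝ V ℝ (n := p)) _

end Multiplication

/-! ### Cutoff functions -/

section Relative

open MeasureTheory Filter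

variable {V : Type*} [NormedAddCommGroup V] [InnerProductSpace ℝ V] [FiniteDimensional ℝ V]
  [MeasurableSpace V] [BorelSpace V]

theorem isCutoff_radialBump : IsCutoff (radialBump : V → ℝ) where
  smooth := contDiff_radialBump
  compact := hasCompactSupport_radialBump
  invariant g _ x := by simp [radialBump]
  eq_one := by
    filter_upwards [Metric.closedBall_mem_nhds (0 : V) one_pos] with x hx
    exact radialBump_eq_one (by simpa using hx)

theorem IsCutoff.contDiff_one_sub {χ : V → ℝ} (hχ : IsCutoff χ) :
    ContDiff ℝ ∞ fun x => 1 - χ x := contDiff_const.sub hχ.smooth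

theorem IsCutoff.one_sub_eventually {χ : V → ℝ} (hχ : IsCutoff χ) :
    ∀ᶠ x in 𝓝 0, 1 - χ x = 0 := hχ.eq_one.mono fun x hx => by rw [hx, sub_self]

theorem IsCutoff.one_sub_invariant {χ : V → ℝ} (hχ : IsCutoff χ) :
    ∀ g ∈ SO V, ∀ x, 1 - χ (g x) = 1 - χ x := fun g hg x => by rw [hχ.invariant g hg]

/-- For a relatively closed pair, `χ α + dχ ∧ β = α - D((1 - χ) β)`. -/
theorem cutoff_eq_sub {χ : V → ℝ} (hχ : IsCutoff χ) {α β : EForm V}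
    (hβ : ∀ X, β X ∈ smoothForms (punctured V))
    (h : restrictPunctured V α = eqDiff (punctured V) β) :
    cutoff χ α β = α - eqDiff ⊤ fun X => mulForm (fun x => 1 - χ x) (β X) := by
  rw [eqDiff_mulForm hχ.contDiff_one_sub hχ.one_sub_eventually hβ, ← h]
  funext X p x
  have h1 : mulForm (fun x => 1 - χ x) (restrictPunctured V α X) p x =
      (1 - χ x) • α X p x := by
    by_cases hx : x = 0
    · subst hx
      simp [mulForm, hχ.eq_one.self_of_nhds]
    · change (1 - χ x) • (punctured V : Set V).indicator (α X p) x = _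
      rw [Set.indicator_of_mem hx]
  change χ x • α X p x + dWedge χ (β X) p x = α X p x -
    (mulForm (fun x => 1 - χ x) (restrictPunctured V α X) p x +
      dWedge (fun x => 1 - χ x) (β X) p x)
  rw [h1, dWedge_one_sub]
  ext v
  simp
  ring

theorem support_cutoff_subset (χ : V → ℝ) (α β : EForm V) (X : so V) (p : ℕ) :
    Function.support (cutoff χ α β X p) ⊆ tsupport χ := by
  intro x hx
  by_contra h
  refine hx ?_
  have h1 : fderiv ℝ χ x = 0 := by
    have : χ =ᶠ[𝓝 x] fun _ => 0 := notMem_tsupport_iff_eventuallyEq.1 h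
    rw [this.fderiv_eq, fderiv_fun_const]
    rfl
  change χ x • α X p x + dWedge χ (β X) p x = 0
  rw [dWedge_apply_of_fderiv_eq_zero h1, image_eq_zero_of_notMem_tsupport h]
  simp

theorem exists_isCutoff_eq_one {K : Set V} (hK : IsCompact K) :
    ∃ χ : V → ℝ, IsCutoff χ ∧ ∀ x ∈ K, χ x = 1 := by
  obtain ⟨R, hR⟩ := hK.isBounded.subset_closedBall 0
  let r : ℝ := max R 1
  have hr : 0 < r := lt_max_of_lt_right one_pos
  have h1 (x : V) (hx : ‖x‖ ≤ r) : radialBump (r⁻¹ • x) = 1 := by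
    refine radialBump_eq_one ?_
    rw [norm_smul, norm_inv, Real.norm_of_nonneg hr.le, inv_mul_le_iff₀ hr]
    simpa using hx
  refine ⟨fun x => radialBump (r⁻¹ • x), ⟨contDiff_radialBump.comp (contDiff_id.const_smul _),
    ?_, fun g _ x => ?_, ?_⟩, fun x hx => h1 x ?_⟩
  · exact hasCompactSupport_radialBump.comp_homeomorph (Homeomorph.smulOfNeZero r⁻¹ (by positivity))
  · simp [radialBump, norm_smul]
  · filter_upwards [Metric.closedBall_mem_nhds (0 : V) hr] with x hx
    exact h1 x (by simpa using hx)
  · have := hR hx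
    exact (by simpa using this : ‖x‖ ≤ R).trans (le_max_left _ _)

/-- For a relatively closed pair, `χ α + dχ ∧ β` is an equivariant form with compact support. That
it is a smooth equivariant polynomial map is read off from `cutoff_eq_sub`; it does not change
under multiplication by a cutoff function equal to `1` on the support of `χ`. -/
theorem cutoff_mem_eqForms {χ : V → ℝ} (hχ : IsCutoff χ) {α β : EForm V}
    (hα : α ∈ eqForms (smoothForms (⊤ : TopologicalSpace.Opens V)))
    (hβ : β ∈ eqForms (smoothForms (punctured V)))
    (h : restrictPunctured V α = eqDiff (punctured V) β) :
    cutoff χ α β ∈ eqForms (compactForms V) := by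
  have h1 : cutoff χ α β ∈ eqForms (smoothForms (⊤ : TopologicalSpace.Opens V)) := by
    rw [cutoff_eq_sub hχ (fun X => polyMaps_apply_mem hβ.1 X) h]
    exact sub_mem hα (isStable_smoothForms.eqDiff_mem (mulForm_mem_eqForms hχ.one_sub_invariant
      (fun a ha => mulForm_mem_smoothForms_of_punctured hχ.contDiff_one_sub
        hχ.one_sub_eventually ha) hβ))
  obtain ⟨χ', hχ', hχ1⟩ := exists_isCutoff_eq_one hχ.compact.isCompact
  have h2 : (fun X => mulForm χ' (cutoff χ α β X)) = cutoff χ α β := by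
    funext X p x
    change χ' x • cutoff χ α β X p x = _
    by_cases hx : cutoff χ α β X p x = 0
    · rw [hx, smul_zero]
    · rw [hχ1 x (support_cutoff_subset χ α β X p hx), one_smul]
  rw [← h2]
  exact mulForm_mem_eqForms hχ'.invariant
    (fun a ha => mulForm_mem_compactForms hχ'.smooth hχ'.compact ha) h1

/-- For a relatively closed pair, `χ α + dχ ∧ β` is closed. -/
theorem eqDiff_cutoff {χ : V → ℝ} (hχ : IsCutoff χ) {α β : EForm V}
    (hα : α ∈ eqForms (smoothForms (⊤ : TopologicalSpace.Opens V)))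
    (hβ : β ∈ eqForms (smoothForms (punctured V))) (hD : eqDiff ⊤ α = 0)
    (h : restrictPunctured V α = eqDiff (punctured V) β) : eqDiff ⊤ (cutoff χ α β) = 0 := by
  have h1 := mulForm_mem_eqForms hχ.one_sub_invariant
      (fun a ha => mulForm_mem_smoothForms_of_punctured hχ.contDiff_one_sub
        hχ.one_sub_eventually ha) hβ
  have h2 := isStable_smoothForms.eqDiff_mem h1
  rw [cutoff_eq_sub hχ (fun X => polyMaps_apply_mem hβ.1 X) h,
    eqDiff_sub (fun X => polyMaps_apply_mem hα.1 X) (fun X => polyMaps_apply_mem h2.1 X), hD,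
    eqDiff_eqDiff h1, sub_zero]

/-- The integral of a relative class does not depend on the cutoff function: the forms obtained
from two choices differ by the differential of a compactly supported form, namely `β` multiplied by
the difference of the cutoff functions. -/
theorem formIntegral_cutoff_eq {d : ℕ} (e : OrthonormalBasis (Fin d) ℝ V) {χ χ' : V → ℝ}
    (hχ : IsCutoff χ) (hχ' : IsCutoff χ') {α β : EForm V}
    (hα : α ∈ eqForms (smoothForms (⊤ : TopologicalSpace.Opens V)))
    (hβ : β ∈ eqForms (smoothForms (punctured V)))
    (h : restrictPunctured V α = eqDiff (punctured V) β) (X : so V) :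
    formIntegral e (cutoff χ α β X) = formIntegral e (cutoff χ' α β X) := by
  have hβ' (X : so V) : β X ∈ smoothForms (punctured V) := polyMaps_apply_mem hβ.1 X
  have hs {χ : V → ℝ} (hχ : IsCutoff χ) (X : so V) :
      mulForm (fun x => 1 - χ x) (β X) ∈ smoothForms ⊤ :=
    mulForm_mem_smoothForms_of_punctured hχ.contDiff_one_sub hχ.one_sub_eventually (hβ' X)
  have h1 : (fun X => mulForm (fun x => 1 - χ' x) (β X)) -
      (fun X => mulForm (fun x => 1 - χ x) (β X)) =
      fun X => mulForm (fun x => χ x - χ' x) (β X) := by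
    funext X p x
    change (1 - χ' x) • β X p x - (1 - χ x) • β X p x = (χ x - χ' x) • β X p x
    ext v
    simp
    ring
  have h2 : cutoff χ α β = cutoff χ' α β +
      eqDiff ⊤ fun X => mulForm (fun x => χ x - χ' x) (β X) := by
    rw [← h1, eqDiff_sub (hs hχ') (hs hχ), cutoff_eq_sub hχ hβ' h, cutoff_eq_sub hχ' hβ' h]
    abel
  have h3 (X : so V) : mulForm (fun x => χ x - χ' x) (β X) ∈ rapidForms V := by
    refine compactForms_le_rapidForms ⟨mulForm_mem_smoothForms_of_punctured
      (hχ.smooth.sub hχ'.smooth) ?_ (hβ' X), fun p => (hχ.compact.sub hχ'.compact).smul_right⟩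
    filter_upwards [hχ.eq_one, hχ'.eq_one] with x h1 h2
    rw [h1, h2, sub_self]
  rw [h2]
  refine (formIntegral_add e (compactForms_le_rapidForms
    (polyMaps_apply_mem (cutoff_mem_eqForms hχ' hα hβ h).1 X))
    (sub_mem (isStable_rapidForms.dForm_mem _ (h3 X))
      (isStable_rapidForms.contract_mem _ (h3 X) X))).trans ?_
  exact (congrArg (_ + ·) (formIntegral_eqDiff e h3 X)).trans (add_zero _)

end Relative

/-! ### Radial contraction on the complement of the origin -/

section RadialHomotopy

open MeasureTheory Filter

theorem contDiffAt_clm_comp {E F G : Type*} [NormedAddCommGroup E] [NormedSpace ℝ E]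
    [NormedAddCommGroup F] [NormedSpace ℝ F] [NormedAddCommGroup G] [NormedSpace ℝ G]
    (L : F →L[ℝ] G) {f : E → F} {n : WithTop ℕ∞} {x : E} (h : ContDiffAt ℝ n f x) :
    ContDiffAt ℝ n (fun y => L (f y)) x :=
  L.contDiff.contDiffAt.comp x h

theorem contDiffOn_clm_fderiv {E F G : Type*} [NormedAddCommGroup E] [NormedSpace ℝ E]
    [NormedAddCommGroup F] [NormedSpace ℝ F] [NormedAddCommGroup G] [NormedSpace ℝ G]
    (L : (E →L[ℝ] F) →L[ℝ] G) {f : E → F} {U : Set E} (hU : IsOpen U) (h : ContDiffOn ℝ ∞ f U) :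
    ContDiffOn ℝ ∞ (fun y => L (fderiv ℝ f y)) U :=
  L.contDiff.comp_contDiffOn (h.fderiv_of_isOpen hU (m := ∞) (by simp))

/-- A parametric integral over a half-line is smooth if the integrand is smooth in both variables
and vanishes beyond a locally bounded value of the variable of integration. -/
theorem contDiffOn_integral_Ioi {E G : Type*} [NormedAddCommGroup E] [NormedSpace ℝ E]
    [FiniteDimensional ℝ E] [NormedAddCommGroup G] [NormedSpace ℝ G] [CompleteSpace G]
    {F : ℝ → E → G} {U : Set E} (hU : IsOpen U)
    (hF : ∀ s : ℝ, 1 ≤ s → ∀ x ∈ U, ContDiffAt ℝ ∞ (fun q : ℝ × E => F q.1 q.2) (s, x))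
    (hS : ∀ x ∈ U, ∃ u ∈ 𝓝 x, ∃ S : ℝ, ∀ s, S < s → ∀ y ∈ u, F s y = 0) :
    ContDiffOn ℝ ∞ (fun x => ∫ s in Set.Ioi (1 : ℝ), F s x) U ∧
    (∀ x ∈ U, IntegrableOn (fun s => F s x) (Set.Ioi 1)) ∧
    (∀ x ∈ U, IntegrableOn (fun s => fderiv ℝ (F s) x) (Set.Ioi 1)) ∧
    ∀ x ∈ U, HasFDerivAt (fun x => ∫ s in Set.Ioi (1 : ℝ), F s x)
      (∫ s in Set.Ioi (1 : ℝ), fderiv ℝ (F s) x) x := by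
  have : ProperSpace E := FiniteDimensional.proper ℝ E
  have hF' (n : ℕ) (s : ℝ) (hs : 1 ≤ s) (x : E) (hx : x ∈ U) :
      ContinuousAt (fun q : ℝ × E => iteratedFDeriv ℝ n (F q.1) q.2) (s, x) :=
    (contDiffAt_iteratedFDeriv_param n (hF s hs x hx)).continuousAt
  refine contDiffOn_integral (μ := volume.restrict (Set.Ioi (1 : ℝ))) hU ?_ ?_ ?_
  · refine (ae_restrict_mem measurableSet_Ioi).mono fun s hs x hx => ?_
    exact ((hF s (le_of_lt hs) x hx).comp x (f := fun x => (s, x))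
      (by fun_prop)).contDiffWithinAt
  · intro n x hx
    refine ContinuousOn.aestronglyMeasurable (fun s hs => ?_) measurableSet_Ioi
    exact ((hF' n s (le_of_lt hs) x hx).comp (f := fun s : ℝ => (s, x))
      (by fun_prop)).continuousWithinAt
  · intro n x hx
    obtain ⟨u, hu, S, hS⟩ := hS x hx
    obtain ⟨K, hK, hKu, hKc⟩ := local_compact_nhds (Filter.inter_mem hu (hU.mem_nhds hx))
    obtain ⟨C, hC⟩ := ((isCompact_Icc (a := (1 : ℝ)) (b := S)).prod
      hKc).exists_bound_of_continuousOn
      (f := fun q : ℝ × E => iteratedFDeriv ℝ n (F q.1) q.2)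
      (fun q hq => (hF' n q.1 hq.1.1 q.2 (hKu hq.2).2).continuousWithinAt)
    refine ⟨interior K, interior_mem_nhds.2 hK, (Set.Icc (1 : ℝ) S).indicator fun _ => C, ?_, ?_⟩
    · exact ((integrable_indicator_iff measurableSet_Icc).2
        (integrableOn_const (by simp))).restrict
    · refine (ae_restrict_mem measurableSet_Ioi).mono fun s hs y hy => ?_
      by_cases h : s ≤ S
      · rw [Set.indicator_of_mem (s := Set.Icc (1 : ℝ) S) ⟨le_of_lt hs, h⟩]
        exact hC (s, y) ⟨⟨le_of_lt hs, h⟩, interior_subset hy⟩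
      · rw [Set.indicator_of_notMem (s := Set.Icc (1 : ℝ) S) fun h' => h h'.2]
        have h1 : F s =ᶠ[𝓝 y] fun _ => 0 := by
          filter_upwards [mem_interior_iff_mem_nhds.1 hy] with z hz
          exact hS s (not_le.1 h) z (hKu hz).1
        rw [(h1.iteratedFDeriv ℝ n).eq_of_nhds, iteratedFDeriv_fun_zero]
        simp

variable {V : Type*} [NormedAddCommGroup V] [InnerProductSpace ℝ V]

variable (V) in
/-- The smooth forms on `V ∖ {0}` which vanish outside a bounded set. -/
def boundedForms : Submodule ℝ (Form V) where
  carrier := {a | a ∈ smoothForms (punctured V) ∧ ∀ p, ∃ R : ℝ, ∀ x, R < ‖x‖ → a p x = 0}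
  add_mem' := fun ha hb => ⟨add_mem ha.1 hb.1, fun p => by
    obtain ⟨R, hR⟩ := ha.2 p
    obtain ⟨R', hR'⟩ := hb.2 p
    refine ⟨max R R', fun x hx => ?_⟩
    rw [max_lt_iff] at hx
    simp [hR x hx.1, hR' x hx.2]⟩
  zero_mem' := ⟨zero_mem _, fun _ => ⟨0, fun _ _ => rfl⟩⟩
  smul_mem' := fun c a ha => ⟨Submodule.smul_mem _ c ha.1, fun p => by
    obtain ⟨R, hR⟩ := ha.2 p
    exact ⟨R, fun x hx => by simp [hR x hx]⟩⟩

/-- The homotopy operator for forms on `V ∖ {0}` of bounded support, given by contraction along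
the rays `s ↦ s x`, `1 ≤ s`. -/
def radialOp (a : Form V) : Form V := fun p => (punctured V : Set V).indicator fun x =>
  -∫ s in Set.Ioi (1 : ℝ), s ^ p • (a (p + 1) (s • x)).curryLeft x

variable [FiniteDimensional ℝ V] [MeasurableSpace V] [BorelSpace V]

/-- The integral defining `radialOp` is smooth and commutes with the exterior derivative: on a
neighbourhood of `x ≠ 0` the points `s y` leave the support of `a` for large `s`. -/
theorem radialOp_regularity {a : Form V} (ha : a ∈ boundedForms V) (p : ℕ) :
    ContDiffOn ℝ ∞ (fun x => ∫ s in Set.Ioi (1 : ℝ), s ^ p • (a (p + 1) (s • x)).curryLeft x)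
      (punctured V) ∧
    (∀ x ∈ punctured V, IntegrableOn (fun s : ℝ => s ^ p • (a (p + 1) (s • x)).curryLeft x)
      (Set.Ioi 1)) ∧
    ∀ x ∈ punctured V,
      extDeriv (fun x => ∫ s in Set.Ioi (1 : ℝ), s ^ p • (a (p + 1) (s • x)).curryLeft x) x =
        ∫ s in Set.Ioi (1 : ℝ), extDeriv (fun x => s ^ p • (a (p + 1) (s • x)).curryLeft x) x ∧
      IntegrableOn (fun s : ℝ => extDeriv (fun x => s ^ p • (a (p + 1) (s • x)).curryLeft x) x)
        (Set.Ioi 1) := by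
  have hF (s : ℝ) (hs : 1 ≤ s) (x : V) (hx : x ∈ (punctured V : Set V)) : ContDiffAt ℝ ∞
      (fun q : ℝ × V => q.1 ^ p • (a (p + 1) (q.1 • q.2)).curryLeft q.2) (s, x) := by
    have hne : s • x ≠ 0 := smul_ne_zero (by positivity) hx
    have h1 : ContDiffAt ℝ ∞ (fun q : ℝ × V => a (p + 1) (q.1 • q.2)) (s, x) :=
      (smoothForms_contDiffAt ha.1 (p + 1) hne).comp (f := fun q : ℝ × V => q.1 • q.2) (s, x)
        (by fun_prop)
    have h2 : ContDiffAt ℝ ∞ (fun q : ℝ × V => curryLeftCLM V p (a (p + 1) (q.1 • q.2))) (s, x) :=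
      contDiffAt_clm_comp (F := V [⋀^Fin (p + 1)]→L[ℝ] ℝ) (G := V →L[ℝ] V [⋀^Fin p]→L[ℝ] ℝ)
        (curryLeftCLM V p) h1
    have h3 : ContDiffAt ℝ ∞ (fun q : ℝ × V => curryLeftCLM V p (a (p + 1) (q.1 • q.2)) q.2)
      (s, x) := h2.clm_apply contDiffAt_snd
    exact (contDiffAt_fst.pow p).smul h3
  have hS (x : V) (hx : x ∈ (punctured V : Set V)) : ∃ u ∈ 𝓝 x, ∃ S : ℝ, ∀ s, S < s → ∀ y ∈ u,
      s ^ p • (a (p + 1) (s • y)).curryLeft y = 0 := by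
    obtain ⟨R, hR⟩ := ha.2 (p + 1)
    have hx0 : 0 < ‖x‖ := norm_pos_iff.2 hx
    refine ⟨{y | ‖x‖ / 2 < ‖y‖}, (isOpen_lt continuous_const continuous_norm).mem_nhds
      (half_lt_self hx0), |R| / (‖x‖ / 2), fun s hs y hy => ?_⟩
    have hy' : ‖x‖ / 2 < ‖y‖ := hy
    have hs0 : 0 < s := lt_of_le_of_lt (by positivity) hs
    have h1 : R < ‖s • y‖ := by
      rw [norm_smul, Real.norm_of_nonneg hs0.le]
      rw [div_lt_iff₀ (by positivity)] at hs
      calc R ≤ |R| := le_abs_self R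
        _ < s * (‖x‖ / 2) := hs
        _ ≤ s * ‖y‖ := by gcongr
    simp [hR _ h1]
  obtain ⟨c1, c2, c3, c4⟩ := contDiffOn_integral_Ioi (G := V [⋀^Fin p]→L[ℝ] ℝ)
    (F := fun (s : ℝ) (x : V) => s ^ p • (a (p + 1) (s • x)).curryLeft x)
    (punctured V).isOpen hF hS
  refine ⟨c1, c2, fun x hx => ?_⟩
  exact clm_fderiv_eq_integral (G := V [⋀^Fin p]→L[ℝ] ℝ) (H := V [⋀^Fin (p + 1)]→L[ℝ] ℝ)
    (ContinuousAlternatingMap.alternatizeUncurryFinCLM ℝ V ℝ (n := p)) (c4 x hx) (c3 x hx)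

theorem radialOp_mem {a : Form V} (ha : a ∈ boundedForms V) :
    radialOp a ∈ smoothForms (punctured V) := by
  intro p
  refine ⟨(radialOp_regularity ha p).1.neg.congr fun x hx => ?_, fun x hx => ?_⟩
  · exact Set.indicator_of_mem (s := (punctured V : Set V)) hx _
  · exact Set.indicator_of_notMem (s := (punctured V : Set V)) hx _

theorem radialOp_apply (a : Form V) (p : ℕ) {x : V} (hx : x ∈ punctured V) :
    radialOp a p x = -∫ s in Set.Ioi (1 : ℝ), s ^ p • (a (p + 1) (s • x)).curryLeft x :=
  Set.indicator_of_mem (s := (punctured V : Set V)) hx _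

theorem radialOp_apply_zero (a : Form V) (p : ℕ) {x : V} (hx : x ∉ punctured V) :
    radialOp a p x = 0 :=
  Set.indicator_of_notMem (s := (punctured V : Set V)) hx _

theorem radialOp_add {a b : Form V} (ha : a ∈ boundedForms V) (hb : b ∈ boundedForms V) :
    radialOp (a + b) = radialOp a + radialOp b := by
  funext p x
  by_cases hx : x ∈ punctured V
  · have h := integral_add ((radialOp_regularity ha p).2.1 x hx)
      ((radialOp_regularity hb p).2.1 x hx)
    simp only [Pi.add_apply, radialOp_apply _ _ hx, ContinuousAlternatingMap.curryLeft_add,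
      smul_add, add_apply] at h ⊢
    rw [h]
    abel
  · simp [radialOp_apply_zero _ _ hx]

theorem radialOp_smul (c : ℝ) (a : Form V) : radialOp (c • a) = c • radialOp a := by
  funext p x
  by_cases hx : x ∈ punctured V
  · simp only [Pi.smul_apply, radialOp_apply _ _ hx, smul_neg, ← integral_smul,
      ContinuousAlternatingMap.curryLeft_smul, smul_apply, smul_comm c]
  · simp [radialOp_apply_zero _ _ hx]

theorem dForm_mem_punctured {a : Form V} (ha : a ∈ smoothForms (punctured V)) :
    dForm (punctured V) a ∈ smoothForms (punctured V) := by
  intro p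
  cases p with
  | zero => exact ⟨contDiffOn_const, fun _ _ => rfl⟩
  | succ p =>
    refine ⟨?_, fun x hx => Set.indicator_of_notMem (s := (punctured V : Set V)) hx _⟩
    refine (contDiffOn_clm_fderiv (F := V [⋀^Fin p]→L[ℝ] ℝ) (G := V [⋀^Fin (p + 1)]→L[ℝ] ℝ)
      (ContinuousAlternatingMap.alternatizeUncurryFinCLM ℝ V ℝ (n := p))
      (punctured V).isOpen (ha p).1).congr fun x hx => ?_
    exact Set.indicator_of_mem (s := (punctured V : Set V)) hx _

theorem dForm_mem_boundedForms {a : Form V} (ha : a ∈ boundedForms V) :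
    dForm (punctured V) a ∈ boundedForms V := by
  refine ⟨dForm_mem_punctured ha.1, fun p => ?_⟩
  cases p with
  | zero => exact ⟨0, fun _ _ => rfl⟩
  | succ p =>
    obtain ⟨R, hR⟩ := ha.2 p
    refine ⟨R, fun x hx => ?_⟩
    by_cases h0 : x ∈ (punctured V : Set V)
    · refine (Set.indicator_of_mem h0 _).trans ?_
      refine (extDeriv_eq_of_eventuallyEq ?_).trans (extDeriv_fun_const 0 x)
      filter_upwards [(isOpen_lt continuous_const continuous_norm).mem_nhds hx] with y hy
      exact hR y hy
    · exact Set.indicator_of_notMem h0 _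

/-- The pullback of a `p`-form by the dilation `s` is multiplication by `s ^ p`. -/
theorem smul_compContinuousLinearMap_smul_id {p : ℕ} (s : ℝ) (f : V [⋀^Fin p]→L[ℝ] ℝ) :
    f.compContinuousLinearMap (s • ContinuousLinearMap.id ℝ V) = s ^ p • f := by
  ext v
  have h := f.toMultilinearMap.map_smul_univ (fun _ => s) v
  simp only [Finset.prod_const, Finset.card_univ, Fintype.card_fin] at h
  exact h

/-- `d h + h d = 1` for the radial homotopy operator `h`. -/
theorem dForm_radialOp {a : Form V} (ha : a ∈ boundedForms V) :
    dForm (punctured V) (radialOp a) + radialOp (dForm (punctured V) a) = a := by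
  funext p x
  change dForm (punctured V) (radialOp a) p x + radialOp (dForm (punctured V) a) p x = a p x
  by_cases hx : x ∈ punctured V
  swap
  · rw [radialOp_apply_zero _ _ hx, (ha.1 p).2 x hx,
      ((dForm_mem_punctured (radialOp_mem ha)) p).2 x hx, add_zero]
  have hx0 : x ≠ 0 := hx
  have hsx (s : ℝ) (hs : 1 ≤ s) : s • x ≠ 0 := smul_ne_zero (by positivity) hx0
  have hdiff (s : ℝ) (hs : 1 ≤ s) : DifferentiableAt ℝ (a p) (s • x) :=
    (smoothForms_contDiffAt ha.1 p (hsx s hs)).differentiableAt (by simp)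
  have hdapp (s : ℝ) (hs : 1 ≤ s) :
      dForm (punctured V) a (p + 1) (s • x) = extDeriv (a p) (s • x) :=
    Set.indicator_of_mem (s := (punctured V : Set V)) (hsx s hs) _
  have hA (s : ℝ) : HasDerivAt (fun s : ℝ => s • ContinuousLinearMap.id ℝ V)
      (ContinuousLinearMap.id ℝ V) s := by
    simpa using (hasDerivAt_id s).smul_const (ContinuousLinearMap.id ℝ V)
  obtain ⟨i1, i2, i3⟩ := radialOp_regularity (dForm_mem_boundedForms ha) p
  -- The pullback of `a` by the dilation `s` is eventually zero, so integrating its derivative over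
  -- `1 < s` gives `-a`.
  have hlim : Tendsto (fun s : ℝ => s ^ p • a p (s • x)) atTop (𝓝 0) := by
    obtain ⟨R, hR⟩ := ha.2 p
    refine tendsto_const_nhds.congr' ?_
    filter_upwards [eventually_gt_atTop (|R| / ‖x‖)] with s hs
    have hs0 : 0 < s := lt_of_le_of_lt (by positivity) hs
    rw [div_lt_iff₀ (norm_pos_iff.2 hx0)] at hs
    rw [hR (s • x) (by
      rw [norm_smul, Real.norm_of_nonneg hs0.le]
      exact (le_abs_self R).trans_lt hs), smul_zero]
  have hpull : (fun s : ℝ => (a p ((s • ContinuousLinearMap.id ℝ V) x +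
      (0 : V))).compContinuousLinearMap (s • ContinuousLinearMap.id ℝ V)) =
      fun s => s ^ p • a p (s • x) := by
    funext s
    rw [smul_compContinuousLinearMap_smul_id]
    simp
  -- The contribution of `h d` to the derivative along the ray.
  have hcontr (s : ℝ) (hs : 1 ≤ s) : ((extDeriv (a p) ((s • ContinuousLinearMap.id ℝ V) x +
      (0 : V))).curryLeft (ContinuousLinearMap.id ℝ V x + 0)).compContinuousLinearMap
      (s • ContinuousLinearMap.id ℝ V) =
      s ^ p • (dForm (punctured V) a (p + 1) (s • x)).curryLeft x := by
    rw [smul_compContinuousLinearMap_smul_id, hdapp s hs]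
    simp
  -- The contribution of `d h`, which is absent in degree zero.
  have hdh : ∃ Φ : ℝ → V [⋀^Fin p]→L[ℝ] ℝ, IntegrableOn Φ (Set.Ioi 1) ∧
      dForm (punctured V) (radialOp a) p x = -∫ s in Set.Ioi (1 : ℝ), Φ s ∧
      ∀ s : ℝ, 1 ≤ s → HasDerivAt (fun s : ℝ => s ^ p • a p (s • x))
        (Φ s + s ^ p • (dForm (punctured V) a (p + 1) (s • x)).curryLeft x) s := by
    rcases p with - | p
    · refine ⟨fun _ => 0, (integrable_zero ℝ (V [⋀^Fin 0]→L[ℝ] ℝ) _ :),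
        by simp [dForm], fun s hs => ?_⟩
      have h := hasDerivAt_pullback_affine_zero (a := a 0) (x := x) (hA s)
        (hasDerivAt_const s (0 : V)) (by simpa using hdiff s hs)
      rw [hpull, hcontr s hs] at h
      rw [zero_add]
      exact h
    · obtain ⟨-, -, j3⟩ := radialOp_regularity ha p
      refine ⟨_, (j3 x hx).2, ?_, fun s hs => ?_⟩
      · rw [← (j3 x hx).1]
        refine (Set.indicator_of_mem (s := (punctured V : Set V)) hx _).trans ?_
        have h1 : radialOp a p =ᶠ[𝓝 x] fun x => (-1 : ℝ) •
            ∫ s in Set.Ioi (1 : ℝ), s ^ p • (a (p + 1) (s • x)).curryLeft x := by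
          filter_upwards [(punctured V).isOpen.mem_nhds hx] with y hy
          rw [radialOp_apply a p hy]
          exact (neg_one_smul ℝ _).symm
        rw [extDeriv_eq_of_eventuallyEq h1]
        exact (extDeriv_smul (-1 : ℝ) _).trans (neg_one_smul ℝ _)
      · have h := hasDerivAt_pullback_affine (a := a (p + 1)) (x := x) (hA s)
          (hasDerivAt_const s (0 : V)) (by simpa using hdiff s hs)
        rw [hpull, hcontr s hs] at h
        refine h.congr_deriv ?_
        congr 2
        funext y
        rw [smul_compContinuousLinearMap_smul_id]
        simp
  obtain ⟨Φ, hΦ, hd, hder⟩ := hdh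
  have hFTC := integral_Ioi_of_hasDerivAt_of_tendsto (a := 1)
    (hder 1 le_rfl).continuousAt.continuousWithinAt (fun s hs => hder s (le_of_lt hs))
    (hΦ.add (i2 x hx)) hlim
  have hsum := integral_add hΦ (i2 x hx)
  rw [hsum] at hFTC
  rw [hd, radialOp_apply _ _ hx, ← neg_add, hFTC]
  simp

/-- The radial homotopy operator anticommutes with contraction by the linear vector field `VX`. -/
theorem radialOp_contract {a : Form V} (ha : a ∈ boundedForms V) (X : so V) :
    radialOp (contract (vecField X) a) = -contract (vecField X) (radialOp a) := by
  funext p x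
  by_cases hx : x ∈ punctured V
  swap
  · simp [radialOp_apply_zero _ _ hx, contract]
  have i1 := (radialOp_regularity ha (p + 1)).2.1 x hx
  have h1 := (((curryLeftCLM V p).flip (vecField X x))).integral_comp_comm
    (E := V [⋀^Fin (p + 1)]→L[ℝ] ℝ) i1
  change radialOp (contract (vecField X) a) p x = -(radialOp a (p + 1) x).curryLeft (vecField X x)
  rw [radialOp_apply _ _ hx, radialOp_apply _ _ hx]
  have h2 : (-∫ s in Set.Ioi (1 : ℝ), s ^ (p + 1) • (a (p + 1 + 1) (s • x)).curryLeft x).curryLeft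
      (vecField X x) = -((∫ s in Set.Ioi (1 : ℝ), s ^ (p + 1) •
        (a (p + 1 + 1) (s • x)).curryLeft x).curryLeft (vecField X x)) := by
    ext v
    simp
  rw [h2, neg_neg]
  refine Eq.trans ?_ h1
  rw [← integral_neg]
  refine integral_congr_ae (Eventually.of_forall fun s => ?_)
  ext v
  -- Linearity of `VX` supplies the missing factor `s`, and exchanging the two contractions the
  -- sign.
  have h3 : vecField X (s • x) = s • vecField X x := by simp [vecField]
  have h4 := (a (p + 2) (s • x)).toAlternatingMap.map_swap
    (Matrix.vecCons (vecField X x) (Matrix.vecCons x v)) (i := 0) (j := 1) (by simp)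
  have h5 : (Matrix.vecCons (vecField X x) (Matrix.vecCons x v)) ∘ Equiv.swap (0 : Fin (p + 2)) 1 =
      Matrix.vecCons x (Matrix.vecCons (vecField X x) v) := by
    funext i
    refine Fin.cases ?_ (fun i => Fin.cases ?_ (fun i => ?_) i) i
    · simp
    · simp
    · have : Equiv.swap (0 : Fin (p + 2)) 1 i.succ.succ = i.succ.succ :=
        Equiv.swap_apply_of_ne_of_ne (by simp [Fin.ext_iff]) (by simp [Fin.ext_iff])
      simp [this]
  rw [h5] at h4
  change -(s ^ p * (((a (p + 2) (s • x)).curryLeft (vecField X (s • x))).curryLeft x) v) =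
    s ^ (p + 1) * a (p + 2) (s • x) (Matrix.vecCons x (Matrix.vecCons (vecField X x) v))
  rw [h3]
  have h6 : (((a (p + 2) (s • x)).curryLeft (s • vecField X x)).curryLeft x) v =
      s * a (p + 2) (s • x) (Matrix.vecCons (vecField X x) (Matrix.vecCons x v)) := by
    rw [map_smul]
    rfl
  have h7 : a (p + 2) (s • x) (Matrix.vecCons x (Matrix.vecCons (vecField X x) v)) =
    -a (p + 2) (s • x) (Matrix.vecCons (vecField X x) (Matrix.vecCons x v)) := h4
  rw [h6, h7]
  ring

theorem IsEquivariant.radialOp {α : EForm V} (hα : IsEquivariant α)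
    (hb : ∀ X, α X ∈ boundedForms V) : IsEquivariant fun X => radialOp (α X) := by
  intro g hg X p x v
  change EquivariantThom.radialOp (α (Ad g X)) p (g x) (fun i => g (v i)) =
    EquivariantThom.radialOp (α X) p x v
  by_cases hx : x ∈ punctured V
  · have hgx : g x ∈ punctured V := fun h => hx (g.map_eq_zero_iff.1 h)
    have hcons (y : V) : (Matrix.vecCons (g y) fun i => g (v i)) =
        fun i => g (Matrix.vecCons y v i) := by
      funext i
      refine Fin.cases ?_ (fun j => ?_) i <;> simp
    rw [radialOp_apply _ _ hx, radialOp_apply _ _ hgx, ContinuousAlternatingMap.neg_apply,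
      ContinuousAlternatingMap.neg_apply,
      integral_form_apply ((radialOp_regularity (hb X) p).2.1 x hx),
      integral_form_apply ((radialOp_regularity (hb (Ad g X)) p).2.1 (g x) hgx)]
    simp only [← map_smul g, ContinuousAlternatingMap.smul_apply,
      ContinuousAlternatingMap.curryLeft_apply_apply, hcons, hα g hg X]
  · have hgx : g x ∉ punctured V := fun h => hx fun h' => h (by simp_all)
    rw [radialOp_apply_zero _ _ hx, radialOp_apply_zero _ _ hgx]
    rfl

/-- A closed equivariant form of bounded support on `V ∖ {0}` is exact. -/
theorem exists_eqDiff_eq_of_bounded {β : EForm V} (hβ : β ∈ eqForms (boundedForms V))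
    (hD : eqDiff (punctured V) β = 0) :
    ∃ κ ∈ eqForms (smoothForms (punctured V)), eqDiff (punctured V) κ = β := by
  have hb (X : so V) : β X ∈ boundedForms V := polyMaps_apply_mem hβ.1 X
  refine ⟨fun X => radialOp (β X), ⟨polyMaps_map (𝓐 := boundedForms V) radialOp
    (fun a ha b hb => radialOp_add ha hb) (fun c a _ => radialOp_smul c a)
    (fun a ha => radialOp_mem ha) hβ.1, IsEquivariant.radialOp hβ.2 hb⟩, ?_⟩
  funext X
  have h1 : dForm (punctured V) (β X) = contract (vecField X) (β X) :=
    sub_eq_zero.1 (congrFun hD X)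
  have h2 := dForm_radialOp (hb X)
  rw [h1, radialOp_contract (hb X)] at h2
  rw [← sub_eq_add_neg] at h2
  exact h2

end RadialHomotopy

/-! ### Relative cohomology -/

section RelativeCohomology

open MeasureTheory Filter

variable {V : Type*} [NormedAddCommGroup V] [InnerProductSpace ℝ V] [FiniteDimensional ℝ V]
  [MeasurableSpace V] [BorelSpace V]

theorem dWedge_add (f : V → ℝ) (a b : Form V) : dWedge f (a + b) = dWedge f a + dWedge f b := by
  funext p x
  cases p with
  | zero => simp [dWedge]
  | succ p =>
    have h : (fderiv ℝ f x).smulRight ((a + b) p x) =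
        (fderiv ℝ f x).smulRight (a p x) + (fderiv ℝ f x).smulRight (b p x) := by
      ext w v
      simp
    exact (congrArg ContinuousAlternatingMap.alternatizeUncurryFin h).trans
      (ContinuousAlternatingMap.alternatizeUncurryFin_add _ _)

theorem dWedge_smul (f : V → ℝ) (c : ℝ) (a : Form V) : dWedge f (c • a) = c • dWedge f a := by
  funext p x
  cases p with
  | zero => simp [dWedge]
  | succ p =>
    have h : (fderiv ℝ f x).smulRight ((c • a) p x) = c • (fderiv ℝ f x).smulRight (a p x) := by
      ext w v
      simp
      ring
    exact (congrArg ContinuousAlternatingMap.alternatizeUncurryFin h).trans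
      (ContinuousAlternatingMap.alternatizeUncurryFin_smul _ _)

theorem cutoff_add (χ : V → ℝ) (α β α' β' : EForm V) :
    cutoff χ (α + α') (β + β') = cutoff χ α β + cutoff χ α' β' := by
  funext X
  have h1 := mulForm_add χ (α X) (α' X)
  have h2 := dWedge_add χ (β X) (β' X)
  change mulForm χ (α X + α' X) + dWedge χ (β X + β' X) =
    mulForm χ (α X) + dWedge χ (β X) + (mulForm χ (α' X) + dWedge χ (β' X))
  rw [h1, h2]
  abel

theorem cutoff_smul (χ : V → ℝ) (c : so V → ℝ) (α β : EForm V) :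
    cutoff χ (fun X => c X • α X) (fun X => c X • β X) = fun X => c X • cutoff χ α β X := by
  funext X
  have h1 := mulForm_smul χ (c X) (α X)
  have h2 := dWedge_smul χ (c X) (β X)
  change mulForm χ (c X • α X) + dWedge χ (c X • β X) =
    c X • (mulForm χ (α X) + dWedge χ (β X))
  rw [h1, h2, smul_add]

theorem mem_ker_relD {z : RelForms V} : z ∈ LinearMap.ker (relD V) ↔
    eqDiff ⊤ (z.1 : EForm V) = 0 ∧
      restrictPunctured V (z.1 : EForm V) = eqDiff (punctured V) (z.2 : EForm V) := by
  rw [LinearMap.mem_ker]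
  change (eqDiff ⊤ (z.1 : EForm V), restrictPunctured V (z.1 : EForm V) -
    eqDiff (punctured V) (z.2 : EForm V)) = 0 ↔ _
  rw [Prod.mk_eq_zero, sub_eq_zero]

/-- The cochain map `(α, β) ↦ χ α + dχ ∧ β` from relatively closed pairs to compactly supported
equivariant forms. -/
def cutoffMap {χ : V → ℝ} (hχ : IsCutoff χ) :
    LinearMap.ker (relD V) →ₗ[InvPoly V] eqForms (compactForms V) where
  toFun z := ⟨cutoff χ (z.1.1 : EForm V) (z.1.2 : EForm V),
    cutoff_mem_eqForms hχ z.1.1.2 z.1.2.2 (mem_ker_relD.1 z.2).2⟩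
  map_add' _ _ := Subtype.ext (cutoff_add χ _ _ _ _)
  map_smul' r _ := Subtype.ext (cutoff_smul χ r.toFun _ _)

theorem eqDiff_restrictPunctured (α : EForm V) :
    eqDiff (punctured V) (restrictPunctured V α) = restrictPunctured V (eqDiff ⊤ α) := by
  funext X p x
  by_cases hx : x ∈ (punctured V : Set V)
  · have hr (a : EForm V) (p : ℕ) : restrictPunctured V a X p x = a X p x :=
      Set.indicator_of_mem hx _
    rw [hr]
    change dForm (punctured V) (restrictPunctured V α X) p x -
      (restrictPunctured V α X (p + 1) x).curryLeft (vecField X x) =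
      dForm ⊤ (α X) p x - (α X (p + 1) x).curryLeft (vecField X x)
    rw [hr]
    congr 1
    cases p with
    | zero => rfl
    | succ p =>
      rw [dForm_top_succ]
      refine (Set.indicator_of_mem hx _).trans (extDeriv_eq_of_eventuallyEq ?_)
      filter_upwards [(punctured V).isOpen.mem_nhds hx] with y hy
      exact Set.indicator_of_mem hy _
  · have hr (a : EForm V) (p : ℕ) : restrictPunctured V a X p x = 0 :=
      Set.indicator_of_notMem hx _
    rw [hr]
    change dForm (punctured V) (restrictPunctured V α X) p x -
      (restrictPunctured V α X (p + 1) x).curryLeft (vecField X x) = 0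
    have h1 : dForm (punctured V) (restrictPunctured V α X) p x = 0 := by
      cases p with
      | zero => rfl
      | succ p => exact Set.indicator_of_notMem hx _
    rw [hr, h1]
    simp

theorem restrict_mem_boundedForms {a : Form V} (ha : a ∈ compactForms V) :
    (fun p => (punctured V : Set V).indicator (a p)) ∈ boundedForms V := by
  refine ⟨fun p => ⟨?_, fun x hx => Set.indicator_of_notMem hx _⟩, fun p => ?_⟩
  · exact ((mem_compactForms.1 ha p).1.contDiffOn).congr fun x hx => Set.indicator_of_mem hx _
  · obtain ⟨R, hR⟩ := (ha.2 p).isCompact.isBounded.subset_closedBall 0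
    refine ⟨R, fun x hx => ?_⟩
    have h0 : a p x = 0 :=
      image_eq_zero_of_notMem_tsupport fun h => (hx.trans_le (by simpa using hR h)).false
    by_cases h : x ∈ (punctured V : Set V)
    · exact (Set.indicator_of_mem h _).trans h0
    · exact Set.indicator_of_notMem h _

theorem IsEquivariant.restrictPunctured {α : EForm V} (hα : IsEquivariant α) :
    IsEquivariant (restrictPunctured V α) := by
  intro g hg X p x v
  by_cases hx : x = 0
  · have h1 : EquivariantThom.restrictPunctured V α (Ad g X) p (g x) = 0 :=
      Set.indicator_of_notMem (s := (punctured V : Set V)) (fun h => h (by simp [hx])) _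
    have h2 : EquivariantThom.restrictPunctured V α X p x = 0 :=
      Set.indicator_of_notMem (s := (punctured V : Set V)) (fun h => h hx) _
    rw [h1, h2]
    rfl
  · have h1 : EquivariantThom.restrictPunctured V α (Ad g X) p (g x) = α (Ad g X) p (g x) :=
      Set.indicator_of_mem (s := (punctured V : Set V))
        (fun h => hx (g.map_eq_zero_iff.1 h)) _
    have h2 : EquivariantThom.restrictPunctured V α X p x = α X p x :=
      Set.indicator_of_mem (s := (punctured V : Set V)) hx _
    rw [h1, h2]
    exact hα g hg X p x v

theorem restrict_mem_eqForms {α : EForm V} (hα : α ∈ eqForms (compactForms V)) :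
    restrictPunctured V α ∈ eqForms (boundedForms V) :=
  ⟨polyMaps_map (𝓐 := compactForms V) (fun a p => (punctured V : Set V).indicator (a p))
    (fun _ _ _ _ => funext fun _ => Set.indicator_add _ _ _)
    (fun c a _ => funext fun p => Set.indicator_const_smul _ c (a p))
    (fun _ ha => restrict_mem_boundedForms ha) hα.1,
    IsEquivariant.restrictPunctured hα.2⟩

theorem mulForm_mem_boundedForms {χ : V → ℝ} (hχ : IsCutoff χ) {a : Form V}
    (ha : a ∈ smoothForms (punctured V)) : mulForm χ a ∈ boundedForms V := by
  refine ⟨mulForm_mem_punctured hχ.smooth ha, fun p => ?_⟩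
  obtain ⟨R, hR⟩ := hχ.compact.isCompact.isBounded.subset_closedBall 0
  refine ⟨R, fun x hx => ?_⟩
  have h0 : χ x = 0 :=
    image_eq_zero_of_notMem_tsupport fun h => (hx.trans_le (by simpa using hR h)).false
  simp [mulForm, h0]

/-- A form vanishing at `0` is the extension by zero of its restriction. -/
theorem restrictPunctured_mulForm {χ : V → ℝ} (hχ : IsCutoff χ) (β : EForm V) :
    restrictPunctured V (fun X => mulForm (fun x => 1 - χ x) (β X)) =
      fun X => mulForm (fun x => 1 - χ x) (β X) := by
  funext X p
  refine Set.indicator_eq_self.2 fun x hx h0 => hx ?_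
  have h1 : x = 0 := h0
  subst h1
  simp [mulForm, hχ.eq_one.self_of_nhds]

/-- If `(α, β)` is relatively closed and `χ α + dχ ∧ β` is the differential of a compactly
supported form, then `(α, β)` is relatively exact. -/
theorem exists_relD_eq {χ : V → ℝ} (hχ : IsCutoff χ) {α β ψ : EForm V}
    (hβ : β ∈ eqForms (smoothForms (punctured V)))
    (h : restrictPunctured V α = eqDiff (punctured V) β)
    (hψ : ψ ∈ eqForms (compactForms V)) (hDψ : eqDiff ⊤ ψ = cutoff χ α β) :
    ∃ w : RelForms V, relD V w = (α, β) := by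
  have hψ' : ψ ∈ eqForms (smoothForms (⊤ : TopologicalSpace.Opens V)) :=
    eqForms_mono compactForms_le hψ
  have h1 := mulForm_mem_eqForms hχ.one_sub_invariant
      (fun a ha => mulForm_mem_smoothForms_of_punctured hχ.contDiff_one_sub
        hχ.one_sub_eventually ha) hβ
  -- By `cutoff_eq_sub`, `α = D(ψ + (1 - χ) β)`. The defect `β - (ψ + (1 - χ) β) = χ β - ψ` is
  -- closed on `V ∖ {0}` and has bounded support.
  let α' : EForm V := ψ + fun X => mulForm (fun x => 1 - χ x) (β X)
  have hα' : α' ∈ eqForms (smoothForms (⊤ : TopologicalSpace.Opens V)) := add_mem hψ' h1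
  have hDα' : eqDiff ⊤ α' = α := by
    rw [eqDiff_add (fun X => polyMaps_apply_mem hψ'.1 X) (fun X => polyMaps_apply_mem h1.1 X), hDψ,
      cutoff_eq_sub hχ (fun X => polyMaps_apply_mem hβ.1 X) h, sub_add_cancel]
  have h2 : β - restrictPunctured V α' =
      (fun X => mulForm χ (β X)) - restrictPunctured V ψ := by
    have h3 : restrictPunctured V α' = restrictPunctured V ψ +
        fun X => mulForm (fun x => 1 - χ x) (β X) := by
      rw [← restrictPunctured_mulForm hχ β]
      exact map_add (restrictPunctured V) _ _
    have h4 : (fun X => mulForm χ (β X)) = β - fun X => mulForm (fun x => 1 - χ x) (β X) := by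
      funext X p x
      change χ x • β X p x = β X p x - (1 - χ x) • β X p x
      ext v
      simp
      ring
    rw [h3, h4]
    abel
  have h5 : β - restrictPunctured V α' ∈ eqForms (boundedForms V) := by
    rw [h2]
    exact sub_mem (mulForm_mem_eqForms hχ.invariant
      (fun a ha => mulForm_mem_boundedForms hχ ha) hβ) (restrict_mem_eqForms hψ)
  have h6 (X : so V) : restrictPunctured V α' X ∈ smoothForms (punctured V) := fun p =>
    ⟨(mem_smoothForms_top.1 (polyMaps_apply_mem hα'.1 X) p).contDiffOn.congr
      fun x hx => Set.indicator_of_mem hx _, fun x hx => Set.indicator_of_notMem hx _⟩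
  have h7 : eqDiff (punctured V) (β - restrictPunctured V α') = 0 := by
    rw [eqDiff_sub (fun X => polyMaps_apply_mem hβ.1 X) h6, eqDiff_restrictPunctured, hDα', h,
      sub_self]
  obtain ⟨κ, hκ, hκ'⟩ := exists_eqDiff_eq_of_bounded h5 h7
  refine ⟨(⟨α', hα'⟩, -⟨κ, hκ⟩), ?_⟩
  change (eqDiff ⊤ α', restrictPunctured V α' - eqDiff (punctured V) (-κ)) = (α, β)
  rw [hDα', eqDiff_neg, hκ']
  simp

/-- The integral of a relatively exact pair vanishes: if it is the differential of a pair `w`, then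
`χ α + dχ ∧ β` is the differential of the compactly supported form attached in the same way to `w`.
-/
theorem formIntegral_cutoff_relD {d : ℕ} (e : OrthonormalBasis (Fin d) ℝ V) {χ : V → ℝ}
    (hχ : IsCutoff χ) {α β : EForm V} {w : RelForms V} (hw : relD V w = (α, β))
    (hβ : β ∈ eqForms (smoothForms (punctured V)))
    (h : restrictPunctured V α = eqDiff (punctured V) β) (X : so V) :
    formIntegral e (cutoff χ α β X) = 0 := by
  obtain ⟨⟨α', hα'⟩, ⟨β', hβ'⟩⟩ := w
  have hw1 : eqDiff ⊤ α' = α := congrArg Prod.fst hw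
  have hw2 : restrictPunctured V α' - eqDiff (punctured V) β' = β := congrArg Prod.snd hw
  have hm {β : EForm V} (hβ : β ∈ eqForms (smoothForms (punctured V))) :
      (fun X => mulForm (fun x => 1 - χ x) (β X)) ∈
        eqForms (smoothForms (⊤ : TopologicalSpace.Opens V)) :=
    mulForm_mem_eqForms hχ.one_sub_invariant
      (fun a ha => mulForm_mem_smoothForms_of_punctured hχ.contDiff_one_sub
        hχ.one_sub_eventually ha) hβ
  have hs {α : EForm V} (hα : α ∈ eqForms (smoothForms (⊤ : TopologicalSpace.Opens V))) (X : so V) :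
      α X ∈ smoothForms (⊤ : TopologicalSpace.Opens V) := polyMaps_apply_mem hα.1 X
  have hβs (X : so V) : β X ∈ smoothForms (punctured V) := polyMaps_apply_mem hβ.1 X
  have hβs' (X : so V) : β' X ∈ smoothForms (punctured V) := polyMaps_apply_mem hβ'.1 X
  have hDm := isStable_smoothForms.eqDiff_mem (hm hβ')
  have h1 : cutoff χ α' β' = α' - (fun X => mulForm (fun x => 1 - χ x) (β X)) -
      eqDiff ⊤ fun X => mulForm (fun x => 1 - χ x) (β' X) := by
    rw [eqDiff_mulForm hχ.contDiff_one_sub hχ.one_sub_eventually hβs', ← hw2]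
    funext X p x
    have h3 : (1 - χ x) • restrictPunctured V α' X p x = (1 - χ x) • α' X p x := by
      by_cases hx : x = 0
      · subst hx
        simp [hχ.eq_one.self_of_nhds]
      · change (1 - χ x) • (punctured V : Set V).indicator (α' X p) x = _
        rw [Set.indicator_of_mem hx]
    change χ x • α' X p x + dWedge χ (β' X) p x = α' X p x -
      (1 - χ x) • (restrictPunctured V α' X p x - eqDiff (punctured V) β' X p x) -
      ((1 - χ x) • eqDiff (punctured V) β' X p x + dWedge (fun x => 1 - χ x) (β' X) p x)
    have h4 : (1 - χ x) • (restrictPunctured V α' X p x - eqDiff (punctured V) β' X p x) =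
      (1 - χ x) • α' X p x - (1 - χ x) • eqDiff (punctured V) β' X p x := by
      rw [← h3]
      exact smul_sub _ _ _
    rw [h4, dWedge_one_sub]
    ext v
    simp
    ring
  have h2 : eqDiff ⊤ (cutoff χ α' β') = cutoff χ α β := by
    rw [h1, eqDiff_sub (hs (sub_mem hα' (hm hβ))) (hs hDm),
      eqDiff_sub (hs hα') (hs (hm hβ)), eqDiff_eqDiff (hm hβ'), hw1, cutoff_eq_sub hχ hβs h,
      sub_zero]
  rw [← h2]
  refine formIntegral_eqDiff e (fun X => compactForms_le_rapidForms ⟨?_, fun p => ?_⟩) X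
  · rw [h1]
    exact sub_mem (sub_mem (hs hα' X) (hs (hm hβ) X)) (hs hDm X)
  · exact hχ.compact.mono' (support_cutoff_subset χ α' β' X p)

/-- The relative cohomology is freely generated by any class of integral `1`. -/
theorem relative_cohomology {d : ℕ} (e : OrthonormalBasis (Fin d) ℝ V)
    {m : LinearMap.ker (relD V)}
    (hm : ∀ X, formIntegral e (cutoff radialBump (relIncl V m).1 (relIncl V m).2 X) = 1) :
    IsFreeGenerator (InvPoly V) (relClass V m) ∧
    ∃ I : HRel V →ₗ[InvPoly V] InvPoly V,
      (∀ (z : LinearMap.ker (relD V)) (χ : V → ℝ), IsCutoff χ → ∀ X : so V,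
        (I (relClass V z)).toFun X =
          formIntegral e (cutoff χ (relIncl V z).1 (relIncl V z).2 X)) ∧
      ∀ a : HRel V, I a = 1 ↔ a = relClass V m := by
  let J : LinearMap.ker (relD V) →ₗ[InvPoly V] InvPoly V :=
    integralMap compactForms_le_rapidForms e ∘ₗ cutoffMap isCutoff_radialBump
  have hJ (z : LinearMap.ker (relD V)) : J z = 0 ↔ relIncl V z ∈ LinearMap.range (relD V) := by
    obtain ⟨hz1, hz2⟩ := mem_ker_relD.1 z.2
    have hz : relIncl V z = ((z.1.1 : EForm V), (z.1.2 : EForm V)) := rfl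
    refine ⟨fun h => ?_, ?_⟩
    · obtain ⟨ψ, hψ, hψ'⟩ := exists_eqDiff_eq e isStable_compactForms compactForms_le_rapidForms
        (fun a ha => homotopyOp_mem_compactForms e ha)
        (cutoff_mem_eqForms isCutoff_radialBump z.1.1.2 z.1.2.2 hz2)
        (eqDiff_cutoff isCutoff_radialBump z.1.1.2 z.1.2.2 hz1 hz2)
        fun X => congrArg (fun P : InvPoly V => P.toFun X) h
      exact exists_relD_eq isCutoff_radialBump z.1.2.2 hz2 hψ hψ'
    · rintro ⟨w, hw⟩
      exact InvPoly.ext fun X =>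
        formIntegral_cutoff_relD e isCutoff_radialBump (hw.trans hz) z.1.2.2 hz2 X
  obtain ⟨h1, I, hI, h2⟩ := cohomology_freeGenerator (relIncl V) (relD V) J hJ (m := m)
    (InvPoly.ext hm)
  refine ⟨h1, I, fun z χ hχ X => ?_, h2⟩
  refine (congrArg (fun P : InvPoly V => P.toFun X) (hI z)).trans ?_
  exact formIntegral_cutoff_eq e isCutoff_radialBump hχ z.1.1.2 z.1.2.2 (mem_ker_relD.1 z.2).2 X

end RelativeCohomology

/-! ### Exponentials of nilpotent elements -/

section NilExp

theorem nilExp_eq_sum {A : Type*} [Ring A] [Module ℝ A] {a : A} {N : ℕ} (h : a ^ N = 0) :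
    nilExp a = ∑ n ∈ Finset.range N, ((n.factorial : ℝ)⁻¹) • a ^ n := by
  have hle : nilpotencyClass a ≤ N := Nat.sInf_le h
  have h0 : a ^ nilpotencyClass a = 0 := Nat.sInf_mem (s := {k | a ^ k = 0}) ⟨N, h⟩
  refine Finset.sum_subset (Finset.range_mono hle) fun n _ hn => ?_
  rw [pow_eq_zero_of_le (by simpa using hn) h0, smul_zero]

/-- A linear map intertwining multiplication by `a` and by `b` intertwines multiplication by their
exponentials. -/
theorem map_nilExp_mul {A B : Type*} [Ring A] [Algebra ℝ A] [Ring B] [Algebra ℝ B]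
    (φ : A →ₗ[ℝ] B) {a : A} {b : B} (ha : IsNilpotent a) (hb : IsNilpotent b)
    (h : ∀ y, φ (a * y) = b * φ y) (y : A) : φ (nilExp a * y) = nilExp b * φ y := by
  obtain ⟨N, hN⟩ := ha
  obtain ⟨M, hM⟩ := hb
  rw [nilExp_eq_sum (pow_eq_zero_of_le (le_max_left N M) hN),
    nilExp_eq_sum (pow_eq_zero_of_le (le_max_right N M) hM), Finset.sum_mul, Finset.sum_mul,
    map_sum]
  refine Finset.sum_congr rfl fun n _ => ?_
  have key : ∀ n y, φ (a ^ n * y) = b ^ n * φ y := by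
    intro n
    induction n with
    | zero => simp
    | succ n ih =>
      intro y
      rw [pow_succ, mul_assoc, ih, h, ← mul_assoc, ← pow_succ]
  rw [smul_mul_assoc, map_smul, key, smul_mul_assoc]

/-- The derivative of an exponential along a map `δ` which satisfies the Leibniz rule
`δ(ay) = by + aδ(y)` for left multiplication by `a`, where `b` commutes with `a`. -/
theorem derivation_nilExp_mul {A : Type*} [Ring A] [Algebra ℝ A] (δ : A →ₗ[ℝ] A) {a b : A}
    (ha : IsNilpotent a) (hab : Commute b a) (h : ∀ y, δ (a * y) = b * y + a * δ y) (y : A) :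
    δ (nilExp a * y) = b * (nilExp a * y) + nilExp a * δ y := by
  obtain ⟨N, hN⟩ := ha
  have key : ∀ n y, δ (a ^ (n + 1) * y) =
      ((n + 1 : ℕ) : ℝ) • (b * (a ^ n * y)) + a ^ (n + 1) * δ y := by
    intro n
    induction n with
    | zero => simp [h]
    | succ n ih =>
      intro y
      have hc : a * (b * (a ^ n * y)) = b * (a ^ (n + 1) * y) := by
        rw [← mul_assoc, ← hab.eq, mul_assoc, ← mul_assoc a, ← pow_succ']
      rw [pow_succ', mul_assoc, h, ih, mul_add, mul_smul_comm, hc, ← mul_assoc a, ← pow_succ',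
        ← add_assoc]
      congr 1
      push_cast
      module
  have h1 := nilExp_eq_sum hN
  have h2 := nilExp_eq_sum (pow_eq_zero_of_le (Nat.le_succ N) hN)
  rw [Finset.sum_range_succ'] at h2
  have h3 : δ (nilExp a * y) = ∑ n ∈ Finset.range N, ((n.factorial : ℝ)⁻¹ • (b * (a ^ n * y)) +
      ((n + 1).factorial : ℝ)⁻¹ • (a ^ (n + 1) * δ y)) + δ y := by
    rw [h2, add_mul, map_add, Finset.sum_mul, map_sum]
    congr 1
    · refine Finset.sum_congr rfl fun n _ => ?_
      rw [smul_mul_assoc, map_smul, key, smul_add, smul_smul]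
      congr 2
      have hn : (n.factorial : ℝ) ≠ 0 := by positivity
      rw [Nat.factorial_succ]
      push_cast
      field_simp
    · simp
  rw [h3, Finset.sum_add_distrib, add_assoc]
  congr 1
  · rw [h1, Finset.sum_mul, Finset.mul_sum]
    exact Finset.sum_congr rfl fun n _ => by rw [smul_mul_assoc, mul_smul_comm]
  · rw [h2, add_mul, Finset.sum_mul]
    simp

/-- Only the constant term of the exponential survives multiplication by an element annihilating
`a`. -/
theorem mul_nilExp_of_mul_eq_zero {A : Type*} [Ring A] [Algebra ℝ A] {a b : A}
    (ha : IsNilpotent a) (h : b * a = 0) : b * nilExp a = b := by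
  obtain ⟨N, hN⟩ := ha
  rw [nilExp_eq_sum (pow_eq_zero_of_le (Nat.le_succ N) hN), Finset.sum_range_succ', mul_add,
    Finset.mul_sum, Finset.sum_eq_zero]
  · simp
  · intro n _
    rw [mul_smul_comm, pow_succ', ← mul_assoc, h, zero_mul, smul_zero]

theorem Commute.nilExp_right {A : Type*} [Ring A] [Algebra ℝ A] {a b : A} (h : Commute b a) :
    Commute b (nilExp a) :=
  Commute.sum_right _ _ _ fun _ _ => (h.pow_right _).smul_right _

end NilExp

/-! ### The exterior algebra -/

section Exterior

variable {V : Type*} [AddCommGroup V] [Module ℝ V]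

/-- Vectors and elements of degree `n` commute up to the sign `(-1) ^ n`. -/
theorem mul_ι_of_mem {n : ℕ} {w : ExteriorAlgebra ℝ V} (hw : w ∈ ⋀[ℝ]^n V) (u : V) :
    w * ExteriorAlgebra.ι ℝ u = (-1 : ℝ) ^ n • (ExteriorAlgebra.ι ℝ u * w) := by
  induction hw using Submodule.pow_induction_on_left' with
  | algebraMap r => simp [Algebra.commutes]
  | add x y i hx hy h1 h2 => rw [add_mul, h1, h2, mul_add, smul_add]
  | mem_mul m hm i x hx ih =>
    obtain ⟨v, rfl⟩ := hm
    have hs : ExteriorAlgebra.ι ℝ v * ExteriorAlgebra.ι ℝ u =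
        -(ExteriorAlgebra.ι ℝ u * ExteriorAlgebra.ι ℝ v) :=
      eq_neg_of_add_eq_zero_left (ExteriorAlgebra.ι_add_mul_swap v u)
    rw [mul_assoc, ih, mul_smul_comm, ← mul_assoc, hs, pow_succ, mul_neg_one, neg_smul, neg_mul,
      smul_neg, mul_assoc]

theorem commute_ι_of_mem_two {w : ExteriorAlgebra ℝ V} (hw : w ∈ ⋀[ℝ]^2 V) (u : V) :
    Commute (ExteriorAlgebra.ι ℝ u) w := by
  have h := mul_ι_of_mem hw u
  rw [neg_one_sq, one_smul] at h
  exact h.symm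

theorem ι_mul_mem {n : ℕ} (u : V) {w : ExteriorAlgebra ℝ V} (hw : w ∈ ⋀[ℝ]^n V) :
    ExteriorAlgebra.ι ℝ u * w ∈ ⋀[ℝ]^(n + 1) V := by
  rw [ExteriorAlgebra.exteriorPower, pow_succ']
  exact Submodule.mul_mem_mul ⟨u, rfl⟩ hw

theorem ι_mem (u : V) : ExteriorAlgebra.ι ℝ u ∈ ⋀[ℝ]^1 V := by
  rw [ExteriorAlgebra.exteriorPower, pow_one]
  exact ⟨u, rfl⟩

theorem ι_mul_ι_mem (u v : V) :
    ExteriorAlgebra.ι ℝ u * ExteriorAlgebra.ι ℝ v ∈ ⋀[ℝ]^2 V :=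
  ι_mul_mem u (ι_mem v)

theorem exteriorPower_eq_bot [FiniteDimensional ℝ V] {n : ℕ} (hn : Module.finrank ℝ V < n) :
    ⋀[ℝ]^n V = ⊥ := by
  rw [← ExteriorAlgebra.ιMulti_span_fixedDegree, Submodule.span_eq_bot]
  rintro _ ⟨v, rfl⟩
  refine AlternatingMap.map_linearDependent _ v fun h => ?_
  have := h.fintype_card_le_finrank
  simp at this
  omega

/-- The contraction of the exterior algebra by a linear form. -/
def contraction (φ : Module.Dual ℝ V) : ExteriorAlgebra ℝ V →ₗ[ℝ] ExteriorAlgebra ℝ V :=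
  CliffordAlgebra.contractLeft (Q := (0 : QuadraticForm ℝ V)) φ

theorem contraction_ι_mul (φ : Module.Dual ℝ V) (v : V) (w : ExteriorAlgebra ℝ V) :
    contraction φ (ExteriorAlgebra.ι ℝ v * w) =
      φ v • w - ExteriorAlgebra.ι ℝ v * contraction φ w :=
  CliffordAlgebra.contractLeft_ι_mul φ v w

theorem contraction_algebraMap (φ : Module.Dual ℝ V) (r : ℝ) :
    contraction φ (algebraMap ℝ _ r) = 0 :=
  CliffordAlgebra.contractLeft_algebraMap _ φ r

theorem contraction_one (φ : Module.Dual ℝ V) : contraction φ 1 = 0 :=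
  CliffordAlgebra.contractLeft_one _ φ

theorem contraction_ιMulti_mem (φ : Module.Dual ℝ V) (n : ℕ) (v : Fin (n + 1) → V) :
    contraction φ (ExteriorAlgebra.ιMulti ℝ (n + 1) v) ∈ ⋀[ℝ]^n V := by
  induction n with
  | zero =>
    rw [ExteriorAlgebra.ιMulti_succ_apply, ExteriorAlgebra.ιMulti_zero_apply, contraction_ι_mul,
      contraction_one, mul_zero, sub_zero, ExteriorAlgebra.exteriorPower, pow_zero]
    exact Submodule.smul_mem _ _ (Submodule.one_le.1 le_rfl)
  | succ n ih =>
    rw [ExteriorAlgebra.ιMulti_succ_apply, contraction_ι_mul]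
    exact Submodule.sub_mem _ (Submodule.smul_mem _ _ (ExteriorAlgebra.ιMulti_range ℝ _ ⟨_, rfl⟩))
      (ι_mul_mem _ (ih _))

/-- Induction over the exterior algebra by left multiplication with vectors. -/
theorem exteriorAlgebra_induction {P : ExteriorAlgebra ℝ V → Prop}
    (hr : ∀ r, P (algebraMap ℝ _ r)) (hadd : ∀ x y, P x → P y → P (x + y))
    (hι : ∀ (v : V) (w), P w → P (ExteriorAlgebra.ι ℝ v * w)) (w : ExteriorAlgebra ℝ V) : P w :=
  CliffordAlgebra.left_induction (Q := (0 : QuadraticForm ℝ V)) hr hadd (fun w v h => hι v w h) w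

end Exterior

/-! ### The Berezin integral and bivectors -/

section Berezin

variable {V : Type*} [NormedAddCommGroup V] [InnerProductSpace ℝ V] {d : ℕ}
  (e : OrthonormalBasis (Fin d) ℝ V)

theorem berezin_ιMulti {n : ℕ} (hn : n ≠ d) (v : Fin n → V) :
    berezin e (ExteriorAlgebra.ιMulti ℝ n v) = 0 := by
  rw [berezin, ExteriorAlgebra.liftAlternating_apply_ιMulti, Pi.single_eq_of_ne hn]
  rfl

theorem berezin_ιMulti_top (v : Fin d → V) :
    berezin e (ExteriorAlgebra.ιMulti ℝ d v) = e.toBasis.det v := by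
  rw [berezin, ExteriorAlgebra.liftAlternating_apply_ιMulti, Pi.single_eq_same]

theorem berezin_eq_zero_of_mem {n : ℕ} (hn : n ≠ d) {w : ExteriorAlgebra ℝ V}
    (hw : w ∈ ⋀[ℝ]^n V) : berezin e w = 0 := by
  rw [← ExteriorAlgebra.ιMulti_span_fixedDegree] at hw
  induction hw using Submodule.span_induction with
  | mem x h =>
    obtain ⟨v, rfl⟩ := h
    exact berezin_ιMulti e hn v
  | zero => simp
  | add x y _ _ hx hy => simp [hx, hy]
  | smul c x _ hx => simp [hx]

/-- Linear maps out of the exterior algebra are determined by the products of vectors. -/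
theorem exteriorAlgebra_hom_ext {V M : Type*} [AddCommGroup V] [Module ℝ V] [AddCommGroup M]
    [Module ℝ M] {f g : ExteriorAlgebra ℝ V →ₗ[ℝ] M}
    (h : ∀ n (v : Fin n → V), f (ExteriorAlgebra.ιMulti ℝ n v) = g (ExteriorAlgebra.ιMulti ℝ n v)) :
    f = g :=
  ExteriorAlgebra.lhom_ext fun n => AlternatingMap.ext fun v => h n v

/-- The Berezin integral of a contraction vanishes: the derivative of a Grassmann function has
no component of top degree. -/
theorem berezin_contraction (φ : Module.Dual ℝ V) (w : ExteriorAlgebra ℝ V) :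
    berezin e (contraction φ w) = 0 := by
  have := e.toBasis.finiteDimensional_of_finite
  have h : (berezin e) ∘ₗ contraction φ = 0 := by
    refine exteriorAlgebra_hom_ext fun n v => ?_
    change berezin e (contraction φ _) = 0
    cases n with
    | zero =>
      rw [ExteriorAlgebra.ιMulti_zero_apply, contraction_one, map_zero]
    | succ n =>
      by_cases hn : n = d
      · have h0 : ExteriorAlgebra.ιMulti ℝ (n + 1) v = 0 := by
          have hm := ExteriorAlgebra.ιMulti_range ℝ (n + 1) ⟨v, rfl⟩
          rwa [exteriorPower_eq_bot (by
            rw [Module.finrank_eq_card_basis e.toBasis]; simp; omega)] at hm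
        rw [h0, map_zero, map_zero]
      · exact berezin_eq_zero_of_mem e hn (contraction_ιMulti_mem φ n v)
  exact LinearMap.congr_fun h w

/-- The Berezin integral is invariant under `SO(V)`. -/
theorem berezin_map {g : V ≃ₗᵢ[ℝ] V} (hg : g ∈ SO V) (w : ExteriorAlgebra ℝ V) :
    berezin e (ExteriorAlgebra.map (g.toLinearEquiv : V →ₗ[ℝ] V) w) = berezin e w := by
  have h : (berezin e) ∘ₗ (ExteriorAlgebra.map (g.toLinearEquiv : V →ₗ[ℝ] V)).toLinearMap =
      berezin e := by
    refine exteriorAlgebra_hom_ext fun n v => ?_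
    change berezin e (ExteriorAlgebra.map _ _) = _
    rw [ExteriorAlgebra.map_apply_ιMulti]
    by_cases hn : n = d
    · subst hn
      have hg' : LinearMap.det (g.toLinearEquiv : V →ₗ[ℝ] V) = 1 := hg
      rw [berezin_ιMulti_top, berezin_ιMulti_top, Module.Basis.det_comp, hg', one_mul]
    · rw [berezin_ιMulti e hn, berezin_ιMulti e hn]
  exact LinearMap.congr_fun h w

/-- The bivector of `X` is `½ ∑_k e_k ∧ X e_k`. -/
theorem bivector_eq_sum (X : so V) : bivector e X = (1 / 2 : ℝ) • ∑ k,
    ExteriorAlgebra.ι ℝ (e k) * ExteriorAlgebra.ι ℝ ((X : Module.End ℝ V) (e k)) := by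
  have hX := X.2
  rw [LinearMap.mem_skewAdjointSubmodule] at hX
  have hX' : ∀ v w : V, ⟪(X : Module.End ℝ V) v, w⟫ = -⟪(X : Module.End ℝ V) w, v⟫ := by
    intro v w
    have := hX v w
    simp only [innerₗ_apply_apply, Pi.neg_apply, inner_neg_right] at this
    rw [this, real_inner_comm]
  set F : Fin d → Fin d → ExteriorAlgebra ℝ V := fun k l =>
    ⟪(X : Module.End ℝ V) (e k), e l⟫ • (ExteriorAlgebra.ι ℝ (e k) * ExteriorAlgebra.ι ℝ (e l))
    with hF
  have hsymm : ∀ k l, F l k = F k l := by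
    intro k l
    have hs : ExteriorAlgebra.ι ℝ (e l) * ExteriorAlgebra.ι ℝ (e k) =
        -(ExteriorAlgebra.ι ℝ (e k) * ExteriorAlgebra.ι ℝ (e l)) :=
      eq_neg_of_add_eq_zero_left (ExteriorAlgebra.ι_add_mul_swap _ _)
    simp only [hF]
    rw [hX', hs, smul_neg, neg_smul, neg_neg]
  have hdiag : ∀ k, F k k = 0 := fun k => by simp [hF]
  have h1 : ∀ k, ExteriorAlgebra.ι ℝ (e k) * ExteriorAlgebra.ι ℝ ((X : Module.End ℝ V) (e k)) =
      ∑ l, F k l := by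
    intro k
    conv_lhs => rw [← e.sum_repr' ((X : Module.End ℝ V) (e k))]
    rw [map_sum, Finset.mul_sum]
    refine Finset.sum_congr rfl fun l _ => ?_
    rw [map_smul, mul_smul_comm, real_inner_comm]
  have h2 := Finset.sum_sum_Ioi_add_eq_sum_sum_off_diag F
  have h3 : ∀ k, ∑ l ∈ {k}ᶜ, F l k = ∑ l, F k l := by
    intro k
    rw [← Finset.sum_compl_add_sum {k} (fun l => F k l)]
    simp [hdiag, hsymm]
  simp_rw [h1]
  simp_rw [h3] at h2
  rw [← h2, bivector, Finset.smul_sum]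
  refine Finset.sum_congr rfl fun k _ => ?_
  rw [Finset.smul_sum]
  refine Finset.sum_congr rfl fun l _ => ?_
  rw [hsymm, ← two_smul ℝ, smul_smul]
  simp [hF]

theorem bivector_mem (X : so V) : bivector e X ∈ ⋀[ℝ]^2 V :=
  Submodule.sum_mem _ fun _ _ => Submodule.sum_mem _ fun _ _ =>
    Submodule.smul_mem _ _ (ι_mul_ι_mem _ _)

theorem bivector_smul (c : ℝ) (X : so V) : bivector e (c • X) = c • bivector e X := by
  simp only [bivector, Finset.smul_sum, smul_smul]
  refine Finset.sum_congr rfl fun k _ => Finset.sum_congr rfl fun l _ => ?_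
  congr 1
  exact real_inner_smul_left _ _ _

theorem bivector_pow_mem (X : so V) (n : ℕ) : bivector e X ^ n ∈ ⋀[ℝ]^(2 * n) V := by
  rw [ExteriorAlgebra.exteriorPower, pow_mul]
  exact Submodule.pow_mem_pow _ (bivector_mem e X) n

theorem bivector_pow_eq_zero (X : so V) : bivector e X ^ (d + 1) = 0 := by
  have := e.toBasis.finiteDimensional_of_finite
  have h := bivector_pow_mem e X (d + 1)
  rwa [exteriorPower_eq_bot (by rw [Module.finrank_eq_card_basis e.toBasis]; simp; omega)] at h

/-- The bivector of `g X g⁻¹` is the image of the bivector of `X` under `g`. -/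
theorem bivector_Ad (g : V ≃ₗᵢ[ℝ] V) (X : so V) : bivector e (Ad g X) =
    ExteriorAlgebra.map (g.toLinearEquiv : V →ₗ[ℝ] V) (bivector e X) := by
  rw [bivector_eq_sum, bivector_eq_sum, map_smul, map_sum]
  congr 1
  set B : V → V → ExteriorAlgebra ℝ V := fun v w =>
    ExteriorAlgebra.ι ℝ (g v) * ExteriorAlgebra.ι ℝ (g ((X : Module.End ℝ V) w)) with hB
  have h1 : ∀ k, ExteriorAlgebra.ι ℝ (e k) *
      ExteriorAlgebra.ι ℝ (((Ad g X : so V) : Module.End ℝ V) (e k)) =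
      ∑ j, ⟪e j, g.symm (e k)⟫ • ∑ i, ⟪e i, g.symm (e k)⟫ • B (e i) (e j) := by
    intro k
    have ha : ∀ j, ∑ i, ⟪e i, g.symm (e k)⟫ • B (e i) (e j) = B (g.symm (e k)) (e j) := by
      intro j
      conv_rhs => rw [← e.sum_repr' (g.symm (e k))]
      simp only [hB, map_sum, map_smul, Finset.sum_mul, smul_mul_assoc]
    have hb : ∀ u w, ∑ j, ⟪e j, w⟫ • B u (e j) = B u w := by
      intro u w
      conv_rhs => rw [← e.sum_repr' w]
      simp only [hB, map_sum, map_smul, Finset.mul_sum, mul_smul_comm]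
    simp_rw [ha]
    rw [hb]
    simp [hB, Ad]
  have h2 : ∀ i j, ∑ k, ⟪e j, g.symm (e k)⟫ * ⟪e i, g.symm (e k)⟫ = ⟪e i, e j⟫ := by
    intro i j
    have := (e.map g.symm).sum_inner_mul_inner (e i) (e j)
    rw [← this]
    refine Finset.sum_congr rfl fun k _ => ?_
    rw [OrthonormalBasis.map_apply, mul_comm, real_inner_comm (e j)]
  calc _ = ∑ k, ∑ j, ∑ i, (⟪e j, g.symm (e k)⟫ * ⟪e i, g.symm (e k)⟫) • B (e i) (e j) := by
        refine Finset.sum_congr rfl fun k _ => ?_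
        rw [h1]
        simp only [Finset.smul_sum, smul_smul]
    _ = ∑ j, ∑ i, ⟪e i, e j⟫ • B (e i) (e j) := by
        rw [Finset.sum_comm]
        refine Finset.sum_congr rfl fun j _ => ?_
        rw [Finset.sum_comm]
        refine Finset.sum_congr rfl fun i _ => ?_
        rw [← Finset.sum_smul, h2]
    _ = _ := by
        refine Finset.sum_congr rfl fun j _ => ?_
        rw [Finset.sum_eq_single j]
        · simp [hB]
        · intro i _ hij
          rw [e.inner_eq_zero hij, zero_smul]
        · simp

/-- Contraction by `x` of the bivector `ω_X` of `X` gives `ι_x ω_X = Xx`. -/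
theorem contraction_bivector_mul (x : V) (X : so V) (w : ExteriorAlgebra ℝ V) :
    contraction (innerₗ V x) (bivector e X * w) =
      ExteriorAlgebra.ι ℝ ((X : Module.End ℝ V) x) * w +
        bivector e X * contraction (innerₗ V x) w := by
  have hX := X.2
  rw [LinearMap.mem_skewAdjointSubmodule] at hX
  have hX' : ∀ v : V, ⟪x, (X : Module.End ℝ V) v⟫ = -⟪v, (X : Module.End ℝ V) x⟫ := by
    intro v
    have := hX v x
    simp only [innerₗ_apply_apply, Pi.neg_apply, inner_neg_right] at this
    rw [← this, real_inner_comm]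
  have h1 : ∀ k, contraction (innerₗ V x) (ExteriorAlgebra.ι ℝ (e k) *
      ExteriorAlgebra.ι ℝ ((X : Module.End ℝ V) (e k)) * w) =
      (⟪e k, x⟫ • ExteriorAlgebra.ι ℝ ((X : Module.End ℝ V) (e k)) +
        ⟪e k, (X : Module.End ℝ V) x⟫ • ExteriorAlgebra.ι ℝ (e k)) * w +
      ExteriorAlgebra.ι ℝ (e k) * ExteriorAlgebra.ι ℝ ((X : Module.End ℝ V) (e k)) *
        contraction (innerₗ V x) w := by
    intro k
    rw [mul_assoc, contraction_ι_mul, contraction_ι_mul, innerₗ_apply_apply, innerₗ_apply_apply,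
      hX', real_inner_comm, add_mul, mul_sub, smul_mul_assoc, smul_mul_assoc, mul_smul_comm,
      neg_smul, mul_assoc]
    abel
  have h2 : ∑ k, (⟪e k, x⟫ • ExteriorAlgebra.ι ℝ ((X : Module.End ℝ V) (e k)) +
        ⟪e k, (X : Module.End ℝ V) x⟫ • ExteriorAlgebra.ι ℝ (e k)) =
      (2 : ℝ) • ExteriorAlgebra.ι ℝ ((X : Module.End ℝ V) x) := by
    rw [Finset.sum_add_distrib, two_smul]
    congr 1
    · conv_rhs => rw [← e.sum_repr' x]
      simp only [map_sum, map_smul]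
    · conv_rhs => rw [← e.sum_repr' ((X : Module.End ℝ V) x)]
      simp only [map_sum, map_smul]
  rw [bivector_eq_sum, smul_mul_assoc, map_smul, Finset.sum_mul, map_sum]
  simp_rw [h1]
  rw [Finset.sum_add_distrib, ← Finset.sum_mul, ← Finset.sum_mul, h2, smul_add, smul_mul_assoc,
    smul_smul, smul_mul_assoc]
  norm_num

end Berezin

/-! ### Berezin coefficients -/

section Coefficients

variable {V : Type*} [NormedAddCommGroup V] [InnerProductSpace ℝ V] [FiniteDimensional ℝ V] {d : ℕ}
  (e : OrthonormalBasis (Fin d) ℝ V)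

/-- The constant `p`-form `(v₁, …, v_p) ↦ T(v_p ⋯ v₁ w)` attached to an element `w` of `⋀V`. The
order of the vectors is reversed so that contraction by `u` corresponds to multiplication of `w` by
`u` on the left; the reversal is expressed by the sign `(-1) ^ (p (p - 1) / 2)`. -/
def coeffForm (p : ℕ) : ExteriorAlgebra ℝ V →ₗ[ℝ] V [⋀^Fin p]→L[ℝ] ℝ where
  toFun w :=
    { ((-1 : ℝ) ^ (p * (p - 1) / 2)) • ((berezin e ∘ₗ LinearMap.mulRight ℝ w).compAlternatingMap
        (ExteriorAlgebra.ιMulti ℝ p)) with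
      cont := continuous_multilinear _ }
  map_add' w w' := by
    ext v
    change (-1 : ℝ) ^ (p * (p - 1) / 2) * berezin e (_ * (w + w')) =
      (-1 : ℝ) ^ (p * (p - 1) / 2) * berezin e (_ * w) +
        (-1 : ℝ) ^ (p * (p - 1) / 2) * berezin e (_ * w')
    rw [mul_add, map_add, mul_add]
  map_smul' c w := by
    ext v
    change (-1 : ℝ) ^ (p * (p - 1) / 2) * berezin e (_ * (c • w)) =
      c * ((-1 : ℝ) ^ (p * (p - 1) / 2) * berezin e (_ * w))
    rw [mul_smul_comm, map_smul, smul_eq_mul]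
    ring

theorem coeffForm_apply (p : ℕ) (w : ExteriorAlgebra ℝ V) (v : Fin p → V) :
    coeffForm e p w v =
      (-1 : ℝ) ^ (p * (p - 1) / 2) * berezin e (ExteriorAlgebra.ιMulti ℝ p v * w) := rfl

theorem coeffForm_zero_apply (w : ExteriorAlgebra ℝ V) (v : Fin 0 → V) :
    coeffForm e 0 w v = berezin e w := by
  simp [coeffForm_apply]

/-- Contraction by `u` corresponds to left multiplication by `u`. -/
theorem coeffForm_curryLeft (p : ℕ) (w : ExteriorAlgebra ℝ V) (u : V) :
    (coeffForm e (p + 1) w).curryLeft u = coeffForm e p (ExteriorAlgebra.ι ℝ u * w) := by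
  ext v
  have h : ExteriorAlgebra.ιMulti ℝ p v * ExteriorAlgebra.ι ℝ u =
      (-1 : ℝ) ^ p • (ExteriorAlgebra.ι ℝ u * ExteriorAlgebra.ιMulti ℝ p v) :=
    mul_ι_of_mem (ExteriorAlgebra.ιMulti_range ℝ p ⟨v, rfl⟩) u
  change coeffForm e (p + 1) w (Matrix.vecCons u v) = _
  rw [coeffForm_apply, coeffForm_apply, ExteriorAlgebra.ιMulti_succ_apply, ← mul_assoc, h,
    Nat.triangle_succ, pow_add, smul_mul_assoc, map_smul, smul_eq_mul, mul_assoc]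
  simp

/-- The exterior product with the linear form `⟨x, ·⟩` corresponds to contraction by `x`. Both
sides have the same contractions, by induction on the degree; in degree one this is the vanishing
of `berezin_contraction`. -/
theorem alternatizeUncurryFin_inner_coeffForm (x : V) (p : ℕ) (w : ExteriorAlgebra ℝ V) :
    ContinuousAlternatingMap.alternatizeUncurryFin ((innerSL ℝ x).smulRight (coeffForm e p w)) =
      coeffForm e (p + 1) (contraction (innerₗ V x) w) := by
  have hι : ∀ u w, ExteriorAlgebra.ι ℝ u * contraction (innerₗ V x) w =
      ⟪x, u⟫ • w - contraction (innerₗ V x) (ExteriorAlgebra.ι ℝ u * w) := by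
    intro u w
    rw [contraction_ι_mul, innerₗ_apply_apply, sub_sub_cancel]
  induction p generalizing w with
  | zero =>
    refine alternating_ext_curryLeft fun u => ?_
    rw [coeffForm_curryLeft, hι]
    ext v
    rw [coeffForm_zero_apply, map_sub, berezin_contraction, map_smul, sub_zero]
    change ContinuousAlternatingMap.alternatizeUncurryFin _ (Matrix.vecCons u v) = _
    simp [ContinuousAlternatingMap.alternatizeUncurryFin_apply, coeffForm_zero_apply]
  | succ p ih =>
    refine alternating_ext_curryLeft fun u => ?_
    have h := alternatizeUncurryFin_flip_comp ((innerSL ℝ x).smulRight (coeffForm e (p + 1) w)) u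
      ((innerSL ℝ x).smulRight (coeffForm e p (ExteriorAlgebra.ι ℝ u * w))) (fun y => by
        rw [← coeffForm_curryLeft]
        ext v
        simp)
    rw [ih] at h
    rw [coeffForm_curryLeft, hι, map_sub, map_smul, h]
    ext v
    simp

/-- The exponential `exp(½ ∑_{k<l} ⟨X e_k, e_l⟩ e_k ∧ e_l)`. -/
def bivectorExp (X : so V) : ExteriorAlgebra ℝ V :=
  nilExp ((1 / 2 : ℝ) • bivector e X)

theorem isNilpotent_bivector (c : ℝ) (X : so V) : IsNilpotent (c • bivector e X) :=
  ⟨d + 1, by rw [smul_pow, bivector_pow_eq_zero, smul_zero]⟩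

theorem commute_ι_bivectorExp (u : V) (X : so V) :
    Commute (ExteriorAlgebra.ι ℝ u) (bivectorExp e X) :=
  Commute.nilExp_right ((commute_ι_of_mem_two (bivector_mem e X) u).smul_right _)

/-- The infinitesimal form of the relation between the equivariant parameter and the exponential:
`ι_x exp(½ω_X) = ½ (Xx) exp(½ω_X)`. -/
theorem contraction_bivectorExp (x : V) (X : so V) :
    contraction (innerₗ V x) (bivectorExp e X) =
      (1 / 2 : ℝ) • (ExteriorAlgebra.ι ℝ ((X : Module.End ℝ V) x) * bivectorExp e X) := by
  have h := derivation_nilExp_mul (contraction (innerₗ V x)) (isNilpotent_bivector e (1 / 2) X)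
    (b := (1 / 2 : ℝ) • ExteriorAlgebra.ι ℝ ((X : Module.End ℝ V) x))
    (((commute_ι_of_mem_two (bivector_mem e X) _).smul_left _).smul_right _)
    (fun y => by
      rw [smul_mul_assoc, map_smul, contraction_bivector_mul, smul_add, smul_mul_assoc,
        smul_mul_assoc]) 1
  rw [mul_one, contraction_one, mul_zero, add_zero, smul_mul_assoc] at h
  exact h

/-- The constant forms attached to `exp(½ω_X)` satisfy `ι_{Xx} c = d‖x‖² ∧ c`, relating the degrees
`p + 2` and `p`. -/
theorem curryLeft_coeffForm_bivectorExp (x : V) (X : so V) (p : ℕ) :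
    (coeffForm e (p + 2) (bivectorExp e X)).curryLeft ((X : Module.End ℝ V) x) =
      (2 : ℝ) • ContinuousAlternatingMap.alternatizeUncurryFin
        ((innerSL ℝ x).smulRight (coeffForm e p (bivectorExp e X))) := by
  rw [alternatizeUncurryFin_inner_coeffForm, coeffForm_curryLeft, contraction_bivectorExp, map_smul,
    smul_smul]
  norm_num

/-- The relation `ι_{Xx} c = d‖x‖² ∧ c` in degree zero, where the right hand side is absent. -/
theorem curryLeft_coeffForm_one_bivectorExp (x : V) (X : so V) :
    (coeffForm e 1 (bivectorExp e X)).curryLeft ((X : Module.End ℝ V) x) = 0 := by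
  ext v
  have h : ExteriorAlgebra.ι ℝ ((X : Module.End ℝ V) x) * bivectorExp e X =
      (2 : ℝ) • contraction (innerₗ V x) (bivectorExp e X) := by
    rw [contraction_bivectorExp, smul_smul]
    norm_num
  rw [coeffForm_curryLeft, coeffForm_zero_apply, h, map_smul, berezin_contraction, smul_zero]
  rfl

theorem coeffForm_zero_bivectorExp (X : so V) (v : Fin 0 → V) :
    coeffForm e 0 (bivectorExp e X) v = pfaffian e ((1 / 2 : ℝ) • X) := by
  rw [coeffForm_zero_apply, pfaffian, bivector_smul, bivectorExp]

/-- In top degree only the term `1` of the exponential contributes. -/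
theorem coeffForm_top_bivectorExp (X : so V) :
    coeffForm e d (bivectorExp e X) (fun k => e k) = (-1 : ℝ) ^ (d * (d - 1) / 2) := by
  have h0 : ExteriorAlgebra.ιMulti ℝ d (fun k => e k) * ((1 / 2 : ℝ) • bivector e X) = 0 := by
    have h1 : ExteriorAlgebra.ιMulti ℝ d (fun k => e k) * bivector e X ∈ ⋀[ℝ]^(d + 2) V := by
      rw [ExteriorAlgebra.exteriorPower, pow_add]
      exact Submodule.mul_mem_mul (ExteriorAlgebra.ιMulti_range ℝ d ⟨_, rfl⟩) (bivector_mem e X)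
    rw [exteriorPower_eq_bot (by rw [Module.finrank_eq_card_basis e.toBasis]; simp)] at h1
    rw [mul_smul_comm, (Submodule.mem_bot ℝ).1 h1, smul_zero]
  rw [coeffForm_apply, bivectorExp, mul_nilExp_of_mul_eq_zero (isNilpotent_bivector e _ X) h0,
    berezin_ιMulti_top]
  have h2 : (fun k => e k) = ⇑e.toBasis := by simp
  rw [h2, Module.Basis.det_self, mul_one]

theorem bivectorExp_Ad (g : V ≃ₗᵢ[ℝ] V) (X : so V) : bivectorExp e (Ad g X) =
    ExteriorAlgebra.map (g.toLinearEquiv : V →ₗ[ℝ] V) (bivectorExp e X) := by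
  have h := map_nilExp_mul (ExteriorAlgebra.map (g.toLinearEquiv : V →ₗ[ℝ] V)).toLinearMap
    (isNilpotent_bivector e (1 / 2) X) (isNilpotent_bivector e (1 / 2) (Ad g X)) (fun y => by
      simp [bivector_Ad]) 1
  simpa [bivectorExp] using h.symm

theorem coeffForm_bivectorExp_Ad {g : V ≃ₗᵢ[ℝ] V} (hg : g ∈ SO V) (X : so V) (p : ℕ)
    (v : Fin p → V) : coeffForm e p (bivectorExp e (Ad g X)) (fun i => g (v i)) =
      coeffForm e p (bivectorExp e X) v := by
  have h : ExteriorAlgebra.ιMulti ℝ p (fun i => g (v i)) =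
      ExteriorAlgebra.map (g.toLinearEquiv : V →ₗ[ℝ] V) (ExteriorAlgebra.ιMulti ℝ p v) :=
    (ExteriorAlgebra.map_apply_ιMulti _ _).symm
  rw [coeffForm_apply, coeffForm_apply, bivectorExp_Ad, h, ← map_mul, berezin_map e hg]

/-- A linear map from `⋀V` to a space of forms turns the exponential of the bivector of `X` into a
polynomial function of `X`. -/
theorem bivectorExp_mem_polyMaps {𝓐 : Submodule ℝ (Form V)} (K : ExteriorAlgebra ℝ V →ₗ[ℝ] Form V)
    (hK : ∀ w, K w ∈ 𝓐) : (fun X => K (bivectorExp e X)) ∈ polyMaps 𝓐 := by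
  have key : ∀ (n : ℕ) (w : ExteriorAlgebra ℝ V),
      (fun X => K (bivector e X ^ n * w)) ∈ polyMaps 𝓐 := by
    intro n
    induction n with
    | zero => exact fun w => by simpa using polyMaps_const_mem (hK w)
    | succ n ih =>
      intro w
      have h : (fun X => K (bivector e X ^ (n + 1) * w)) =
          ∑ k, ∑ l ∈ Finset.Ioi k, (fun X : so V => ⟪(X : Module.End ℝ V) (e k), e l⟫ •
            K (bivector e X ^ n *
              (ExteriorAlgebra.ι ℝ (e k) * ExteriorAlgebra.ι ℝ (e l) * w))) := by
        funext X
        simp only [Finset.sum_apply]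
        rw [pow_succ, mul_assoc]
        conv_lhs => enter [2, 2]; rw [bivector]
        simp only [Finset.sum_mul, Finset.mul_sum, map_sum, smul_mul_assoc, mul_smul_comm,
          map_smul]
      rw [h]
      refine Submodule.sum_mem _ fun k _ => Submodule.sum_mem _ fun l _ => ?_
      refine polyFun_smul_polyMaps (linear_mem_polyFun
        ({ toFun := fun X => ⟪(X : Module.End ℝ V) (e k), e l⟫
           map_add' := fun X Y => ?_
           map_smul' := fun c X => ?_ } : Module.Dual ℝ (so V))) (ih _)
      · exact inner_add_left _ _ _
      · exact real_inner_smul_left _ _ _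
  have h : (fun X => K (bivectorExp e X)) = ∑ n ∈ Finset.range (d + 1),
      ((n.factorial : ℝ)⁻¹ * (1 / 2) ^ n) • (fun X => K (bivector e X ^ n * 1)) := by
    funext X
    simp only [Finset.sum_apply]
    rw [bivectorExp, nilExp_eq_sum (N := d + 1) (by rw [smul_pow, bivector_pow_eq_zero, smul_zero]),
      map_sum]
    refine Finset.sum_congr rfl fun n _ => ?_
    rw [smul_pow, smul_smul, map_smul, ← mul_one (bivector e X ^ n)]
    rfl
  rw [h]
  exact Submodule.sum_mem _ fun n _ => Submodule.smul_mem _ _ (key n 1)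

end Coefficients

/-! ### Components of elements of `⋀V^*` -/

section ToAlt

variable {V : Type*} [NormedAddCommGroup V] [InnerProductSpace ℝ V] [FiniteDimensional ℝ V]

theorem toAlt_apply (w : ExteriorAlgebra ℝ (Module.Dual ℝ V)) (p : ℕ) (v : Fin p → V) :
    toAlt w p v = exteriorPower.pairingDual ℝ V p
      (DirectSum.decompose (fun i : ℕ => ⋀[ℝ]^i (Module.Dual ℝ V)) w p)
      (exteriorPower.ιMulti ℝ p v) := rfl

/-- The degree `p` component, as a linear map. -/
def toAltLin (p : ℕ) : ExteriorAlgebra ℝ (Module.Dual ℝ V) →ₗ[ℝ] V [⋀^Fin p]→L[ℝ] ℝ where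
  toFun w := toAlt w p
  map_add' w w' := by
    ext v
    rw [ContinuousAlternatingMap.add_apply, toAlt_apply, toAlt_apply, toAlt_apply,
      DirectSum.decompose_add, DirectSum.add_apply, map_add]
    rfl
  map_smul' c w := by
    ext v
    change toAlt (c • w) p v = c * toAlt w p v
    rw [toAlt_apply, toAlt_apply, DirectSum.decompose_smul]
    change exteriorPower.pairingDual ℝ V p (c • _) _ = _
    rw [map_smul]
    rfl

theorem toAlt_add (w w' : ExteriorAlgebra ℝ (Module.Dual ℝ V)) (p : ℕ) :
    toAlt (w + w') p = toAlt w p + toAlt w' p := map_add (toAltLin p) w w'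

theorem toAlt_smul (c : ℝ) (w : ExteriorAlgebra ℝ (Module.Dual ℝ V)) (p : ℕ) :
    toAlt (c • w) p = c • toAlt w p := map_smul (toAltLin p) c w

/-- Induction over the exterior algebra by linear combinations of products of vectors. -/
theorem exteriorAlgebra_induction_ιMulti {W : Type*} [AddCommGroup W] [Module ℝ W]
    {P : ExteriorAlgebra ℝ W → Prop} (hadd : ∀ x y, P x → P y → P (x + y))
    (hsmul : ∀ (c : ℝ) x, P x → P (c • x))
    (hι : ∀ n (f : Fin n → W), P (ExteriorAlgebra.ιMulti ℝ n f)) (w : ExteriorAlgebra ℝ W) :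
    P w := by
  have hw : w ∈ (⊤ : Submodule ℝ (ExteriorAlgebra ℝ W)) := trivial
  rw [← ExteriorAlgebra.ιMulti_span] at hw
  induction hw using Submodule.span_induction with
  | mem x h =>
    obtain ⟨⟨n, f⟩, rfl⟩ := h
    exact hι n f
  | zero => simpa using hsmul 0 _ (hι 0 ![])
  | add x y _ _ hx hy => exact hadd x y hx hy
  | smul c x _ hx => exact hsmul c x hx

theorem toAlt_of_mem_of_ne {w : ExteriorAlgebra ℝ (Module.Dual ℝ V)} {n p : ℕ}
    (hw : w ∈ ⋀[ℝ]^n (Module.Dual ℝ V)) (hn : n ≠ p) : toAlt w p = 0 := by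
  ext v
  rw [toAlt_apply]
  have h : DirectSum.decompose (fun i : ℕ => ⋀[ℝ]^i (Module.Dual ℝ V)) w p = 0 :=
    Subtype.ext (DirectSum.decompose_of_mem_ne _ hw hn)
  rw [h, map_zero]
  rfl

theorem toAlt_ιMulti {p : ℕ} (f : Fin p → Module.Dual ℝ V) (v : Fin p → V) :
    toAlt (ExteriorAlgebra.ιMulti ℝ p f) p v = Matrix.det (.of fun i j => f j (v i)) := by
  have h : DirectSum.decompose (fun i : ℕ => ⋀[ℝ]^i (Module.Dual ℝ V))
      (ExteriorAlgebra.ιMulti ℝ p f) p = exteriorPower.ιMulti ℝ p f :=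
    Subtype.ext (DirectSum.decompose_of_mem_same _ (ExteriorAlgebra.ιMulti_range ℝ p ⟨f, rfl⟩))
  rw [toAlt_apply, h, exteriorPower.pairingDual_ιMulti_ιMulti]

/-- The exterior product with a linear form corresponds to the alternation of `φ ⊗ w`: this is the
Laplace expansion of a determinant along its first column. -/
theorem toAlt_ι_mul (φ : Module.Dual ℝ V) (w : ExteriorAlgebra ℝ (Module.Dual ℝ V)) (p : ℕ) :
    toAlt (ExteriorAlgebra.ι ℝ φ * w) (p + 1) = ContinuousAlternatingMap.alternatizeUncurryFin
      ((LinearMap.toContinuousLinearMap φ).smulRight (toAlt w p)) := by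
  suffices h : ∀ v, toAlt (ExteriorAlgebra.ι ℝ φ * w) (p + 1) v =
      ∑ i : Fin (p + 1), (-1 : ℝ) ^ (i : ℕ) * (φ (v i) * toAlt w p (i.removeNth v)) by
    ext v
    rw [h, ContinuousAlternatingMap.alternatizeUncurryFin_apply]
    refine Finset.sum_congr rfl fun i _ => ?_
    rw [ContinuousLinearMap.smulRight_apply, ContinuousAlternatingMap.smul_apply, zsmul_eq_mul]
    simp
  intro v
  induction w using exteriorAlgebra_induction_ιMulti with
  | hadd x y hx hy =>
    rw [mul_add, toAlt_add, toAlt_add, ContinuousAlternatingMap.add_apply, hx, hy,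
      ← Finset.sum_add_distrib]
    refine Finset.sum_congr rfl fun i _ => ?_
    rw [ContinuousAlternatingMap.add_apply, mul_add, mul_add]
  | hsmul c x hx =>
    rw [mul_smul_comm, toAlt_smul, toAlt_smul, ContinuousAlternatingMap.smul_apply, hx,
      Finset.smul_sum]
    refine Finset.sum_congr rfl fun i _ => ?_
    rw [ContinuousAlternatingMap.smul_apply, smul_eq_mul, smul_eq_mul]
    ring
  | hι n f =>
    have hf : ExteriorAlgebra.ι ℝ φ * ExteriorAlgebra.ιMulti ℝ n f =
        ExteriorAlgebra.ιMulti ℝ (n + 1) (Matrix.vecCons φ f) := by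
      rw [ExteriorAlgebra.ιMulti_succ_apply]
      rfl
    by_cases hn : n = p
    · subst hn
      rw [hf, toAlt_ιMulti, Matrix.det_succ_column_zero]
      refine Finset.sum_congr rfl fun i _ => ?_
      rw [toAlt_ιMulti, mul_assoc]
      rfl
    · rw [toAlt_of_mem_of_ne (ExteriorAlgebra.ιMulti_range ℝ n ⟨f, rfl⟩) hn, hf,
        toAlt_of_mem_of_ne (ExteriorAlgebra.ιMulti_range ℝ (n + 1) ⟨_, rfl⟩) (by omega)]
      simp

theorem toAlt_algebraMap_succ (r : ℝ) (p : ℕ) :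
    toAlt (V := V) (algebraMap ℝ _ r) (p + 1) = 0 :=
  toAlt_of_mem_of_ne (n := 0) (by
    rw [ExteriorAlgebra.exteriorPower, pow_zero]
    exact Submodule.algebraMap_mem r) (by omega)

theorem algebraMapInv_ι_mul {W : Type*} [AddCommGroup W] [Module ℝ W] (φ : W)
    (w : ExteriorAlgebra ℝ W) :
    ExteriorAlgebra.algebraMapInv (ExteriorAlgebra.ι ℝ φ * w) = 0 := by
  rw [map_mul]
  simp [ExteriorAlgebra.algebraMapInv]

theorem toAlt_zero_apply (w : ExteriorAlgebra ℝ (Module.Dual ℝ V)) (v : Fin 0 → V) :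
    toAlt w 0 v = ExteriorAlgebra.algebraMapInv w := by
  induction w using exteriorAlgebra_induction_ιMulti with
  | hadd x y hx hy => rw [toAlt_add, ContinuousAlternatingMap.add_apply, hx, hy, map_add]
  | hsmul c x hx => rw [toAlt_smul, ContinuousAlternatingMap.smul_apply, hx, map_smul]
  | hι n f =>
    cases n with
    | zero =>
      rw [toAlt_ιMulti, ExteriorAlgebra.ιMulti_zero_apply, map_one]
      simp
    | succ n =>
      rw [toAlt_of_mem_of_ne (ExteriorAlgebra.ιMulti_range ℝ (n + 1) ⟨f, rfl⟩) (by omega),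
        ExteriorAlgebra.ιMulti_succ_apply, algebraMapInv_ι_mul]
      rfl

/-- Contraction of alternating maps corresponds to contraction in the exterior algebra. -/
theorem curryLeft_toAlt (w : ExteriorAlgebra ℝ (Module.Dual ℝ V)) (p : ℕ) (u : V) :
    (toAlt w (p + 1)).curryLeft u = toAlt (contraction (Module.Dual.eval ℝ V u) w) p := by
  change _ = toAltLin p _
  induction w using exteriorAlgebra_induction generalizing p with
  | hr r =>
    rw [toAlt_algebraMap_succ, contraction_algebraMap, map_zero]
    rfl
  | hadd x y hx hy =>
    rw [map_add, map_add, ← hx, ← hy, toAlt_add]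
    rfl
  | hι φ w ih =>
    rw [contraction_ι_mul, map_sub, map_smul, toAlt_ι_mul]
    change _ = φ u • toAlt w p - toAlt _ p
    cases p with
    | zero =>
      have h0 : toAlt (ExteriorAlgebra.ι ℝ φ * contraction (Module.Dual.eval ℝ V u) w) 0 = 0 := by
        ext v
        rw [toAlt_zero_apply, algebraMapInv_ι_mul]
        rfl
      rw [h0]
      ext v
      change ContinuousAlternatingMap.alternatizeUncurryFin _ (Matrix.vecCons u v) = _
      simp [ContinuousAlternatingMap.alternatizeUncurryFin_apply, Subsingleton.elim v 0]
    | succ p =>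
      have h := alternatizeUncurryFin_flip_comp
        ((LinearMap.toContinuousLinearMap φ).smulRight (toAlt w (p + 1))) u
        ((LinearMap.toContinuousLinearMap φ).smulRight
          (toAlt (contraction (Module.Dual.eval ℝ V u) w) p)) (fun y => by
          have := ih p
          change _ = toAlt _ p at this
          rw [← this]
          ext v
          simp)
      rw [← toAlt_ι_mul] at h
      rw [h]
      ext v
      simp

end ToAlt

/-! ### The super-algebra `⋀V^* ⊗ ⋀V` -/

section Super

variable {V : Type*} [NormedAddCommGroup V] [InnerProductSpace ℝ V]

theorem stmul_eq_mul (α : ExteriorAlgebra ℝ (Module.Dual ℝ V)) (ξ : ExteriorAlgebra ℝ V) :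
    stmul α ξ = stmul α 1 * stmul 1 ξ :=
  (GradedTensorProduct.tmul_one_mul_one_tmul _ _ α ξ).symm

theorem stmul_mul_one (α α' : ExteriorAlgebra ℝ (Module.Dual ℝ V)) :
    stmul (V := V) (α * α') 1 = stmul α 1 * stmul α' 1 :=
  map_mul (GradedTensorProduct.includeLeft (fun i : ℕ => ⋀[ℝ]^i (Module.Dual ℝ V))
    (fun i : ℕ => ⋀[ℝ]^i V)) α α'

theorem stmul_one_mul (ξ ξ' : ExteriorAlgebra ℝ V) :
    stmul (V := V) 1 (ξ * ξ') = stmul 1 ξ * stmul 1 ξ' :=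
  map_mul (GradedTensorProduct.includeRight (fun i : ℕ => ⋀[ℝ]^i (Module.Dual ℝ V))
    (fun i : ℕ => ⋀[ℝ]^i V)) ξ ξ'

theorem stmul_mul_stmul (α α' : ExteriorAlgebra ℝ (Module.Dual ℝ V)) (ξ : ExteriorAlgebra ℝ V) :
    stmul α 1 * stmul α' ξ = stmul (α * α') ξ := by
  rw [stmul_eq_mul α', ← mul_assoc, ← stmul_mul_one, ← stmul_eq_mul]

/-- The sign rule of the super tensor product, for linear forms and vectors. -/
theorem stmul_ι_anticomm (φ : Module.Dual ℝ V) (v : V) :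
    stmul 1 (ExteriorAlgebra.ι ℝ v) * stmul (ExteriorAlgebra.ι ℝ φ) 1 =
      -(stmul (ExteriorAlgebra.ι ℝ φ) 1 * stmul 1 (ExteriorAlgebra.ι ℝ v)) := by
  have h := GradedTensorProduct.tmul_coe_mul_coe_tmul (R := ℝ)
    (fun i : ℕ => ⋀[ℝ]^i (Module.Dual ℝ V)) (fun i : ℕ => ⋀[ℝ]^i V) (j₁ := 1) (i₂ := 1) 1
    ⟨_, ι_mem v⟩ ⟨_, ι_mem φ⟩ 1
  rw [← stmul_eq_mul]
  simpa using h

/-- Induction over `⋀V^* ⊗ ⋀V` by left multiplication with linear forms. -/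
theorem superAlg_induction {P : SuperAlg V → Prop} (hadd : ∀ x y, P x → P y → P (x + y))
    (hone : ∀ ξ, P (stmul 1 ξ))
    (hι : ∀ (φ : Module.Dual ℝ V) y, P y → P (stmul (ExteriorAlgebra.ι ℝ φ) 1 * y))
    (y : SuperAlg V) : P y := by
  have h : ∀ z : ExteriorAlgebra ℝ (Module.Dual ℝ V) ⊗[ℝ] ExteriorAlgebra ℝ V,
      P (GradedTensorProduct.of ℝ _ _ z) := by
    intro z
    induction z using TensorProduct.induction_on with
    | zero =>
      have := hone 0
      rwa [show stmul (V := V) 1 0 = 0 from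
        congrArg (GradedTensorProduct.of ℝ _ _) (TensorProduct.tmul_zero _ _)] at this
    | add x y hx hy =>
      rw [map_add]
      exact hadd _ _ hx hy
    | tmul α ξ =>
      change P (stmul α ξ)
      induction α using exteriorAlgebra_induction with
      | hr r =>
        have : stmul (algebraMap ℝ _ r) ξ = stmul (V := V) 1 (r • ξ) := by
          rw [Algebra.algebraMap_eq_smul_one]
          exact congrArg (GradedTensorProduct.of ℝ _ _) (TensorProduct.smul_tmul _ _ _)
        rw [this]
        exact hone _
      | hadd x y hx hy =>
        have : stmul (x + y) ξ = stmul x ξ + stmul y ξ :=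
          congrArg (GradedTensorProduct.of ℝ _ _) (TensorProduct.add_tmul _ _ _)
        rw [this]
        exact hadd _ _ hx hy
      | hι φ w ih =>
        rw [← stmul_mul_stmul]
        exact hι _ _ ih
  simpa using h ((GradedTensorProduct.of ℝ _ _).symm y)

end Super

/-! ### The components of `T(exp f_t)` -/

section SuperExp

variable {V : Type*} [NormedAddCommGroup V] [InnerProductSpace ℝ V]

/-- The inclusion `⋀V → ⋀V^* ⊗ ⋀V`. -/
def superIncl : ExteriorAlgebra ℝ V →ₐ[ℝ] SuperAlg V :=
  GradedTensorProduct.includeRight (fun i : ℕ => ⋀[ℝ]^i (Module.Dual ℝ V))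
    (fun i : ℕ => ⋀[ℝ]^i V)

theorem superIncl_apply (ξ : ExteriorAlgebra ℝ V) : superIncl ξ = stmul 1 ξ := rfl

/-- Contraction of the differential form factor of `⋀V^* ⊗ ⋀V` by a vector. -/
def superContraction (u : V) : SuperAlg V →ₗ[ℝ] SuperAlg V :=
  (GradedTensorProduct.of ℝ (fun i : ℕ => ⋀[ℝ]^i (Module.Dual ℝ V))
      (fun i : ℕ => ⋀[ℝ]^i V)).toLinearMap ∘ₗ
    (contraction (Module.Dual.eval ℝ V u)).rTensor _ ∘ₗ
    (GradedTensorProduct.of ℝ (fun i : ℕ => ⋀[ℝ]^i (Module.Dual ℝ V))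
      (fun i : ℕ => ⋀[ℝ]^i V)).symm.toLinearMap

/-- The projection `⋀V^* ⊗ ⋀V → ⋀V` on the component of degree zero in the first factor. -/
def superProj : SuperAlg V →ₗ[ℝ] ExteriorAlgebra ℝ V :=
  (TensorProduct.lid ℝ _).toLinearMap ∘ₗ
    (ExteriorAlgebra.algebraMapInv (R := ℝ) (M := Module.Dual ℝ V)).toLinearMap.rTensor _ ∘ₗ
    (GradedTensorProduct.of ℝ (fun i : ℕ => ⋀[ℝ]^i (Module.Dual ℝ V))
      (fun i : ℕ => ⋀[ℝ]^i V)).symm.toLinearMap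

theorem superContraction_stmul (u : V) (α : ExteriorAlgebra ℝ (Module.Dual ℝ V))
    (ξ : ExteriorAlgebra ℝ V) :
    superContraction u (stmul α ξ) = stmul (contraction (Module.Dual.eval ℝ V u) α) ξ := rfl

theorem superProj_stmul (α : ExteriorAlgebra ℝ (Module.Dual ℝ V)) (ξ : ExteriorAlgebra ℝ V) :
    superProj (stmul α ξ) = ExteriorAlgebra.algebraMapInv α • ξ := rfl

theorem superBerezin_stmul {d : ℕ} (e : OrthonormalBasis (Fin d) ℝ V)
    (α : ExteriorAlgebra ℝ (Module.Dual ℝ V)) (ξ : ExteriorAlgebra ℝ V) :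
    superBerezin e (stmul α ξ) = berezin e ξ • α := rfl

theorem stmul_smul_left (c : ℝ) (α : ExteriorAlgebra ℝ (Module.Dual ℝ V))
    (ξ : ExteriorAlgebra ℝ V) : stmul (c • α) ξ = c • stmul α ξ :=
  (GradedTensorProduct.of ℝ _ _).map_smul c (α ⊗ₜ[ℝ] ξ)

theorem stmul_sub_left (α α' : ExteriorAlgebra ℝ (Module.Dual ℝ V)) (ξ : ExteriorAlgebra ℝ V) :
    stmul (α - α') ξ = stmul α ξ - stmul α' ξ :=
  congrArg (GradedTensorProduct.of ℝ _ _) (TensorProduct.sub_tmul _ _ _)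

theorem superHom_ext {M : Type*} [AddCommGroup M] [Module ℝ M] {f g : SuperAlg V →ₗ[ℝ] M}
    (h : ∀ α ξ, f (stmul α ξ) = g (stmul α ξ)) : f = g :=
  GradedTensorProduct.hom_ext _ _ (TensorProduct.ext' h)

/-- Contraction of the differential form factor is an antiderivation. -/
theorem superContraction_ι_mul (u : V) (φ : Module.Dual ℝ V) (y : SuperAlg V) :
    superContraction u (stmul (ExteriorAlgebra.ι ℝ φ) 1 * y) =
      φ u • y - stmul (ExteriorAlgebra.ι ℝ φ) 1 * superContraction u y := by
  have h : superContraction u ∘ₗ LinearMap.mulLeft ℝ (stmul (ExteriorAlgebra.ι ℝ φ) 1) =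
      φ u • LinearMap.id -
        LinearMap.mulLeft ℝ (stmul (ExteriorAlgebra.ι ℝ φ) 1) ∘ₗ superContraction u := by
    refine superHom_ext fun α ξ => ?_
    change superContraction u (stmul (ExteriorAlgebra.ι ℝ φ) 1 * stmul α ξ) =
      φ u • stmul α ξ - stmul (ExteriorAlgebra.ι ℝ φ) 1 * superContraction u (stmul α ξ)
    rw [stmul_mul_stmul, superContraction_stmul, superContraction_stmul, stmul_mul_stmul,
      contraction_ι_mul, stmul_sub_left, stmul_smul_left]
    rfl
  exact LinearMap.congr_fun h y

theorem superContraction_one (u : V) (ξ : ExteriorAlgebra ℝ V) :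
    superContraction u (stmul 1 ξ) = 0 := by
  rw [superContraction_stmul, contraction_one]
  exact (congrArg (GradedTensorProduct.of ℝ _ _) (TensorProduct.zero_tmul _ _)).trans
    (map_zero _)

theorem stmul_ι_mul_stmul_ι_mul (v : V) (φ : Module.Dual ℝ V) (y : SuperAlg V) :
    stmul 1 (ExteriorAlgebra.ι ℝ v) * (stmul (ExteriorAlgebra.ι ℝ φ) 1 * y) =
      -(stmul (ExteriorAlgebra.ι ℝ φ) 1 * (stmul 1 (ExteriorAlgebra.ι ℝ v) * y)) := by
  rw [← mul_assoc, stmul_ι_anticomm, neg_mul, mul_assoc]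

/-- Contraction of the differential form factor is an antiderivation which annihilates `V`. -/
theorem superContraction_one_ι_mul (u v : V) (y : SuperAlg V) :
    superContraction u (stmul 1 (ExteriorAlgebra.ι ℝ v) * y) =
      -(stmul 1 (ExteriorAlgebra.ι ℝ v) * superContraction u y) := by
  induction y using superAlg_induction with
  | hadd x y hx hy => rw [mul_add, map_add, hx, hy, map_add, mul_add, neg_add]
  | hone ξ =>
    rw [← stmul_one_mul, superContraction_one, superContraction_one, mul_zero, neg_zero]
  | hι φ y ih =>
    rw [stmul_ι_mul_stmul_ι_mul, map_neg, superContraction_ι_mul, superContraction_ι_mul, ih,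
      mul_sub, mul_smul_comm, stmul_ι_mul_stmul_ι_mul, mul_neg]

theorem superProj_ι_mul (φ : Module.Dual ℝ V) (y : SuperAlg V) :
    superProj (stmul (ExteriorAlgebra.ι ℝ φ) 1 * y) = 0 := by
  have h : superProj ∘ₗ LinearMap.mulLeft ℝ (stmul (V := V) (ExteriorAlgebra.ι ℝ φ) 1) = 0 := by
    refine superHom_ext fun α ξ => ?_
    change superProj (stmul (ExteriorAlgebra.ι ℝ φ) 1 * stmul α ξ) = 0
    rw [stmul_mul_stmul, superProj_stmul, algebraMapInv_ι_mul, zero_smul]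
  exact LinearMap.congr_fun h y

/-- The projection on degree zero forms is linear over `⋀V`. -/
theorem superProj_one_mul (ξ : ExteriorAlgebra ℝ V) (y : SuperAlg V) :
    superProj (stmul 1 ξ * y) = ξ * superProj y := by
  induction ξ using exteriorAlgebra_induction generalizing y with
  | hr r =>
    have h : stmul (V := V) 1 (algebraMap ℝ _ r) = r • (1 : SuperAlg V) := by
      rw [← superIncl_apply, AlgHom.commutes, Algebra.algebraMap_eq_smul_one]
    rw [h, smul_mul_assoc, one_mul, map_smul, Algebra.algebraMap_eq_smul_one, smul_mul_assoc,
      one_mul]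
  | hadd x y' hx hy =>
    have h : stmul (V := V) 1 (x + y') = stmul 1 x + stmul 1 y' :=
      congrArg (GradedTensorProduct.of ℝ _ _) (TensorProduct.tmul_add _ _ _)
    rw [h, add_mul, map_add, hx, hy, add_mul]
  | hι v w ih =>
    rw [stmul_one_mul, mul_assoc, mul_assoc, ← ih]
    generalize stmul 1 w * y = z
    induction z using superAlg_induction with
    | hadd x y hx hy => rw [mul_add, map_add, hx, hy, map_add, mul_add]
    | hone ξ =>
      rw [← stmul_one_mul, superProj_stmul, superProj_stmul, map_one, one_smul, one_smul]
    | hι φ y _ =>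
      rw [stmul_ι_mul_stmul_ι_mul, map_neg, superProj_ι_mul, superProj_ι_mul, mul_zero, neg_zero]

variable {d : ℕ} (e : OrthonormalBasis (Fin d) ℝ V)

theorem fNil_mul (t : ℝ) (X : so V) (y : SuperAlg V) : fNil e t X * y =
    t • ∑ k, stmul (ExteriorAlgebra.ι ℝ (innerₗ V (e k))) 1 *
      (stmul 1 (ExteriorAlgebra.ι ℝ (e k)) * y) +
    (1 / 2 : ℝ) • (superIncl (bivector e X) * y) := by
  rw [fNil, add_mul, smul_mul_assoc, smul_mul_assoc, Finset.sum_mul]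
  congr 2
  exact Finset.sum_congr rfl fun k _ => by rw [stmul_eq_mul, mul_assoc]

theorem superContraction_bivector_mul (X : so V) (u : V) (y : SuperAlg V) :
    superContraction u (superIncl (bivector e X) * y) =
      superIncl (bivector e X) * superContraction u y := by
  rw [bivector_eq_sum, map_smul, map_sum, smul_mul_assoc, smul_mul_assoc, map_smul,
    Finset.sum_mul, Finset.sum_mul, map_sum]
  congr 1
  refine Finset.sum_congr rfl fun k _ => ?_
  rw [map_mul superIncl, superIncl_apply, superIncl_apply, mul_assoc, superContraction_one_ι_mul,
    superContraction_one_ι_mul, mul_neg, neg_neg, mul_assoc]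

/-- The contraction of `f_t(X)` by `u` is `t u`. -/
theorem superContraction_fNil_mul (t : ℝ) (X : so V) (u : V) (y : SuperAlg V) :
    superContraction u (fNil e t X * y) =
      (t • superIncl (ExteriorAlgebra.ι ℝ u)) * y + fNil e t X * superContraction u y := by
  have hu : (superIncl (ExteriorAlgebra.ι ℝ u) : SuperAlg V) * y =
      ∑ k, ⟪e k, u⟫ • (stmul 1 (ExteriorAlgebra.ι ℝ (e k)) * y) := by
    conv_lhs => rw [← e.sum_repr' u]
    simp only [map_sum, map_smul, Finset.sum_mul, smul_mul_assoc]
    rfl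
  rw [fNil_mul, fNil_mul, map_add, map_smul, map_smul, superContraction_bivector_mul, map_sum,
    smul_mul_assoc, hu, ← add_assoc, ← smul_add, ← Finset.sum_add_distrib]
  congr 2
  refine Finset.sum_congr rfl fun k _ => ?_
  rw [superContraction_ι_mul, superContraction_one_ι_mul, mul_neg, sub_neg_eq_add]
  rfl

theorem commute_superIncl_fNil (t : ℝ) (X : so V) (u : V) :
    Commute (superIncl (ExteriorAlgebra.ι ℝ u)) (fNil e t X) := by
  refine Commute.add_right (Commute.smul_right (Commute.sum_right _ _ _ fun k _ => ?_) _)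
    (Commute.smul_right ?_ _)
  · change superIncl _ * _ = _ * superIncl _
    have h : ExteriorAlgebra.ι ℝ u * ExteriorAlgebra.ι ℝ (e k) =
        -(ExteriorAlgebra.ι ℝ (e k) * ExteriorAlgebra.ι ℝ u) :=
      eq_neg_of_add_eq_zero_left (ExteriorAlgebra.ι_add_mul_swap _ _)
    rw [stmul_eq_mul, superIncl_apply, stmul_ι_mul_stmul_ι_mul, ← superIncl_apply,
      ← superIncl_apply, ← map_mul, h, map_neg, mul_neg, neg_neg, map_mul, mul_assoc]
  · exact (commute_ι_of_mem_two (bivector_mem e X) u).map superIncl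

/-- The summands `dx_k e_k` have square zero and commute with each other and with the bivector. -/
theorem isNilpotent_fNil (t : ℝ) (X : so V) : IsNilpotent (fNil e t X) := by
  have hB : IsNilpotent (superIncl (bivector e X)) :=
    ⟨d + 1, by rw [← map_pow, bivector_pow_eq_zero, map_zero]⟩
  have hmul : ∀ (φ ψ : Module.Dual ℝ V) (v w : V),
      stmul (ExteriorAlgebra.ι ℝ φ) (ExteriorAlgebra.ι ℝ v) *
        stmul (ExteriorAlgebra.ι ℝ ψ) (ExteriorAlgebra.ι ℝ w) =
      -(stmul (ExteriorAlgebra.ι ℝ φ * ExteriorAlgebra.ι ℝ ψ) 1 *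
        stmul 1 (ExteriorAlgebra.ι ℝ v * ExteriorAlgebra.ι ℝ w)) := by
    intro φ ψ v w
    rw [stmul_eq_mul (ExteriorAlgebra.ι ℝ φ), stmul_eq_mul (ExteriorAlgebra.ι ℝ ψ), mul_assoc,
      stmul_ι_mul_stmul_ι_mul, mul_neg, stmul_mul_one, stmul_one_mul, mul_assoc]
  have hc : ∀ (φ ψ : Module.Dual ℝ V) (v w : V),
      Commute (stmul (ExteriorAlgebra.ι ℝ φ) (ExteriorAlgebra.ι ℝ v))
        (stmul (ExteriorAlgebra.ι ℝ ψ) (ExteriorAlgebra.ι ℝ w)) := by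
    intro φ ψ v w
    change _ * _ = _ * _
    rw [hmul, hmul, eq_neg_of_add_eq_zero_left (ExteriorAlgebra.ι_add_mul_swap φ ψ),
      eq_neg_of_add_eq_zero_left (ExteriorAlgebra.ι_add_mul_swap v w), ← superIncl_apply (V := V),
      map_neg, superIncl_apply, ← neg_one_smul ℝ (ExteriorAlgebra.ι ℝ ψ * _), stmul_smul_left,
      neg_one_smul, neg_mul_neg]
  have hA : IsNilpotent (∑ k, stmul (ExteriorAlgebra.ι ℝ (innerₗ V (e k)))
      (ExteriorAlgebra.ι ℝ (e k))) := by
    refine Commute.isNilpotent_sum (fun k _ => ⟨2, ?_⟩) fun i j _ _ => hc _ _ _ _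
    rw [pow_two, hmul, ExteriorAlgebra.ι_sq_zero (e k), ← superIncl_apply, map_zero, mul_zero,
      neg_zero]
  have hAB : Commute (∑ k, stmul (ExteriorAlgebra.ι ℝ (innerₗ V (e k)))
      (ExteriorAlgebra.ι ℝ (e k))) (superIncl (bivector e X)) := by
    refine Commute.sum_left _ _ _ fun k _ => ?_
    have h1 : Commute (stmul (V := V) (ExteriorAlgebra.ι ℝ (innerₗ V (e k))) 1)
        (superIncl (bivector e X)) := by
      rw [bivector_eq_sum, map_smul, map_sum]
      refine Commute.smul_right (Commute.sum_right _ _ _ fun l _ => ?_) _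
      change _ * _ = _ * _
      rw [map_mul, superIncl_apply, superIncl_apply, mul_assoc (stmul 1 _), stmul_ι_anticomm,
        mul_neg, stmul_ι_mul_stmul_ι_mul, neg_neg]
    rw [stmul_eq_mul]
    exact h1.mul_left ((commute_ι_of_mem_two (bivector_mem e X) (e k)).map superIncl)
  exact Commute.isNilpotent_add (((hAB.smul_left t).smul_right (1 / 2 : ℝ))) (hA.smul t)
    (hB.smul _)

variable [FiniteDimensional ℝ V]

/-- The components of the Berezin integral of `exp(f_t(X)) w`: contracting with a vector `u`
amounts to replacing `w` by `t u w`, which reduces the computation to the component of degree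
zero. -/
theorem toAlt_superBerezin_nilExp (t : ℝ) (X : so V) (w : ExteriorAlgebra ℝ V) (p : ℕ) :
    toAlt (superBerezin e (nilExp (fNil e t X) * superIncl w)) p =
      t ^ p • coeffForm e p (bivectorExp e X * w) := by
  induction p generalizing w with
  | zero =>
    ext v
    have h1 : ∀ y : SuperAlg V, ExteriorAlgebra.algebraMapInv (superBerezin e y) =
        berezin e (superProj y) := by
      have h : (ExteriorAlgebra.algebraMapInv (R := ℝ) (M := Module.Dual ℝ V)).toLinearMap ∘ₗ
          superBerezin e = berezin e ∘ₗ superProj := by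
        refine superHom_ext fun α ξ => ?_
        change ExteriorAlgebra.algebraMapInv (superBerezin e (stmul α ξ)) =
          berezin e (superProj (stmul α ξ))
        rw [superBerezin_stmul, superProj_stmul, map_smul, map_smul, smul_eq_mul, smul_eq_mul,
          mul_comm]
      exact LinearMap.congr_fun h
    rw [toAlt_zero_apply, h1, map_nilExp_mul superProj (isNilpotent_fNil e t X)
      (isNilpotent_bivector e (1 / 2) X) (fun y => ?_)]
    · rw [superIncl_apply, superProj_stmul, map_one, one_smul, pow_zero, one_smul,
        coeffForm_zero_apply]
      rfl
    · rw [fNil_mul, map_add, map_smul, map_sum, Finset.sum_eq_zero fun k _ => superProj_ι_mul _ _,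
        smul_zero, zero_add, map_smul, superIncl_apply, superProj_one_mul, smul_mul_assoc]
  | succ p ih =>
    have hS : ∀ (u : V) (y : SuperAlg V), contraction (Module.Dual.eval ℝ V u)
        (superBerezin e y) = superBerezin e (superContraction u y) := by
      intro u
      have h : contraction (Module.Dual.eval ℝ V u) ∘ₗ superBerezin e =
          superBerezin e ∘ₗ superContraction u := by
        refine superHom_ext fun α ξ => ?_
        change contraction _ (superBerezin e (stmul α ξ)) =
          superBerezin e (superContraction u (stmul α ξ))
        rw [superBerezin_stmul, superContraction_stmul, superBerezin_stmul, map_smul]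
      exact LinearMap.congr_fun h
    refine alternating_ext_curryLeft fun u => ?_
    have hE : superContraction u (nilExp (fNil e t X) * superIncl w) =
        t • (nilExp (fNil e t X) * superIncl (ExteriorAlgebra.ι ℝ u * w)) := by
      have h := derivation_nilExp_mul (superContraction u) (isNilpotent_fNil e t X)
        ((commute_superIncl_fNil e t X u).smul_left t)
        (superContraction_fNil_mul e t X u) (superIncl w)
      rw [superIncl_apply w, superContraction_one, mul_zero, add_zero, ← superIncl_apply] at h
      rw [h, smul_mul_assoc, ← mul_assoc,
        (Commute.nilExp_right (commute_superIncl_fNil e t X u)).eq,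
        mul_assoc, map_mul]
    rw [curryLeft_toAlt, hS, hE, map_smul, toAlt_smul, ih]
    change _ = t ^ (p + 1) • (coeffForm e (p + 1) (bivectorExp e X * w)).curryLeft u
    rw [coeffForm_curryLeft, ← mul_assoc (ExteriorAlgebra.ι ℝ u),
      (commute_ι_bivectorExp e u X).eq, mul_assoc, smul_smul, pow_succ']

/-- The component of degree `p` of `T(exp f_t)` is a Gaussian times a constant form. -/
theorem formC_eq (t : ℝ) (X : so V) (p : ℕ) (x : V) : formC e t X p x =
    (Real.exp (-t ^ 2 * ‖x‖ ^ 2) * t ^ p) • coeffForm e p (bivectorExp e X) := by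
  have h := toAlt_superBerezin_nilExp e t X 1 p
  rw [map_one, mul_one, mul_one] at h
  rw [formC, expF, map_smul, toAlt_smul, h, smul_smul]

/-- The vector `x` multiplying `exp f_t` becomes a contraction by `x`, that is, by the Euler vector
field. -/
theorem formEta_eq (t : ℝ) (X : so V) (p : ℕ) (x : V) : formEta e t X p x =
    -((Real.exp (-t ^ 2 * ‖x‖ ^ 2) * t ^ p) •
      (coeffForm e (p + 1) (bivectorExp e X)).curryLeft x) := by
  have hx : (∑ k, ⟪e k, x⟫ • stmul 1 (ExteriorAlgebra.ι ℝ (e k)) : SuperAlg V) =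
      superIncl (ExteriorAlgebra.ι ℝ x) := by
    conv_rhs => rw [← e.sum_repr' x]
    simp only [map_sum, map_smul]
    rfl
  rw [formEta, hx, expF, mul_smul_comm, (Commute.nilExp_right (commute_superIncl_fNil e t X x)).eq,
    map_smul, toAlt_smul, toAlt_superBerezin_nilExp, smul_smul, coeffForm_curryLeft,
    (commute_ι_bivectorExp e x X).eq]

end SuperExp

/-! ### The Mathai–Quillen form -/

section MathaiQuillen

open MeasureTheory Filter
open scoped SchwartzMap

variable {V : Type*} [NormedAddCommGroup V] [InnerProductSpace ℝ V]

/-- Completion of the square after bounding `1 + r` by `exp r`. -/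
theorem add_pow_mul_exp_neg_sq_le (M : ℕ) (r : ℝ) (hr : 0 ≤ r) :
    (1 + r) ^ M * Real.exp (-r ^ 2) ≤ Real.exp (M ^ 2 / 4) := by
  have h1 : (1 + r) ^ M ≤ Real.exp (M * r) := by
    rw [Real.exp_nat_mul]
    gcongr
    linarith [Real.add_one_le_exp r]
  calc (1 + r) ^ M * Real.exp (-r ^ 2) ≤ Real.exp (M * r) * Real.exp (-r ^ 2) := by gcongr
    _ = Real.exp (M * r - r ^ 2) := by rw [← Real.exp_add]; ring_nf
    _ ≤ _ := Real.exp_le_exp.2 (by nlinarith [sq_nonneg (r - M / 2)])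

theorem contDiff_exp_neg_norm_sq : ContDiff ℝ ∞ fun x : V => Real.exp (-‖x‖ ^ 2) :=
  Real.contDiff_exp.comp (contDiff_norm_sq ℝ).neg

/-- The derivatives of the Gaussian are rapidly decreasing. -/
theorem exp_neg_norm_sq_decay (k n : ℕ) : ∃ C : ℝ, ∀ x : V,
    ‖x‖ ^ k * ‖iteratedFDeriv ℝ n (fun x : V => Real.exp (-‖x‖ ^ 2)) x‖ ≤ C := by
  have hq : (fun x : V => -‖x‖ ^ 2).HasTemperateGrowth :=
    (Function.hasTemperateGrowth_norm_sq V).neg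
  obtain ⟨m, C, hC, hb⟩ := hq.norm_iteratedFDeriv_le_uniform n
  refine ⟨n.factorial * (max C 1) ^ n * Real.exp ((k + m * n : ℕ) ^ 2 / 4), fun x => ?_⟩
  have h1 : (1 : ℝ) ≤ 1 + ‖x‖ := by linarith [norm_nonneg x]
  have hD1 : 1 ≤ max C 1 * (1 + ‖x‖) ^ m :=
    one_le_mul_of_one_le_of_one_le (le_max_right _ _) (one_le_pow₀ h1)
  have h2 := norm_iteratedFDeriv_comp_le (g := Real.exp) (f := fun x : V => -‖x‖ ^ 2) (n := n)
    (N := ∞) (C := Real.exp (-‖x‖ ^ 2)) (D := max C 1 * (1 + ‖x‖) ^ m) Real.contDiff_exp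
    (contDiff_norm_sq ℝ).neg (by exact_mod_cast le_top) x
    (fun i _ => by
      rw [norm_iteratedFDeriv_eq_norm_iteratedDeriv, iteratedDeriv_eq_iterate, Real.iter_deriv_exp,
        Real.norm_of_nonneg (Real.exp_pos _).le])
    (fun i hi hin => by
      refine (hb i hin x).trans (le_trans ?_ (le_self_pow₀ hD1 (by omega)))
      gcongr
      exact le_max_left _ _)
  have h3 : ‖x‖ ^ k ≤ (1 + ‖x‖) ^ k := by gcongr; linarith
  calc _ ≤ (1 + ‖x‖) ^ k * (n.factorial * Real.exp (-‖x‖ ^ 2) * (max C 1 * (1 + ‖x‖) ^ m) ^ n) := by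
        gcongr
        exact h2
    _ = n.factorial * (max C 1) ^ n * ((1 + ‖x‖) ^ (k + m * n) * Real.exp (-‖x‖ ^ 2)) := by
        rw [mul_pow, ← pow_mul, pow_add]
        ring
    _ ≤ _ := by
        gcongr
        exact add_pow_mul_exp_neg_sq_le _ _ (norm_nonneg x)

theorem exists_schwartzMap_exp_neg_norm_sq_smul {G : Type*} [NormedAddCommGroup G]
    [NormedSpace ℝ G] (c : G) : ∃ s : 𝓢(V, G), ⇑s = fun x => Real.exp (-‖x‖ ^ 2) • c := by
  have hs : ContDiff ℝ ∞ fun x : V => Real.exp (-‖x‖ ^ 2) • c :=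
    contDiff_exp_neg_norm_sq.smul contDiff_const
  refine ⟨⟨fun x => Real.exp (-‖x‖ ^ 2) • c, hs, fun k n => ?_⟩, rfl⟩
  obtain ⟨C, hC⟩ := exp_neg_norm_sq_decay (V := V) k n
  refine ⟨‖(ContinuousLinearMap.id ℝ ℝ).smulRight c‖ * C, fun x => ?_⟩
  have h := ((ContinuousLinearMap.id ℝ ℝ).smulRight c).norm_iteratedFDeriv_comp_left
    (f := fun x : V => Real.exp (-‖x‖ ^ 2)) (x := x) (N := ∞) (n := n)
    contDiff_exp_neg_norm_sq.contDiffAt (by exact_mod_cast le_top)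
  calc _ ≤ ‖x‖ ^ k * (‖(ContinuousLinearMap.id ℝ ℝ).smulRight c‖ *
        ‖iteratedFDeriv ℝ n (fun x : V => Real.exp (-‖x‖ ^ 2)) x‖) := by
        gcongr
        exact h
    _ = ‖(ContinuousLinearMap.id ℝ ℝ).smulRight c‖ *
        (‖x‖ ^ k * ‖iteratedFDeriv ℝ n (fun x : V => Real.exp (-‖x‖ ^ 2)) x‖) := by ring
    _ ≤ _ := by
        gcongr
        exact hC x

theorem hasFDerivAt_exp_neg_norm_sq (x : V) : HasFDerivAt (fun x : V => Real.exp (-‖x‖ ^ 2))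
    ((-2 * Real.exp (-‖x‖ ^ 2)) • innerSL ℝ x) x := by
  have h : (-2 * Real.exp (-‖x‖ ^ 2)) • innerSL ℝ x =
      Real.exp (-‖x‖ ^ 2) • -(2 • innerSL ℝ x) := by
    ext v
    simp
    ring
  rw [h]
  exact (hasStrictFDerivAt_norm_sq x).hasFDerivAt.neg.exp

variable [FiniteDimensional ℝ V] [MeasurableSpace V] [BorelSpace V]

theorem extDeriv_smul_const {p : ℕ} {f : V → ℝ} {x : V} (hf : DifferentiableAt ℝ f x)
    (c : V [⋀^Fin p]→L[ℝ] ℝ) : extDeriv (fun y => f y • c) x =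
      ContinuousAlternatingMap.alternatizeUncurryFin ((fderiv ℝ f x).smulRight c) := by
  rw [extDeriv_smul_apply hf (differentiableAt_const c), extDeriv_fun_const, smul_zero, zero_add]

theorem alternatizeUncurryFin_smul_inner {p : ℕ} (a : ℝ) (x : V) (c : V [⋀^Fin p]→L[ℝ] ℝ) :
    ContinuousAlternatingMap.alternatizeUncurryFin ((a • innerSL ℝ x).smulRight c) =
      a • ContinuousAlternatingMap.alternatizeUncurryFin ((innerSL ℝ x).smulRight c) := by
  rw [← ContinuousAlternatingMap.alternatizeUncurryFin_smul]
  congr 1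
  ext y v
  simp [mul_assoc]

variable {d : ℕ} (e : OrthonormalBasis (Fin d) ℝ V)

theorem formC_one_eq (X : so V) (p : ℕ) (x : V) : formC e 1 X p x =
    Real.exp (-‖x‖ ^ 2) • coeffForm e p (bivectorExp e X) := by
  rw [formC_eq]
  norm_num

/-- The form `T(exp f_1)` is a Gaussian times a linear function of `exp(½ω_X)`, hence rapidly
decreasing and polynomial in `X`. -/
theorem formC_one_mem : formC e 1 ∈ eqForms (rapidForms V) := by
  let K : ExteriorAlgebra ℝ V →ₗ[ℝ] Form V :=
    { toFun := fun w p x => Real.exp (-‖x‖ ^ 2) • coeffForm e p w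
      map_add' := fun w w' => by
        funext p x
        rw [map_add, smul_add]
        rfl
      map_smul' := fun c w => by
        funext p x
        rw [map_smul, smul_comm]
        rfl }
  have hK : ∀ w, K w ∈ rapidForms V := fun w =>
    mem_rapidForms.2 fun p => exists_schwartzMap_exp_neg_norm_sq_smul (coeffForm e p w)
  have h : formC e 1 = fun X => K (bivectorExp e X) := by
    funext X p x
    exact formC_one_eq e X p x
  refine mem_eqForms.2 ⟨?_, fun g hg X p x v => ?_⟩
  · rw [h]
    exact bivectorExp_mem_polyMaps e K hK
  · rw [formC_one_eq, formC_one_eq, g.norm_map, ContinuousAlternatingMap.smul_apply,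
      ContinuousAlternatingMap.smul_apply, coeffForm_bivectorExp_Ad e hg]

/-- The differential of `exp(-‖x‖²)` is `-exp(-‖x‖²) d‖x‖²`, so `curryLeft_coeffForm_bivectorExp`
says that `T(exp f_1)` is closed. -/
theorem eqDiff_formC_one : eqDiff ⊤ (formC e 1) = 0 := by
  funext X p x
  have hv (q : ℕ) : (formC e 1 X (q + 1) x).curryLeft (vecField X x) =
      -(Real.exp (-‖x‖ ^ 2) •
        (coeffForm e (q + 1) (bivectorExp e X)).curryLeft ((X : Module.End ℝ V) x)) := by
    rw [formC_one_eq, vecField, map_neg]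
    rfl
  cases p with
  | zero =>
    change 0 - (formC e 1 X 1 x).curryLeft (vecField X x) = 0
    rw [hv, curryLeft_coeffForm_one_bivectorExp, smul_zero, neg_zero, sub_zero]
  | succ p =>
    rw [eqDiff_apply_succ, hv, curryLeft_coeffForm_bivectorExp]
    have h : formC e 1 X p = fun x => Real.exp (-‖x‖ ^ 2) • coeffForm e p (bivectorExp e X) :=
      funext fun x => formC_one_eq e X p x
    have hd := hasFDerivAt_exp_neg_norm_sq x
    rw [h, extDeriv_smul_const hd.differentiableAt, hd.fderiv, alternatizeUncurryFin_smul_inner]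
    ext v
    simp
    ring

/-- The top component of `T(exp f_1)` is `±exp(-‖x‖²)`, with Gaussian integral. -/
theorem formIntegral_formC_one (X : so V) :
    formIntegral e (formC e 1 X) = epsilon d := by
  have h : ∀ x, formC e 1 X d x (fun k => e k) =
      Real.exp (-1 * ‖x‖ ^ 2) * (-1 : ℝ) ^ (d * (d - 1) / 2) := by
    intro x
    rw [formC_one_eq, ContinuousAlternatingMap.smul_apply, coeffForm_top_bivectorExp, smul_eq_mul]
    norm_num
  have hd : Module.finrank ℝ V = d := by
    rw [Module.finrank_eq_card_basis e.toBasis, Fintype.card_fin]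
  rw [formIntegral, epsilon]
  simp_rw [h]
  rw [integral_mul_const, GaussianFourier.integral_rexp_neg_mul_sq_norm one_pos, hd, div_one,
    mul_comm]

end MathaiQuillen

/-! ### The relative Thom form -/

section RelativeThom

open MeasureTheory Filter

variable {V : Type*} [NormedAddCommGroup V] [InnerProductSpace ℝ V]

/-- The function `½ Γ((p+1)/2) ‖x‖^{-(p+1)} = ∫₀^∞ t^p exp(-t²‖x‖²) dt` on `V ∖ {0}`. At `x = 0` its
value is `0`, in accordance with the extension by zero of forms on `V ∖ {0}`. -/
def radialCoeff (p : ℕ) (x : V) : ℝ :=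
  1 / 2 * Real.Gamma ((p + 1) / 2) * (‖x‖ ^ 2) ^ (-((p : ℝ) + 1) / 2)

theorem integral_exp_mul_pow {x : V} (hx : x ≠ 0) (p : ℕ) :
    ∫ t in Set.Ioi (0 : ℝ), Real.exp (-t ^ 2 * ‖x‖ ^ 2) * t ^ p = radialCoeff p x := by
  have hb : 0 < ‖x‖ ^ 2 := by positivity
  have h := integral_rpow_mul_exp_neg_mul_rpow (p := 2) (q := p) two_pos
    (lt_of_lt_of_le neg_one_lt_zero p.cast_nonneg) hb
  have h' : ∀ t : ℝ, t ^ (p : ℝ) * Real.exp (-‖x‖ ^ 2 * t ^ (2 : ℝ)) =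
      Real.exp (-t ^ 2 * ‖x‖ ^ 2) * t ^ p := by
    intro t
    rw [Real.rpow_natCast, Real.rpow_two, mul_comm]
    congr 2
    ring
  simp_rw [h'] at h
  rw [h, radialCoeff]
  ring

theorem radialCoeff_zero_apply (p : ℕ) : radialCoeff p (0 : V) = 0 := by
  rw [radialCoeff, norm_zero, zero_pow two_ne_zero, Real.zero_rpow, mul_zero]
  have : (0 : ℝ) < p + 1 := by positivity
  simp only [ne_eq, div_eq_zero_iff, neg_eq_zero]
  rintro (h | h) <;> linarith

theorem contDiffAt_radialCoeff (p : ℕ) {x : V} (hx : x ≠ 0) :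
    ContDiffAt ℝ ∞ (radialCoeff p) x :=
  contDiffAt_const.mul ((contDiff_norm_sq ℝ).contDiffAt.rpow_const_of_ne (by positivity))

theorem norm_sq_mul_radialCoeff_add_two (p : ℕ) {x : V} (hx : x ≠ 0) :
    ‖x‖ ^ 2 * radialCoeff (p + 2) x = (p + 1) / 2 * radialCoeff p x := by
  have hb : 0 < ‖x‖ ^ 2 := by positivity
  have h1 : ((p + 2 : ℕ) + 1 : ℝ) / 2 = (p + 1) / 2 + 1 := by push_cast; ring
  have h2 : -((p + 2 : ℕ) + 1 : ℝ) / 2 = -(p + 1) / 2 - 1 := by push_cast; ring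
  rw [radialCoeff, radialCoeff, h1, h2, Real.Gamma_add_one (by positivity), Real.rpow_sub hb,
    Real.rpow_one]
  field_simp

theorem norm_sq_mul_radialCoeff_one {x : V} (hx : x ≠ 0) :
    ‖x‖ ^ 2 * radialCoeff 1 x = 1 / 2 := by
  have hb : 0 < ‖x‖ ^ 2 := by positivity
  rw [radialCoeff]
  norm_num
  rw [Real.rpow_neg_one]
  field_simp

/-- With `ρ_p` for `radialCoeff p`, this says `dρ_p = -ρ_{p+2} d‖x‖²`. -/
theorem hasFDerivAt_radialCoeff (p : ℕ) {x : V} (hx : x ≠ 0) :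
    HasFDerivAt (radialCoeff p) ((-2 * radialCoeff (p + 2) x) • innerSL ℝ x) x := by
  have hb : 0 < ‖x‖ ^ 2 := by positivity
  have h := ((hasStrictFDerivAt_norm_sq x).hasFDerivAt.rpow_const
    (p := -((p : ℝ) + 1) / 2) (Or.inl hb.ne')).const_mul (1 / 2 * Real.Gamma ((p + 1) / 2))
  have h2 : (-2 * radialCoeff (p + 2) x) • innerSL ℝ x =
      (1 / 2 * Real.Gamma ((p + 1) / 2)) •
        ((-((p : ℝ) + 1) / 2 * (‖x‖ ^ 2) ^ (-((p : ℝ) + 1) / 2 - 1)) • 2 • innerSL ℝ x) := by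
    have h3 : radialCoeff (p + 2) x = (p + 1) / 2 * (1 / 2 * Real.Gamma ((p + 1) / 2)) *
        (‖x‖ ^ 2) ^ (-((p : ℝ) + 1) / 2 - 1) := by
      have h4 : ‖x‖ ^ 2 * radialCoeff (p + 2) x = (p + 1) / 2 *
          (1 / 2 * Real.Gamma ((p + 1) / 2) * (‖x‖ ^ 2) ^ (-((p : ℝ) + 1) / 2)) :=
        norm_sq_mul_radialCoeff_add_two p hx
      rw [Real.rpow_sub hb, Real.rpow_one]
      field_simp at h4 ⊢
      linarith
    rw [h3]
    ext v
    simp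
    ring
  rw [h2]
  exact h

variable [FiniteDimensional ℝ V] [MeasurableSpace V] [BorelSpace V] {d : ℕ}
  (e : OrthonormalBasis (Fin d) ℝ V)

/-- The integral over `t` in the definition of `β_∧` is a Gamma integral. -/
theorem formBeta_eq (X : so V) (p : ℕ) (x : V) : formBeta e X p x =
    -radialCoeff p x • (coeffForm e (p + 1) (bivectorExp e X)).curryLeft x := by
  by_cases hx : x = 0
  · subst hx
    rw [radialCoeff_zero_apply]
    ext v
    simp [formBeta, punctured]
  · refine (Set.indicator_of_mem (s := (punctured V : Set V)) hx _).trans ?_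
    simp_rw [formEta_eq]
    rw [integral_neg, integral_smul_const, integral_exp_mul_pow hx]
    exact (neg_smul _ _).symm

theorem formBeta_mem : formBeta e ∈ eqForms (smoothForms (punctured V)) := by
  let K : ExteriorAlgebra ℝ V →ₗ[ℝ] Form V :=
    { toFun := fun w p x => -radialCoeff p x • (coeffForm e (p + 1) w).curryLeft x
      map_add' := fun w w' => by
        funext p x
        ext v
        simp
      map_smul' := fun c w => by
        funext p x
        ext v
        simp
        ring }
  have hK : ∀ w, K w ∈ smoothForms (punctured V) := by
    refine fun w p => ⟨fun x hx => ContDiffAt.contDiffWithinAt ?_, fun x hx => ?_⟩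
    · exact (contDiffAt_radialCoeff p hx).neg.smul
        (contDiff_curryLeft_self (contDiff_const (c := coeffForm e (p + 1) w))).contDiffAt
    · have hx0 : x = 0 := by simpa [punctured] using hx
      change -radialCoeff p x • (coeffForm e (p + 1) w).curryLeft x = 0
      rw [hx0, radialCoeff_zero_apply]
      ext v
      simp
  have h : formBeta e = fun X => K (bivectorExp e X) := by
    funext X p x
    exact formBeta_eq e X p x
  refine mem_eqForms.2 ⟨?_, fun g hg X p x v => ?_⟩
  · rw [h]
    exact bivectorExp_mem_polyMaps e K hK
  · have h1 : radialCoeff p (g x) = radialCoeff p x := by simp [radialCoeff]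
    have h2 := coeffForm_bivectorExp_Ad e hg X (p + 1) (Matrix.vecCons x v)
    have h3 : (fun i => g (Matrix.vecCons x v i)) = Matrix.vecCons (g x) fun i => g (v i) := by
      funext i
      refine Fin.cases ?_ (fun i => ?_) i <;> rfl
    rw [h3] at h2
    rw [formBeta_eq, formBeta_eq, h1]
    exact congrArg (fun r => -radialCoeff p x * r) h2

theorem formPf_zero (X : so V) (x : V) : formPf e X 0 x = coeffForm e 0 (bivectorExp e X) := by
  ext v
  rw [coeffForm_zero_bivectorExp]
  rfl

theorem formPf_mem : formPf e ∈ eqForms (smoothForms (⊤ : TopologicalSpace.Opens V)) := by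
  let K : ExteriorAlgebra ℝ V →ₗ[ℝ] Form V :=
    { toFun := fun w p _ => match p with
        | 0 => coeffForm e 0 w
        | _ + 1 => 0
      map_add' := fun w w' => by
        funext p x
        cases p with
        | zero => exact map_add (coeffForm e 0) w w'
        | succ p => exact (add_zero _).symm
      map_smul' := fun c w => by
        funext p x
        cases p with
        | zero => exact map_smul (coeffForm e 0) c w
        | succ p => exact (smul_zero c).symm }
  have hK : ∀ w, K w ∈ smoothForms (⊤ : TopologicalSpace.Opens V) := by
    refine fun w => mem_smoothForms_top.2 fun p => ?_
    cases p <;> exact contDiff_const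
  have h : formPf e = fun X => K (bivectorExp e X) := by
    funext X p x
    cases p with
    | zero => exact formPf_zero e X x
    | succ p => rfl
  refine mem_eqForms.2 ⟨?_, fun g hg X p x v => ?_⟩
  · rw [h]
    exact bivectorExp_mem_polyMaps e K hK
  · cases p with
    | zero =>
      rw [formPf_zero, formPf_zero, coeffForm_bivectorExp_Ad e hg]
    | succ p => rfl

theorem eqDiff_formPf : eqDiff ⊤ (formPf e) = 0 := by
  funext X p x
  have hv (q : ℕ) : (formPf e X (q + 1) x).curryLeft (vecField X x) = 0 := rfl
  cases p with
  | zero =>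
    change 0 - (formPf e X 1 x).curryLeft (vecField X x) = 0
    rw [hv, sub_zero]
  | succ p =>
    rw [eqDiff_apply_succ, hv, sub_zero]
    cases p with
    | zero =>
      have h : formPf e X 0 = fun _ => coeffForm e 0 (bivectorExp e X) :=
        funext fun x => formPf_zero e X x
      rw [h, extDeriv_fun_const]
      rfl
    | succ p => exact extDeriv_fun_const 0 x

theorem curryLeft_curryLeft_coeffForm (p : ℕ) (w : ExteriorAlgebra ℝ V) (x y : V) :
    ((coeffForm e (p + 2) w).curryLeft x).curryLeft y =
      -((coeffForm e (p + 2) w).curryLeft y).curryLeft x := by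
  rw [coeffForm_curryLeft, coeffForm_curryLeft, coeffForm_curryLeft, coeffForm_curryLeft,
    ← mul_assoc, ← mul_assoc, eq_neg_of_add_eq_zero_left (ExteriorAlgebra.ι_add_mul_swap y x),
    neg_mul, map_neg]

/-- The transgression formula `D β_∧ = Pf(X/2)` on `V ∖ {0}`. -/
theorem restrictPunctured_formPf :
    restrictPunctured V (formPf e) = eqDiff (punctured V) (formBeta e) := by
  funext X p x
  change (punctured V : Set V).indicator (formPf e X p) x =
    dForm (punctured V) (formBeta e X) p x - (formBeta e X (p + 1) x).curryLeft (vecField X x)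
  have hv (q : ℕ) : (formBeta e X (q + 1) x).curryLeft (vecField X x) =
      -(radialCoeff (q + 1) x • ((coeffForm e (q + 2) (bivectorExp e X)).curryLeft
        ((X : Module.End ℝ V) x)).curryLeft x) := by
    have h := curryLeft_curryLeft_coeffForm e q (bivectorExp e X) x ((X : Module.End ℝ V) x)
    rw [formBeta_eq, vecField, map_neg]
    change -(-radialCoeff (q + 1) x • ((coeffForm e (q + 2) (bivectorExp e X)).curryLeft
      x).curryLeft ((X : Module.End ℝ V) x)) = _
    rw [h]
    ext v
    simp
  by_cases hx : x = 0
  · have hx' : x ∉ (punctured V : Set V) := by simp [punctured, hx]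
    rw [Set.indicator_of_notMem hx', hv, hx, radialCoeff_zero_apply]
    cases p with
    | zero =>
      ext v
      simp [dForm]
    | succ p =>
      rw [dForm, Set.indicator_of_notMem (hx ▸ hx')]
      ext v
      simp
  · have hx' : x ∈ (punctured V : Set V) := hx
    rw [hv]
    refine (Set.indicator_of_mem (s := (punctured V : Set V)) hx' _).trans ?_
    cases p with
    | zero =>
      -- In degree zero `Dβ_∧` is `-ι(VX)` of the component of degree one, and `2 ‖x‖² ρ₁ = 1`.
      have h1 := norm_sq_mul_radialCoeff_one hx
      rw [formPf_zero, curryLeft_coeffForm_bivectorExp]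
      ext v
      change _ = 0 - -(radialCoeff 1 x * (2 * ContinuousAlternatingMap.alternatizeUncurryFin
        ((innerSL ℝ x).smulRight (coeffForm e 0 (bivectorExp e X))) (Matrix.vecCons x v)))
      rw [ContinuousAlternatingMap.alternatizeUncurryFin_apply]
      simp [coeffForm_zero_apply]
      linear_combination (-2 * berezin e (bivectorExp e X)) * h1
    | succ p =>
      -- The component `-ρ_p ι_E c` of degree `p` contributes `-(p + 1) ρ_p c + ρ_{p+2} d‖x‖² ∧ ι_E
      -- c`, the one of degree `p + 2` contributes `ρ_{p+2} ι_E (d‖x‖² ∧ c)`, which is `ρ_{p+2}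
      -- (2‖x‖² c - d‖x‖² ∧ ι_E c)`. The sum vanishes since `‖x‖² ρ_{p+2} = (p + 1) / 2 * ρ_p`.
      set c := coeffForm e (p + 1) (bivectorExp e X) with hc
      have h1 := norm_sq_mul_radialCoeff_add_two p hx
      have hflip := alternatizeUncurryFin_flip_comp ((innerSL ℝ x).smulRight c) x
        ((innerSL ℝ x).smulRight (c.curryLeft x)) (fun y => by
          ext v
          simp)
      have hs : extDeriv (fun y => c.curryLeft y) x = ((p + 1 : ℕ) : ℝ) • c := by
        have h := extDeriv_curryLeft_self (a := fun _ => c) (u := x) (differentiableAt_const c)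
        rw [h, extDeriv_fun_const, fderiv_fun_const]
        ext v
        simp
      have hβ : formBeta e X p = fun y => -radialCoeff p y • c.curryLeft y :=
        funext fun y => formBeta_eq e X p y
      have hd : HasFDerivAt (fun y => -radialCoeff p y)
          ((2 * radialCoeff (p + 2) x) • innerSL ℝ x) x := by
        have h2 : (2 * radialCoeff (p + 2) x) • innerSL ℝ x =
            -((-2 * radialCoeff (p + 2) x) • innerSL ℝ x) := by
          ext v
          simp
        rw [h2]
        exact (hasFDerivAt_radialCoeff p hx).neg
      have hdiff : DifferentiableAt ℝ (fun y => c.curryLeft y) x :=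
        (contDiff_curryLeft_self (contDiff_const (c := c))).differentiable (by simp) x
      have hD : dForm (punctured V) (formBeta e X) (p + 1) x =
          -radialCoeff p x • (((p + 1 : ℕ) : ℝ) • c) + (2 * radialCoeff (p + 2) x) •
            ContinuousAlternatingMap.alternatizeUncurryFin
              ((innerSL ℝ x).smulRight (c.curryLeft x)) := by
        rw [dForm]
        refine (Set.indicator_of_mem (s := (punctured V : Set V)) hx' _).trans ?_
        rw [hβ, extDeriv_smul_apply hd.differentiableAt hdiff, hd.fderiv, hs,
          alternatizeUncurryFin_smul_inner]
      rw [hD, hflip, curryLeft_coeffForm_bivectorExp]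
      change 0 = _
      ext v
      simp
      linear_combination (-2 * c v) * h1

end RelativeThom

/-! ### The integral of the relative Thom form -/

section RelativeIntegral

open MeasureTheory Filter

variable {V : Type*} [NormedAddCommGroup V] [InnerProductSpace ℝ V]

/-- The derivative of the radial function `radialBump` along the Euler vector field, in terms of
its profile on `ℝ`. -/
theorem fderiv_radialBump_self (x : V) :
    fderiv ℝ radialBump x x = ‖x‖ * deriv (radialBump : ℝ → ℝ) ‖x‖ := by
  have h1 : HasDerivAt (fun s : ℝ => radialBump (s • x)) (fderiv ℝ radialBump x x) 1 := by
    have h := (contDiff_radialBump (V := V)).differentiable (by simp) ((1 : ℝ) • x)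
    have hl : HasDerivAt (fun s : ℝ => s • x) x 1 := by
      simpa using (hasDerivAt_id' (1 : ℝ)).smul_const x
    have h2 := HasFDerivAt.comp_hasDerivAt (f := fun s : ℝ => s • x) (1 : ℝ) h.hasFDerivAt hl
    rw [one_smul] at h2
    exact h2
  have h2 : HasDerivAt (fun s : ℝ => radialBump (s * ‖x‖))
      (‖x‖ * deriv (radialBump : ℝ → ℝ) ‖x‖) 1 := by
    have h := (contDiff_radialBump (V := ℝ)).differentiable (by simp) (1 * ‖x‖)
    have h3 := h.hasDerivAt.comp (1 : ℝ) ((hasDerivAt_id (1 : ℝ)).mul_const ‖x‖)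
    simpa [mul_comm, Function.comp_def] using h3
  have h3 : (fun s : ℝ => radialBump (s • x)) = fun s : ℝ => radialBump (s * ‖x‖) := by
    funext s
    simp [radialBump, norm_smul]
  rw [h3] at h1
  exact h1.unique h2

variable [FiniteDimensional ℝ V] [MeasurableSpace V] [BorelSpace V] {d : ℕ}
  (e : OrthonormalBasis (Fin d) ℝ V)

/-- In polar coordinates, the integral of the radial derivative of the cutoff against
`½ Γ(d/2) ‖x‖^{-d}` is the same multiple of the area of the sphere as a Gaussian integral. -/
theorem integral_radialCoeff_mul_fderiv {n : ℕ} (hd : Module.finrank ℝ V = n + 1) :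
    ∫ x : V, radialCoeff n x * fderiv ℝ radialBump x x = -Real.pi ^ (((n + 1 : ℕ) : ℝ) / 2) := by
  have : Nontrivial V := Module.nontrivial_of_finrank_pos (R := ℝ) (by omega)
  have hG := GaussianFourier.integral_rexp_neg_mul_sq_norm (V := V) one_pos
  rw [integral_fun_norm_addHaar volume (fun r => Real.exp (-1 * r ^ 2)), hd, div_one] at hG
  have h1 : ∀ x : V, radialCoeff n x * fderiv ℝ radialBump x x =
      (fun r : ℝ => radialCoeff n r * (r * deriv (radialBump : ℝ → ℝ) r)) ‖x‖ := by
    intro x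
    rw [fderiv_radialBump_self]
    simp [radialCoeff]
  have h2 : ∫ r in Set.Ioi (0 : ℝ), r ^ (n + 1 - 1) • Real.exp (-1 * r ^ 2) =
      1 / 2 * Real.Gamma ((n + 1) / 2) := by
    have h := integral_exp_mul_pow (x := (1 : ℝ)) one_ne_zero n
    rw [radialCoeff, norm_one, one_pow, Real.one_rpow, mul_one] at h
    rw [← h]
    refine setIntegral_congr_fun measurableSet_Ioi fun r _ => ?_
    simp [mul_comm]
  have h3 : ∫ r in Set.Ioi (0 : ℝ), r ^ (n + 1 - 1) •
      (radialCoeff n r * (r * deriv (radialBump : ℝ → ℝ) r)) =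
      -(1 / 2 * Real.Gamma ((n + 1) / 2)) := by
    -- The powers of `r` cancel, and what remains is the integral of the derivative of the cutoff
    -- function, which equals minus its value at `0`.
    have h4 : ∫ r in Set.Ioi (0 : ℝ), deriv (radialBump : ℝ → ℝ) r = -1 := by
      rw [hasCompactSupport_radialBump.integral_Ioi_deriv_eq
        (contDiff_radialBump.of_le (by exact_mod_cast le_top)), radialBump_eq_one (by simp)]
    rw [← mul_neg_one, ← h4, ← integral_const_mul]
    refine setIntegral_congr_fun measurableSet_Ioi fun r hr => ?_
    have hr' : (0 : ℝ) < r := hr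
    have h5 : (r ^ 2) ^ (-((n : ℝ) + 1) / 2) * r ^ (n + 1) = 1 := by
      rw [← Real.rpow_natCast r 2, ← Real.rpow_mul hr'.le, ← Real.rpow_natCast r (n + 1),
        ← Real.rpow_add hr']
      convert Real.rpow_zero r using 2
      push_cast
      ring
    simp only [radialCoeff, smul_eq_mul, Nat.add_sub_cancel, Real.norm_of_nonneg hr'.le]
    linear_combination
      (1 / 2 * Real.Gamma ((n + 1) / 2) * deriv (radialBump : ℝ → ℝ) r) * h5
  simp_rw [h1]
  rw [integral_fun_norm_addHaar volume
    (fun r : ℝ => radialCoeff n r * (r * deriv (radialBump : ℝ → ℝ) r)), hd, h3, ← hG, h2]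
  simp

/-- The top component of `dχ ∧ β_∧` is `∓ρ_{d-1} E(χ)`, where `ρ_{d-1}` is `radialCoeff (d - 1)`,
since `dχ ∧ ι_E c = E(χ) c` for a form `c` of top degree. -/
theorem formIntegral_cutoff_formPf_formBeta (X : so V) :
    formIntegral e (cutoff radialBump (formPf e) (formBeta e) X) = epsilon d := by
  have hd : Module.finrank ℝ V = d := by
    rw [Module.finrank_eq_card_basis e.toBasis, Fintype.card_fin]
  have htop := coeffForm_top_bivectorExp e X
  rw [formIntegral]
  -- If `d = 0`, then `V` is a point, the form is the constant `1`, and the point has measure `1`,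
  -- which is the case `d = 0` of the Gaussian integral.
  rcases d with - | n
  · have : Subsingleton V := Module.finrank_zero_iff.1 hd
    have h : ∀ x : V, cutoff radialBump (formPf e) (formBeta e) X 0 x (fun k => e k) =
        Real.exp (-1 * ‖x‖ ^ 2) := by
      intro x
      have hx : ‖x‖ = 0 := by rw [Subsingleton.elim x 0, norm_zero]
      change radialBump x * formPf e X 0 x (fun k => e k) + 0 = _
      rw [formPf_zero, htop, hx, radialBump_eq_one (by rw [hx]; norm_num)]
      norm_num
    simp_rw [h]
    rw [GaussianFourier.integral_rexp_neg_mul_sq_norm one_pos, hd]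
    simp [epsilon]
  · have h : ∀ x : V, cutoff radialBump (formPf e) (formBeta e) X (n + 1) x (fun k => e k) =
        (radialCoeff n x * fderiv ℝ radialBump x x) *
          -(-1 : ℝ) ^ ((n + 1) * ((n + 1) - 1) / 2) := by
      intro x
      set c := coeffForm e (n + 1) (bivectorExp e X) with hc
      have hflip := alternatizeUncurryFin_flip_comp ((fderiv ℝ radialBump x).smulRight c) x
        ((fderiv ℝ radialBump x).smulRight (c.curryLeft x)) (fun y => by
          ext v
          simp)
      rw [alternating_eq_zero e (Nat.lt_succ_self _)
        (ContinuousAlternatingMap.alternatizeUncurryFin ((fderiv ℝ radialBump x).smulRight c))]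
        at hflip
      have hβ : ContinuousAlternatingMap.alternatizeUncurryFin
          ((fderiv ℝ radialBump x).smulRight (formBeta e X n x)) = -radialCoeff n x •
          ContinuousAlternatingMap.alternatizeUncurryFin
            ((fderiv ℝ radialBump x).smulRight (c.curryLeft x)) := by
        rw [formBeta_eq, ← ContinuousAlternatingMap.alternatizeUncurryFin_smul]
        congr 1
        ext y v
        simp
        ring
      change radialBump x * 0 + ContinuousAlternatingMap.alternatizeUncurryFin
          ((fderiv ℝ radialBump x).smulRight (formBeta e X n x)) (fun k => e k) = _
      rw [hβ, hflip, ← htop]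
      change _ + -radialCoeff n x * (fderiv ℝ radialBump x x * c (fun k => e k) - 0) = _
      ring
    simp_rw [h]
    rw [integral_mul_const, integral_radialCoeff_mul_fderiv hd, epsilon]
    ring

theorem epsilon_ne_zero (d : ℕ) : epsilon d ≠ 0 :=
  mul_ne_zero (pow_ne_zero _ (by norm_num)) (Real.rpow_pos_of_pos Real.pi_pos _).ne'

end RelativeIntegral

/-! ### The Thom classes -/

section ThomClasses

open MeasureTheory Filter

variable {V : Type*} [NormedAddCommGroup V] [InnerProductSpace ℝ V]

theorem real_smul_mem_eqForms {𝓐 : Submodule ℝ (Form V)} (c : ℝ) {α : EForm V}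
    (hα : α ∈ eqForms 𝓐) : c • α ∈ eqForms 𝓐 :=
  mem_eqForms.2 ⟨Submodule.smul_mem _ c hα.1, fun g hg X p x v =>
    congrArg (c * ·) (hα.2 g hg X p x v)⟩

theorem eqDiff_real_smul (U : TopologicalSpace.Opens V) (c : ℝ) (α : EForm V) :
    eqDiff U (c • α) = c • eqDiff U α := by
  funext X
  change dForm U (c • α X) - contract (vecField X) (c • α X) =
    c • (dForm U (α X) - contract (vecField X) (α X))
  rw [dForm_smul, contract_smul, smul_sub]

theorem restrictPunctured_real_smul (c : ℝ) (α : EForm V) :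
    restrictPunctured V (c • α) = c • restrictPunctured V α := by
  funext X p
  exact Set.indicator_const_smul _ c (α X p)

variable [FiniteDimensional ℝ V] [MeasurableSpace V] [BorelSpace V] {d : ℕ}
  (e : OrthonormalBasis (Fin d) ℝ V)

theorem formIntegral_real_smul_eq_one {α : EForm V} {X : so V}
    (h : formIntegral e (α X) = epsilon d) : formIntegral e (((epsilon d)⁻¹ • α) X) = 1 := by
  change formIntegral e ((epsilon d)⁻¹ • α X) = 1
  rw [formIntegral_smul, h, inv_mul_cancel₀ (epsilon_ne_zero d)]

end ThomClasses

end

end EquivariantThom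

open EquivariantThom
theorem mainTheorem2 {V : Type*} [NormedAddCommGroup V] [InnerProductSpace ℝ V]
    [FiniteDimensional ℝ V] [MeasurableSpace V] [BorelSpace V] {d : ℕ}
    (e : OrthonormalBasis (Fin d) ℝ V) :
    -- relative cohomology of the pair (V, V ∖ {0})
    (∃ Th : LinearMap.ker (relD V), relIncl V Th = thomRel e ∧
      IsFreeGenerator (InvPoly V) (relClass V Th) ∧
      ∃ integral : HRel V →ₗ[InvPoly V] InvPoly V,
        (∀ (z : LinearMap.ker (relD V)) (χ : V → ℝ), IsCutoff χ → ∀ X : so V,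
          (integral (relClass V z)).toFun X =
            formIntegral e (cutoff χ (relIncl V z).1 (relIncl V z).2 X)) ∧
        ∀ a : HRel V, integral a = 1 ↔ a = relClass V Th) ∧
    -- compactly supported cohomology
    (∀ χ : V → ℝ, IsCutoff χ →
      ∃ Th : LinearMap.ker (compactD V), ((Th : eqForms (compactForms V)) : EForm V) =
          thomCompact e χ ∧
        IsFreeGenerator (InvPoly V)
          (compactClass V Th) ∧
        ∃ integral : HCompact V →ₗ[InvPoly V] InvPoly V,
          (∀ (z : LinearMap.ker (compactD V)) (X : so V),
            (integral (compactClass V z)).toFun X =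
              formIntegral e (((z : eqForms (compactForms V)) : EForm V) X)) ∧
          ∀ a : HCompact V, integral a = 1 ↔
            a = compactClass V Th) ∧
    -- rapidly decreasing cohomology
    (∃ Th : LinearMap.ker (rapidD V), ((Th : eqForms (rapidForms V)) : EForm V) = thomMQ e ∧
      IsFreeGenerator (InvPoly V)
        (rapidClass V Th) ∧
      ∃ integral : HRapid V →ₗ[InvPoly V] InvPoly V,
        (∀ (z : LinearMap.ker (rapidD V)) (X : so V),
          (integral (rapidClass V z)).toFun X =
            formIntegral e (((z : eqForms (rapidForms V)) : EForm V) X)) ∧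
        ∀ a : HRapid V, integral a = 1 ↔
          a = rapidClass V Th) := 
  by
  refine ⟨?_, fun χ hχ => ?_, ?_⟩
  · let m : LinearMap.ker (relD V) := ⟨(⟨_, real_smul_mem_eqForms (epsilon d)⁻¹ (formPf_mem e)⟩,
        ⟨_, real_smul_mem_eqForms (epsilon d)⁻¹ (formBeta_mem e)⟩), mem_ker_relD.2 ⟨by
          change eqDiff ⊤ ((epsilon d)⁻¹ • formPf e) = 0
          rw [eqDiff_real_smul, eqDiff_formPf, smul_zero], by
          change restrictPunctured V ((epsilon d)⁻¹ • formPf e) =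
            eqDiff (punctured V) ((epsilon d)⁻¹ • formBeta e)
          rw [restrictPunctured_real_smul, eqDiff_real_smul, restrictPunctured_formPf]⟩⟩
    refine ⟨m, rfl, relative_cohomology e fun X => ?_⟩
    have h := cutoff_smul radialBump (fun _ => (epsilon d)⁻¹) (formPf e) (formBeta e)
    exact (congrArg (fun ψ : EForm V => formIntegral e (ψ X)) h).trans
      (formIntegral_real_smul_eq_one e (formIntegral_cutoff_formPf_formBeta e X))
  · have hD := eqDiff_cutoff hχ (formPf_mem e) (formBeta_mem e) (eqDiff_formPf e)
      (restrictPunctured_formPf e)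
    let m : LinearMap.ker (compactD V) := ⟨⟨thomCompact e χ, real_smul_mem_eqForms (epsilon d)⁻¹
      (cutoff_mem_eqForms hχ (formPf_mem e) (formBeta_mem e) (restrictPunctured_formPf e))⟩, by
        rw [LinearMap.mem_ker]
        change eqDiff ⊤ ((epsilon d)⁻¹ • cutoff χ (formPf e) (formBeta e)) = 0
        rw [eqDiff_real_smul, hD, smul_zero]⟩
    refine ⟨m, rfl, isStable_cohomology e isStable_compactForms compactForms_le_rapidForms
      (fun a ha => homotopyOp_mem_compactForms e ha) (m := m) fun X => ?_⟩
    refine formIntegral_real_smul_eq_one e ?_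
    rw [formIntegral_cutoff_eq e hχ isCutoff_radialBump (formPf_mem e) (formBeta_mem e)
      (restrictPunctured_formPf e), formIntegral_cutoff_formPf_formBeta]
  · let m : LinearMap.ker (rapidD V) :=
      ⟨⟨thomMQ e, real_smul_mem_eqForms (epsilon d)⁻¹ (formC_one_mem e)⟩, by
        rw [LinearMap.mem_ker]
        change eqDiff ⊤ ((epsilon d)⁻¹ • formC e 1) = 0
        rw [eqDiff_real_smul, eqDiff_formC_one, smul_zero]⟩
    exact ⟨m, rfl, isStable_cohomology e isStable_rapidForms le_rfl
      (fun a ha => homotopyOp_mem_rapidForms e ha) (m := m) fun X =>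
        formIntegral_real_smul_eq_one e (formIntegral_formC_one e X)⟩
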